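/- Fix integers $k\ge 2$ and $d\ge 1$. Let $V=\{0,\dots,n-1\}$ be a finite vertex set. A complete set of $k$-sets on $V$ is a pair $(\mathcal S,\overline{\mathcal S})$ of disjoint families whose union is the family of all $k$-element subsets of $V$; a simple graph $G$ on $V$ is consistent with it if $\mathcal S$ is exactly the family of $k$-subsets $X\subseteq V$ such that $G[X]$ is connected, and $\overline{\mathcal S}$ is exactly the family of $k$-subsets $X$ such that $G[X]$ is disconnected. There are an algorithm and a polynomial $B$ in two variables, both depending only on $k$ and $d$, such that for every $n\geq 0$ and every complete set of $k$-sets $(\mathcal S,\overline{\mathcal S})$ on $V$, given as $n$ together with a list of the members of $\mathcal S$ and a list of the members of $\overline{\mathcal S}$ (in any order), the algorithm halts, outputs every connected graph on $V$ of maximum degree at most $d$ that is consistent with $(\mathcal S,\overline{\mathcal S})$ exactly once and outputs no other graph (each graph is written as its adjacency matrix), and performs at most $B(|V|,N)$ elementary steps, where $N$ is the size of the output. (Elementary steps are those of a unit-cost random access machine with addition and truncated subtraction but without multiplication. The graph with no vertices does not count as connected.) -/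

import Mathlib

/-! ### Random access machines

A structured random access machine over `ℕ`: registers, arrays, a write-only output tape, addition
and truncated subtraction (no multiplication), conditionals and loops. Registers and arrays are
named by constants of the program text, so a program uses finitely many of them. Every operation
costs one step; as a step lengthens the numbers by at most one bit, polynomial time on this machine
is polynomial time in the usual sense. -/

namespace RAM

structure State where
  reg : ℕ → ℕ
  arr : ℕ → ℕ → ℕ
  out : List ℕ

inductive Expr where
  | lit (c : ℕ)
  | reg (x : ℕ)
  | get (a : ℕ) (i : Expr)
  | add (e f : Expr)
  | sub (e f : Expr)

def Expr.eval (s : State) : Expr → ℕ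
  | .lit c => c
  | .reg x => s.reg x
  | .get a i => s.arr a (i.eval s)
  | .add e f => e.eval s + f.eval s
  | .sub e f => e.eval s - f.eval s

/-- The number of elementary operations needed to evaluate an expression. -/
def Expr.cost : Expr → ℕ
  | .lit _ => 1
  | .reg _ => 1
  | .get _ i => i.cost + 1
  | .add e f => e.cost + f.cost + 1
  | .sub e f => e.cost + f.cost + 1

/-- Programs; `assign x e` is `x := e`, `store a i e` is `a[i] := e`, `emit e` appends the value of
`e` to the output, and a test `e` in `ite e p q` or `loop e p` (while) holds when `e ≠ 0`. -/
inductive Prog where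
  | nop
  | assign (x : ℕ) (e : Expr)
  | store (a : ℕ) (i e : Expr)
  | emit (e : Expr)
  | seq (p q : Prog)
  | ite (e : Expr) (p q : Prog)
  | loop (e : Expr) (p : Prog)

def State.setReg (s : State) (x v : ℕ) : State :=
  { s with reg := Function.update s.reg x v }

def State.setArr (s : State) (a i v : ℕ) : State :=
  { s with arr := Function.update s.arr a (Function.update (s.arr a) i v) }

def State.emit (s : State) (v : ℕ) : State :=
  { s with out := s.out ++ [v] }

/-- `p.Run s s' t`: started in `s`, the program `p` halts in `s'` after exactly `t` steps. -/
inductive Prog.Run : Prog → State → State → ℕ → Prop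
  | nop (s : State) : Run .nop s s 1
  | assign (s : State) (x : ℕ) (e : Expr) :
      Run (.assign x e) s (s.setReg x (e.eval s)) (e.cost + 1)
  | store (s : State) (a : ℕ) (i e : Expr) :
      Run (.store a i e) s (s.setArr a (i.eval s) (e.eval s)) (i.cost + e.cost + 1)
  | emit (s : State) (e : Expr) : Run (.emit e) s (s.emit (e.eval s)) (e.cost + 1)
  | seq {p q : Prog} {s s₁ s₂ : State} {t₁ t₂ : ℕ} :
      Run p s s₁ t₁ → Run q s₁ s₂ t₂ → Run (.seq p q) s s₂ (t₁ + t₂)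
  | ite_true {e : Expr} {p q : Prog} {s s' : State} {t : ℕ} :
      e.eval s ≠ 0 → Run p s s' t → Run (.ite e p q) s s' (e.cost + 1 + t)
  | ite_false {e : Expr} {p q : Prog} {s s' : State} {t : ℕ} :
      e.eval s = 0 → Run q s s' t → Run (.ite e p q) s s' (e.cost + 1 + t)
  | loop_true {e : Expr} {p : Prog} {s s₁ s₂ : State} {t₁ t₂ : ℕ} :
      e.eval s ≠ 0 → Run p s s₁ t₁ → Run (.loop e p) s₁ s₂ t₂ →
      Run (.loop e p) s s₂ (e.cost + 1 + t₁ + t₂)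
  | loop_false {e : Expr} {p : Prog} {s : State} :
      e.eval s = 0 → Run (.loop e p) s s (e.cost + 1)

/-- The initial state: the input word stands in array `0`, everything else is zero. -/
def initState (w : List ℕ) : State where
  reg := fun _ => 0
  arr := fun a i => if a = 0 then w.getD i 0 else 0
  out := []

end RAM

namespace KSets

variable {V : Type*}

def connectedKSets (G : SimpleGraph V) (k : ℕ) : Set (Finset V) :=
  {X | X.card = k ∧ (G.induce (X : Set V)).Connected}

def disconnectedKSets (G : SimpleGraph V) (k : ℕ) : Set (Finset V) :=
  {X | X.card = k ∧ ¬ (G.induce (X : Set V)).Connected}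

/-- `S` and `S'` (declared connected, resp. disconnected) partition the family of all `k`-subsets
of `V`. -/
def IsComplete (k : ℕ) (S S' : Finset (Finset V)) : Prop :=
  Disjoint S S' ∧ ∀ X : Finset V, X ∈ S ∨ X ∈ S' ↔ X.card = k

def Consistent (G : SimpleGraph V) (k : ℕ) (S S' : Finset (Finset V)) : Prop :=
  connectedKSets G k = (S : Set (Finset V)) ∧ disconnectedKSets G k = (S' : Set (Finset V))

/-- `L` lists every member of `S` exactly once, and each member by its elements without
repetition (in an arbitrary order). -/
def IsListing [DecidableEq V] (S : Finset (Finset V)) (L : List (List V)) : Prop :=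
  (∀ l ∈ L, l.Nodup) ∧ (L.map List.toFinset).Nodup ∧
    ∀ X : Finset V, X ∈ L.map List.toFinset ↔ X ∈ S

/-- The input word: the number of vertices, the numbers of connected and of disconnected sets, and
then the elements of all the listed sets. -/
def inputWord (n : ℕ) (L L' : List (List (Fin n))) : List ℕ :=
  n :: L.length :: L'.length :: (L.flatten ++ L'.flatten).map Fin.val

open Classical in
/-- A graph as a word: the rows of its adjacency matrix, one after the other. -/
noncomputable def graphWord {n : ℕ} (G : SimpleGraph (Fin n)) : List ℕ :=
  (List.finRange n).flatMap fun u =>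
    (List.finRange n).map fun v => if G.Adj u v then 1 else 0

end KSets

/-!
The algorithm searches the space of partial solutions. A partial solution is a connected graph of
maximum degree at most `d` on a set of active vertices, consistent with the given sets inside it.
Two facts make the search complete and its running time polynomial in the output size.

*Mixing* (`sameConn_mix`). Let `G` and `G'` have the same connected `k`-sets; then they have the same
connected sets of every larger size. Call two vertices indistinguishable if they touch the same
connected sets with at least `2 * k` elements. If a pair `v w` is an edge of just one of the two
graphs, it lies in a set of fewer than `2 * k` vertices whose boundary vertices are common neighbours
of `v` and `w` in the other graph (`exists_pod`); hence `v` and `w` are indistinguishable. Replacing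
`G` by `G'` inside one class of indistinguishable vertices, and keeping `G` elsewhere, preserves the
connected `k`-sets, and also connectivity (once there are at least `k` vertices) and the degree bound.
For bounded degree the classes have bounded size, so this changes a bounded number of pairs.

*Few changes suffice.* Mixing along a single class brings a solution strictly closer to any other
solution (`Good.exists_closer`). Mixing along the classes near a new vertex shows that a partial
solution can be extended by one vertex as soon as a full solution exists (`Good.exists_extension`). In
both cases at most `toggleBound k d` pairs change, a constant.

The program therefore keeps a list of partial solutions that starts with the empty one. For each
member of the list it tries all changes of at most `toggleBound k d` pairs and appends the new partial
solutions found, one for each number of active vertices below `n` and then all the full ones. The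
list has at most `n` members besides the full solutions, and every full solution is found
(`Explored.mem_of_good`). The time is controlled by a calculus of total correctness, `RAM.Spec`, for
programs whose loops all make at most `B` rounds: such a program takes a number of steps polynomial in
`B` (`RAM.Prog.exists_polynomial_bound`), and here `B` is at most `n ^ k + n * n + n + 1` plus the
output size.
-/

/-! ### Connectivity of vertex sets -/

namespace KSets

section Cuts

variable {V : Type*} {G G' : SimpleGraph V} {X Y W : Finset V} {x v : V}

/-- Connectivity of `G[X]` expressed by cuts: every cut of `X` into two nonempty parts is crossed by
an edge. A part is given by a predicate. -/
def ConnOn (G : SimpleGraph V) (X : Finset V) : Prop :=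
  X.Nonempty ∧ ∀ P : V → Prop, (∃ y ∈ X, P y) → (∃ z ∈ X, ¬ P z) →
    ∃ y ∈ X, ∃ z ∈ X, P y ∧ ¬ P z ∧ G.Adj y z

theorem connOn_iff_connected_induce :
    ConnOn G X ↔ (G.induce (X : Set V)).Connected := by
  constructor
  · rintro ⟨⟨x, hx⟩, h⟩
    rw [SimpleGraph.connected_iff_exists_forall_reachable]
    refine ⟨⟨x, hx⟩, ?_⟩
    by_contra hcon
    push Not at hcon
    obtain ⟨⟨w, hw⟩, hxw⟩ := hcon
    obtain ⟨y, hy, z, hz, ⟨hy', hyr⟩, hnz, hadj⟩ :=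
      h (fun y => ∃ hy : y ∈ (X : Set V), (G.induce (X : Set V)).Reachable ⟨x, hx⟩ ⟨y, hy⟩)
        ⟨x, hx, hx, SimpleGraph.Reachable.refl _⟩ ⟨w, hw, fun ⟨_, hr⟩ => hxw hr⟩
    exact hnz ⟨hz, hyr.trans (SimpleGraph.Adj.reachable (by simpa using hadj))⟩
  · intro h
    obtain ⟨⟨x, hx⟩⟩ := h.nonempty
    refine ⟨⟨x, hx⟩, ?_⟩
    rintro P ⟨y, hy, hPy⟩ ⟨z, hz, hPz⟩
    obtain ⟨p⟩ := h.preconnected ⟨y, hy⟩ ⟨z, hz⟩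
    obtain ⟨e, -, he1, he2⟩ := p.exists_boundary_dart {a | P a.1} hPy hPz
    exact ⟨e.fst.1, e.fst.2, e.snd.1, e.snd.2, he1, he2, by simpa using e.adj⟩

theorem ConnOn.singleton (G : SimpleGraph V) (x : V) : ConnOn G {x} := by
  refine ⟨⟨x, by simp⟩, ?_⟩
  rintro P ⟨y, hy, h1⟩ ⟨z, hz, h2⟩
  simp only [Finset.mem_singleton] at hy hz
  subst hy; subst hz; exact absurd h1 h2

theorem ConnOn.mono_adj (h : ConnOn G X) (hG : ∀ x ∈ X, ∀ y ∈ X, G.Adj x y → G'.Adj x y) :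
    ConnOn G' X := by
  refine ⟨h.1, fun P h1 h2 => ?_⟩
  obtain ⟨y, hy, z, hz, a, b, c⟩ := h.2 P h1 h2
  exact ⟨y, hy, z, hz, a, b, hG y hy z hz c⟩

theorem connOn_congr (hG : ∀ x ∈ X, ∀ y ∈ X, G.Adj x y ↔ G'.Adj x y) :
    ConnOn G X ↔ ConnOn G' X :=
  ⟨fun h => h.mono_adj fun x hx y hy => (hG x hx y hy).1,
    fun h => h.mono_adj fun x hx y hy => (hG x hx y hy).2⟩

/-- A member of a connected set with at least two elements has a neighbour in the set. -/
theorem ConnOn.exists_adj (h : ConnOn G X) {x y : V} (hx : x ∈ X) (hy : y ∈ X) (hxy : y ≠ x) :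
    ∃ z ∈ X, G.Adj x z := by
  obtain ⟨a, -, z, hz, rfl, -, hadj⟩ := h.2 (fun a => a = x) ⟨x, hx, rfl⟩ ⟨y, hy, hxy⟩
  exact ⟨z, hz, hadj⟩

/-- `G` and `G'` have the same connected `k`-sets. -/
def SameConn (k : ℕ) (G G' : SimpleGraph V) : Prop :=
  ∀ X : Finset V, X.card = k → (ConnOn G X ↔ ConnOn G' X)

theorem SameConn.symm {k : ℕ} (h : SameConn k G G') : SameConn k G' G := fun X hX => (h X hX).symm

theorem SameConn.trans {k : ℕ} {G'' : SimpleGraph V} (h : SameConn k G G')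
    (h' : SameConn k G' G'') : SameConn k G G'' := fun X hX => (h X hX).trans (h' X hX)

variable [DecidableEq V]

theorem ConnOn.union (hX : ConnOn G X) (hY : ConnOn G Y) (hx : x ∈ X) (hy : x ∈ Y) :
    ConnOn G (X ∪ Y) := by
  refine ⟨⟨x, by simp [hx]⟩, ?_⟩
  have key : ∀ Z, ConnOn G Z → x ∈ Z → Z ⊆ X ∪ Y → ∀ P : V → Prop,
      ((P x ∧ ∃ z ∈ Z, ¬ P z) ∨ (¬ P x ∧ ∃ z ∈ Z, P z)) →
      ∃ y ∈ X ∪ Y, ∃ z ∈ X ∪ Y, P y ∧ ¬ P z ∧ G.Adj y z := by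
    intro Z hZ hxZ hsub P hP
    obtain ⟨y, hy, z, hz, h⟩ : ∃ y ∈ Z, ∃ z ∈ Z, P y ∧ ¬ P z ∧ G.Adj y z := by
      rcases hP with ⟨h1, h2⟩ | ⟨h1, h2⟩
      · exact hZ.2 P ⟨x, hxZ, h1⟩ h2
      · exact hZ.2 P h2 ⟨x, hxZ, h1⟩
    exact ⟨y, hsub hy, z, hsub hz, h⟩
  rintro P ⟨y, hyu, hPy⟩ ⟨z, hzu, hPz⟩
  rw [Finset.mem_union] at hyu hzu
  by_cases hPx : P x
  · rcases hzu with h | h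
    · exact key X hX hx Finset.subset_union_left P (.inl ⟨hPx, z, h, hPz⟩)
    · exact key Y hY hy Finset.subset_union_right P (.inl ⟨hPx, z, h, hPz⟩)
  · rcases hyu with h | h
    · exact key X hX hx Finset.subset_union_left P (.inr ⟨hPx, y, h, hPy⟩)
    · exact key Y hY hy Finset.subset_union_right P (.inr ⟨hPx, y, h, hPy⟩)

theorem ConnOn.pair {x y : V} (h : G.Adj x y) : ConnOn G {x, y} := by
  refine ⟨⟨x, by simp⟩, ?_⟩
  rintro P ⟨a, ha, hPa⟩ ⟨b, hb, hPb⟩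
  refine ⟨a, ha, b, hb, hPa, hPb, ?_⟩
  simp only [Finset.mem_insert, Finset.mem_singleton] at ha hb
  rcases ha with rfl | rfl <;> rcases hb with rfl | rfl
  · exact absurd hPa hPb
  · exact h
  · exact h.symm
  · exact absurd hPa hPb

theorem ConnOn.insert (h : ConnOn G X) (hx : x ∈ X) (hadj : G.Adj v x) :
    ConnOn G (insert v X) := by
  have := (ConnOn.pair hadj).union h (x := x) (by simp) hx
  convert this using 1
  ext a; simp only [Finset.mem_insert, Finset.mem_union, Finset.mem_singleton]
  constructor
  · tauto
  · rintro ((h | rfl) | h) <;> tauto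

/-- A vertex can be added to a connected set iff it belongs to it or has a neighbour in it. -/
theorem ConnOn.insert_iff (h : ConnOn G W) :
    ConnOn G (Insert.insert v W) ↔ v ∈ W ∨ ∃ w ∈ W, G.Adj v w := by
  constructor
  · intro hi
    by_cases hv : v ∈ W
    · exact .inl hv
    · obtain ⟨w, hw⟩ := h.1
      obtain ⟨z, hz, hadj⟩ := hi.exists_adj (x := v) (y := w) (by simp) (by simp [hw])
        (fun e => hv (e ▸ hw))
      rcases Finset.mem_insert.1 hz with rfl | hz
      · exact absurd hadj (G.loopless.irrefl _)
      · exact .inr ⟨z, hz, hadj⟩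
  · rintro (hv | ⟨w, hw, hadj⟩)
    · rwa [Finset.insert_eq_of_mem hv]
    · exact h.insert hw hadj

theorem ConnOn.exists_subset_card (h : ConnOn G X) (hx : x ∈ X) {m : ℕ} (hm : 1 ≤ m)
    (hmX : m ≤ X.card) : ∃ Y ⊆ X, x ∈ Y ∧ Y.card = m ∧ ConnOn G Y := by
  induction m, hm using Nat.le_induction with
  | base => exact ⟨{x}, by simpa using hx, by simp, by simp, ConnOn.singleton G x⟩
  | succ m hm ih =>
    obtain ⟨Y, hYX, hxY, hcard, hY⟩ := ih (by omega)
    obtain ⟨z, hz, hzY⟩ : ∃ z ∈ X, z ∉ Y := by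
      by_contra hcon
      push Not at hcon
      have := Finset.card_le_card (s := X) (t := Y) hcon
      omega
    obtain ⟨a, ha, b, hb, haY, hbY, hadj⟩ := h.2 (· ∈ Y) ⟨x, hx, hxY⟩ ⟨z, hz, hzY⟩
    exact ⟨Insert.insert b Y, Finset.insert_subset hb hYX, by simp [hxY],
      by rw [Finset.card_insert_of_notMem hbY, hcard], hY.insert haY hadj.symm⟩

/-- The connected component of `x` in `G[X]`. -/
theorem exists_component (G : SimpleGraph V) (hx : x ∈ X) :
    ∃ A ⊆ X, x ∈ A ∧ ConnOn G A ∧ ∀ a ∈ A, ∀ z ∈ X, z ∉ A → ¬ G.Adj a z := by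
  classical
  obtain ⟨A, hA, hmax⟩ := Finset.exists_max_image
    (X.powerset.filter fun A => x ∈ A ∧ ConnOn G A) Finset.card
    ⟨{x}, by simp [hx, ConnOn.singleton]⟩
  simp only [Finset.mem_filter, Finset.mem_powerset] at hA hmax
  refine ⟨A, hA.1, hA.2.1, hA.2.2, fun a ha z hz hzA hadj => ?_⟩
  have := hmax (Insert.insert z A)
    ⟨Finset.insert_subset hz hA.1, by simp [hA.2.1], hA.2.2.insert ha hadj.symm⟩
  rw [Finset.card_insert_of_notMem hzA] at this
  omega

/-! ### Graphs with the same connected `k`-sets -/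

/-- A set with `m + 1 ≥ 3` elements is connected iff it has two distinct connected subsets with `m`
elements, so the connected `m`-sets determine the connected `(m + 1)`-sets. -/
theorem SameConn.succ {m : ℕ} (hm : 2 ≤ m) (h : SameConn m G G') : SameConn (m + 1) G G' := by
  have key : ∀ {G G' : SimpleGraph V}, SameConn m G G' → ∀ X : Finset V, X.card = m + 1 →
      ConnOn G X → ConnOn G' X := by
    intro G G' h X hX hG
    obtain ⟨x, hx⟩ := hG.1
    obtain ⟨A, hAX, -, hAc, hA⟩ := hG.exists_subset_card hx (m := m) (by omega) (by omega)
    obtain ⟨a, haX, haA⟩ : ∃ a ∈ X, a ∉ A := by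
      by_contra hcon
      push Not at hcon
      have := Finset.card_le_card (s := X) (t := A) hcon
      omega
    obtain ⟨B, hBX, haB, hBc, hB⟩ := hG.exists_subset_card haX (m := m) (by omega) (by omega)
    have hXA : X = Insert.insert a A := by
      symm
      apply Finset.eq_of_subset_of_card_le (Finset.insert_subset haX hAX)
      rw [Finset.card_insert_of_notMem haA]; omega
    have hAB : X = A ∪ B := by
      apply Finset.Subset.antisymm _ (Finset.union_subset hAX hBX)
      rw [hXA]
      exact Finset.insert_subset (by simp [haB]) Finset.subset_union_left
    obtain ⟨b, hbB, hba⟩ : ∃ b ∈ B, b ≠ a := by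
      apply Finset.exists_mem_ne; omega
    have hbA : b ∈ A := by
      have := hBX hbB
      rw [hXA, Finset.mem_insert] at this
      tauto
    rw [hAB]
    exact ((h A hAc).1 hA).union ((h B hBc).1 hB) hbA hbB
  exact fun X hX => ⟨key h X hX, key h.symm X hX⟩

theorem SameConn.of_le {k m : ℕ} (hk : 2 ≤ k) (h : SameConn k G G') (hm : k ≤ m) :
    SameConn m G G' := by
  induction m, hm using Nat.le_induction with
  | base => exact h
  | succ m hm ih => exact ih.succ (by omega)

theorem SameConn.connOn_iff {k : ℕ} (hk : 2 ≤ k) (h : SameConn k G G') (hX : k ≤ X.card) :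
    ConnOn G X ↔ ConnOn G' X := h.of_le hk hX X rfl

end Cuts

end KSets

/-! ### Indistinguishable vertices and mixing of graphs -/

namespace KSets

section Mix

variable {V : Type*} {G G' : SimpleGraph V} {k : ℕ} {v w x y z : V} {W : Finset V}

/-- The graph that agrees with `G'` on the pairs inside `Q` and with `G` on all other pairs. -/
def mix (G G' : SimpleGraph V) (Q : Set V) : SimpleGraph V where
  Adj x y := ((x ∈ Q ∧ y ∈ Q) ∧ G'.Adj x y) ∨ (¬ (x ∈ Q ∧ y ∈ Q) ∧ G.Adj x y)
  symm := ⟨fun x y h => by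
    rwa [and_comm (a := y ∈ Q), G'.adj_comm y x, G.adj_comm y x]⟩
  loopless := ⟨fun x h => by simp at h⟩

theorem mix_adj_of_mem {Q : Set V} (h : x ∈ Q ∧ y ∈ Q) : (mix G G' Q).Adj x y ↔ G'.Adj x y := by
  simp only [mix, h, and_self, true_and, not_true_eq_false, false_and, or_false]

theorem mix_adj_of_not_mem {Q : Set V} (h : ¬ (x ∈ Q ∧ y ∈ Q)) :
    (mix G G' Q).Adj x y ↔ G.Adj x y := by
  simp only [mix, h, not_false_eq_true, true_and, false_and, false_or]

theorem mem_of_not_mix_adj {Q : Set V} (h : G.Adj x y) (hn : ¬ (mix G G' Q).Adj x y) :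
    (x ∈ Q ∧ y ∈ Q) ∧ ¬ G'.Adj x y := by
  by_cases hm : x ∈ Q ∧ y ∈ Q
  · exact ⟨hm, by rwa [mix_adj_of_mem hm] at hn⟩
  · exact absurd ((mix_adj_of_not_mem hm).2 h) hn

theorem not_mem_of_not_mix_adj {Q : Set V} (h : G'.Adj x y) (hn : ¬ (mix G G' Q).Adj x y) :
    ¬ (x ∈ Q ∧ y ∈ Q) ∧ ¬ G.Adj x y := by
  by_cases hm : x ∈ Q ∧ y ∈ Q
  · exact absurd ((mix_adj_of_mem hm).2 h) hn
  · exact ⟨hm, by rwa [mix_adj_of_not_mem hm] at hn⟩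

theorem mem_of_mix_adj {Q : Set V} (h : (mix G G' Q).Adj x y) (hn : ¬ G.Adj x y) :
    (x ∈ Q ∧ y ∈ Q) ∧ G'.Adj x y := by
  by_cases hm : x ∈ Q ∧ y ∈ Q
  · exact ⟨hm, (mix_adj_of_mem hm).1 h⟩
  · exact absurd ((mix_adj_of_not_mem hm).1 h) hn

theorem not_mem_of_mix_adj {Q : Set V} (h : (mix G G' Q).Adj x y) (hn : ¬ G'.Adj x y) :
    ¬ (x ∈ Q ∧ y ∈ Q) ∧ G.Adj x y := by
  by_cases hm : x ∈ Q ∧ y ∈ Q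
  · exact absurd ((mix_adj_of_mem hm).1 h) hn
  · exact ⟨hm, (mix_adj_of_not_mem hm).1 h⟩

variable [DecidableEq V]

/-- `x` and `y` are adjacent to (or contained in) the same large connected sets. As only sets with
at least `2 * k` elements are involved, the relation depends on the connected `k`-sets only. -/
def Indist (k : ℕ) (G : SimpleGraph V) (x y : V) : Prop :=
  ∀ W : Finset V, 2 * k ≤ W.card → ConnOn G W →
    (ConnOn G (insert x W) ↔ ConnOn G (insert y W))

theorem Indist.refl (k : ℕ) (G : SimpleGraph V) (x : V) : Indist k G x x := fun _ _ _ => Iff.rfl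

theorem Indist.symm (h : Indist k G x y) : Indist k G y x := fun W h1 h2 => (h W h1 h2).symm

theorem Indist.trans (h : Indist k G x y) (h' : Indist k G y z) : Indist k G x z :=
  fun W h1 h2 => (h W h1 h2).trans (h' W h1 h2)

theorem SameConn.connOn_insert_iff (hk : 2 ≤ k) (h : SameConn k G G') (hW : 2 * k ≤ W.card) :
    ConnOn G (insert x W) ↔ ConnOn G' (insert x W) := by
  apply h.connOn_iff hk
  have := Finset.card_le_card (Finset.subset_insert x W)
  omega

theorem Indist.congr (hk : 2 ≤ k) (h : SameConn k G G') (hi : Indist k G x y) :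
    Indist k G' x y := fun W h1 h2 => by
  rw [← h.connOn_insert_iff hk h1, ← h.connOn_insert_iff hk h1]
  exact hi W h1 ((h.connOn_iff hk (by omega)).2 h2)

theorem indist_congr (hk : 2 ≤ k) (h : SameConn k G G') : Indist k G x y ↔ Indist k G' x y :=
  ⟨Indist.congr hk h, Indist.congr hk h.symm⟩

/-- The component of `w` among the non-neighbours of `v` is small: a connected `k`-set in it
together with `v` would tell the two graphs apart. -/
theorem exists_half_pod [Fintype V] (hk : 2 ≤ k) (h : SameConn k G G') (hadj : G'.Adj v w)
    (hnadj : ¬ G.Adj v w) :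
    ∃ C : Finset V, w ∈ C ∧ C.card < k ∧ ∀ c ∈ C, ∀ z ∉ C, G.Adj c z → G.Adj z v := by
  classical
  obtain ⟨C, hCX, hwC, hC, hmax⟩ := exists_component G
    (X := Finset.univ.filter fun z => ¬ G.Adj v z) (x := w) (by simpa using hnadj)
  refine ⟨C, hwC, ?_, ?_⟩
  · by_contra hcard
    obtain ⟨C', hC'C, hwC', hcard', hC'⟩ :=
      hC.exists_subset_card hwC (m := k) (by omega) (by omega)
    have hno : ∀ c ∈ C', ¬ G.Adj v c := fun c hc => by simpa using hCX (hC'C hc)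
    have hC'' := ((h C' hcard').1 hC').insert hwC' hadj
    rw [← h.connOn_iff hk (by have := Finset.card_le_card (Finset.subset_insert v C'); omega),
      hC'.insert_iff] at hC''
    rcases hC'' with hv | ⟨c, hc, hvc⟩
    · obtain ⟨z, hz, hvz⟩ := hC'.exists_adj hv hwC' hadj.ne'
      exact hno z hz hvz
    · exact hno c hc hvc
  · intro c hc z hz hcz
    by_contra hzv
    exact hmax c hc z (by simpa using fun e : G.Adj v z => hzv e.symm) hz hcz

/-- A pair `v w` that is an edge of `G'` but not of `G` lies in a small set `U` all of whose
boundary vertices are common neighbours of `v` and `w` in `G`. -/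
theorem exists_pod [Fintype V] (hk : 2 ≤ k) (h : SameConn k G G') (hadj : G'.Adj v w)
    (hnadj : ¬ G.Adj v w) :
    ∃ U : Finset V, v ∈ U ∧ w ∈ U ∧ U.card < 2 * k ∧
      ∀ u ∈ U, ∀ z ∉ U, G.Adj u z → G.Adj z v ∧ G.Adj z w := by
  obtain ⟨C, hwC, hCk, hC⟩ := exists_half_pod hk h hadj hnadj
  obtain ⟨D, hvD, hDk, hD⟩ := exists_half_pod hk h hadj.symm (fun e => hnadj e.symm)
  refine ⟨C ∪ D, by simp [hvD], by simp [hwC], ?_, ?_⟩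
  · have := Finset.card_union_le C D
    omega
  · intro u hu z hz huz
    simp only [Finset.mem_union, not_or] at hu hz
    rcases hu with hu | hu
    · have h1 := hC u hu z hz.1 huz
      exact ⟨h1, hD v hvD z hz.2 h1.symm⟩
    · have h1 := hD u hu z hz.2 huz
      exact ⟨hC w hwC z hz.1 h1.symm, h1⟩

/-- A large connected set that touches the set `U` of `exists_pod` contains a boundary vertex. -/
theorem connOn_insert_of_pod {U : Finset V} {u : V} (hU : U.card < 2 * k)
    (hb : ∀ u ∈ U, ∀ z ∉ U, G.Adj u z → G.Adj z v ∧ G.Adj z w) (hu : u ∈ U)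
    (hW : 2 * k ≤ W.card) (hc : ConnOn G W) (ht : ConnOn G (insert u W)) :
    ConnOn G (insert v W) ∧ ConnOn G (insert w W) := by
  obtain ⟨z, hz, hzv, hzw⟩ : ∃ z ∈ W, G.Adj z v ∧ G.Adj z w := by
    obtain ⟨z, hzW, hzU⟩ : ∃ z ∈ W, z ∉ U := by
      by_contra hcon
      push Not at hcon
      have := Finset.card_le_card (s := W) (t := U) hcon
      omega
    by_cases hWU : ∃ a ∈ W, a ∈ U
    · obtain ⟨a, -, b, hb', haU, hbU, hadj⟩ := hc.2 (· ∈ U) hWU ⟨z, hzW, hzU⟩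
      exact ⟨b, hb', hb a haU b hbU hadj⟩
    · push Not at hWU
      rcases hc.insert_iff.1 ht with h1 | ⟨b, hbW, hadj⟩
      · exact absurd hu (hWU u h1)
      · exact ⟨b, hbW, hb u hu b (hWU b hbW) hadj⟩
  exact ⟨hc.insert hz hzv.symm, hc.insert hz hzw.symm⟩

theorem indist_of_adj_of_not_adj [Fintype V] (hk : 2 ≤ k) (h : SameConn k G G')
    (hadj : G'.Adj v w) (hnadj : ¬ G.Adj v w) : Indist k G v w := by
  obtain ⟨U, hv, hw, hU, hb⟩ := exists_pod hk h hadj hnadj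
  exact fun W h1 h2 => ⟨fun ht => (connOn_insert_of_pod hU hb hv h1 h2 ht).2,
    fun ht => (connOn_insert_of_pod hU hb hw h1 h2 ht).1⟩

/-- Two graphs with the same connected `k`-sets differ only in pairs of indistinguishable
vertices. -/
theorem indist_of_not_iff [Fintype V] (hk : 2 ≤ k) (h : SameConn k G G')
    (hne : ¬ (G.Adj v w ↔ G'.Adj v w)) : Indist k G v w := by
  by_cases h1 : G.Adj v w
  · exact (indist_congr hk h).2 (indist_of_adj_of_not_adj hk h.symm h1 (by tauto))
  · exact indist_of_adj_of_not_adj hk h (by tauto) h1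

/-- If a set is connected in `M` but not in `G`, then every member `x` of the set has a companion
`v` in the set, incident to an edge of `M` that is missing in `G`, such that every large connected
set touching `x` touches `v`. -/
theorem exists_touching [Fintype V] (hk : 2 ≤ k) (h : SameConn k G G') {M : SimpleGraph V}
    {X : Finset V} (R : V → Prop) (hM : ConnOn M X) (hG : ¬ ConnOn G X)
    (hR : ∀ v w, M.Adj v w → ¬ G.Adj v w → G'.Adj v w ∧ R v) (hx : x ∈ X) :
    ∃ v ∈ X, R v ∧ ∀ W : Finset V, 2 * k ≤ W.card → ConnOn G W →
      ConnOn G (insert x W) → ConnOn G (insert v W) := by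
  obtain ⟨A, hAX, hxA, hA, hmax⟩ := exists_component G hx
  obtain ⟨z, hzX, hzA⟩ : ∃ z ∈ X, z ∉ A := by
    by_contra hcon
    push Not at hcon
    exact hG ((Finset.Subset.antisymm hAX hcon) ▸ hA)
  obtain ⟨v, hv, w, hw, hvA, hwA, hvw⟩ := hM.2 (· ∈ A) ⟨x, hx, hxA⟩ ⟨z, hzX, hzA⟩
  obtain ⟨hadj, hRv⟩ := hR v w hvw (hmax v hvA w hw hwA)
  obtain ⟨U, hvU, hwU, hU, hb⟩ := exists_pod hk h hadj (hmax v hvA w hw hwA)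
  have hxU : x ∈ U := by
    by_contra hxU
    obtain ⟨a, -, b, hbA, haU, hbU, hab⟩ := hA.2 (· ∈ U) ⟨v, hvA, hvU⟩ ⟨x, hxA, hxU⟩
    exact hmax b hbA w hw hwA (hb a haU b hbU hab).2
  exact ⟨v, hv, hRv, fun W h1 h2 h3 => (connOn_insert_of_pod hU hb hxU h1 h2 h3).1⟩

/-- Replacing `G` by `G'` inside one class of indistinguishable vertices does not change the
connected `k`-sets. -/
theorem sameConn_mix [Fintype V] (hk : 2 ≤ k) (h : SameConn k G G') (q : V) :
    SameConn k G (mix G G' {y | Indist k G q y}) := by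
  set Q : Set V := {y | Indist k G q y} with hQ
  set M := mix G G' Q with hMdef
  have hmem : ∀ {x y}, Indist k G x y → x ∈ Q → y ∈ Q := fun hi hx => Indist.trans hx hi
  have hmem' : ∀ {x y}, G.Adj x y → ¬ G'.Adj x y → (x ∈ Q ↔ y ∈ Q) := fun h1 h2 =>
    have hi := (indist_congr hk h).2 (indist_of_adj_of_not_adj hk h.symm h1 h2)
    ⟨hmem hi, hmem hi.symm⟩
  have hmem'' : ∀ {x y}, G'.Adj x y → ¬ G.Adj x y → (x ∈ Q ↔ y ∈ Q) := fun h1 h2 =>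
    have hi := indist_of_adj_of_not_adj hk h h1 h2
    ⟨hmem hi, hmem hi.symm⟩
  have htouch : ∀ {W : Finset V} {x : V}, 2 * k ≤ W.card →
      (ConnOn G (insert x W) ↔ ConnOn G' (insert x W)) :=
    fun hW => h.connOn_insert_iff hk hW
  intro X hXk
  constructor
  · -- A cut of `X` that no edge of `M` crosses is crossed by an edge `v w` of `G` inside `Q` and by
    -- an edge `v' w'` of `G'` outside `Q`. The sets `U` and `U'` belonging to these pairs by
    -- `exists_pod` both contain `X`, which makes `v` and `v'` indistinguishable.
    intro hGX
    have hGX' := (h X hXk).1 hGX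
    by_contra hMX
    simp only [ConnOn, hGX.1, true_and, not_forall] at hMX
    obtain ⟨P, hP1, hP2, hP⟩ := hMX
    push Not at hP
    obtain ⟨v, hv, w, hw, hPv, hPw, hvw⟩ := hGX.2 P hP1 hP2
    obtain ⟨v', hv', w', hw', hPv', hPw', hvw'⟩ := hGX'.2 P hP1 hP2
    obtain ⟨hQvw, hnG'⟩ := mem_of_not_mix_adj hvw (hP v hv w hw hPv hPw)
    obtain ⟨hn, hnG⟩ := not_mem_of_not_mix_adj hvw' (hP v' hv' w' hw' hPv' hPw')
    have hiff := hmem'' hvw' hnG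
    have hvQ' : v' ∉ Q := fun e => hn ⟨e, hiff.1 e⟩
    have hwQ' : w' ∉ Q := fun e => hn ⟨hiff.2 e, e⟩
    obtain ⟨U, hvU, hwU, hU, hb⟩ := exists_pod hk h.symm hvw hnG'
    obtain ⟨U', hvU', hwU', hU', hb'⟩ := exists_pod hk h hvw' hnG
    have hXU : ∀ x ∈ X, x ∈ U := by
      intro x hx
      by_contra hxU
      obtain ⟨a, -, z, hz, haU, hzU, haz⟩ := hGX'.2 (· ∈ U) ⟨v, hv, hvU⟩ ⟨x, hx, hxU⟩
      obtain ⟨hzv, hzw⟩ := hb a haU z hzU haz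
      by_cases hPz : P z
      · obtain ⟨h3, h4⟩ := not_mem_of_not_mix_adj hzw (hP z hz w hw hPz hPw)
        exact h3 ⟨(hmem'' hzw h4).2 hQvw.2, hQvw.2⟩
      · obtain ⟨h3, h4⟩ := not_mem_of_not_mix_adj hzv.symm (hP v hv z hz hPv hPz)
        exact h3 ⟨hQvw.1, (hmem'' hzv.symm h4).1 hQvw.1⟩
    have hXU' : ∀ x ∈ X, x ∈ U' := by
      intro x hx
      by_contra hxU
      obtain ⟨a, -, z, hz, haU, hzU, haz⟩ := hGX.2 (· ∈ U') ⟨v', hv', hvU'⟩ ⟨x, hx, hxU⟩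
      obtain ⟨hzv, hzw⟩ := hb' a haU z hzU haz
      by_cases hPz : P z
      · exact hwQ' (mem_of_not_mix_adj hzw (hP z hz w' hw' hPz hPw')).1.2
      · exact hvQ' (mem_of_not_mix_adj hzv.symm (hP v' hv' z hz hPv' hPz)).1.1
    refine hvQ' (hmem (x := v) (fun W h1 h2 => ⟨fun ht => ?_, fun ht => ?_⟩) hQvw.1)
    · exact (connOn_insert_of_pod hU' hb' (hXU' v hv) h1 h2 ht).1
    · rw [htouch h1] at ht ⊢
      exact (connOn_insert_of_pod hU hb (hXU v' hv') h1
        ((h.connOn_iff hk (by omega)).1 h2) ht).1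
  · -- If `X` is connected in `M` only, then every member of `X` has a companion in `Q` with respect
    -- to `G` and one outside `Q` with respect to `G'`. Alternating between the two, `v₁ ∈ Q`,
    -- `v₂ ∉ Q`, `v₃ ∈ Q`, large connected sets touching `v₁` touch `v₂`, those touching `v₂` touch
    -- `v₃`, and `v₃` is indistinguishable from `v₁`; hence `v₂` is indistinguishable from `v₁`.
    intro hMX
    by_contra hGX
    have hGX' : ¬ ConnOn G' X := fun e => hGX ((h X hXk).2 e)
    have hφ := fun x (hx : x ∈ X) => exists_touching hk h (· ∈ Q) hMX hGX
      (fun v w h1 h2 => ⟨(mem_of_mix_adj h1 h2).2, (mem_of_mix_adj h1 h2).1.1⟩) hx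
    have hψ := fun x (hx : x ∈ X) => exists_touching hk h.symm (· ∉ Q) hMX hGX'
      (fun v w h1 h2 =>
        have h3 := not_mem_of_mix_adj h1 h2
        ⟨h3.2, fun hv => h3.1 ⟨hv, (hmem' h3.2 h2).1 hv⟩⟩) hx
    obtain ⟨x, hx⟩ := hMX.1
    obtain ⟨v₁, hv₁, hQ₁, -⟩ := hφ x hx
    obtain ⟨v₂, hv₂, hQ₂, ht₂⟩ := hψ v₁ hv₁
    obtain ⟨v₃, hv₃, hQ₃, ht₃⟩ := hφ v₂ hv₂
    have h31 : Indist k G v₃ v₁ := Indist.trans (Indist.symm hQ₃) hQ₁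
    refine hQ₂ (hmem (x := v₁) (fun W h1 h2 => ⟨fun ht => ?_, fun ht => ?_⟩) hQ₁)
    · rw [htouch h1] at ht ⊢
      exact ht₂ W h1 ((h.connOn_iff hk (by omega)).1 h2) ht
    · exact (h31 W h1 h2).1 (ht₃ W h1 h2 ht)

end Mix

end KSets

/-! ### Configurations -/

namespace KSets

section Cuts

variable {V : Type*} [DecidableEq V] {G G' : SimpleGraph V} {X Y : Finset V} {v : V}

theorem ConnOn.exists_between (h : ConnOn G X) (hY : ConnOn G Y) (hYX : Y ⊆ X) {m : ℕ}
    (hm : Y.card ≤ m) (hmX : m ≤ X.card) : ∃ Z ⊆ X, Y ⊆ Z ∧ Z.card = m ∧ ConnOn G Z := by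
  induction m, hm using Nat.le_induction with
  | base => exact ⟨Y, hYX, Finset.Subset.refl _, rfl, hY⟩
  | succ m hm ih =>
    obtain ⟨Z, hZX, hYZ, hcard, hZ⟩ := ih (by omega)
    obtain ⟨z, hz, hzZ⟩ := Finset.exists_mem_notMem_of_card_lt_card (s := Z) (t := X) (by omega)
    obtain ⟨y, hy⟩ := hZ.1
    obtain ⟨a, -, b, hb, haZ, hbZ, hadj⟩ := h.2 (· ∈ Z) ⟨y, hZX hy, hy⟩ ⟨z, hz, hzZ⟩
    exact ⟨Insert.insert b Z, Finset.insert_subset hb hZX,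
      hYZ.trans (Finset.subset_insert _ _),
      by rw [Finset.card_insert_of_notMem hbZ, hcard], hZ.insert haZ hadj.symm⟩

/-- A connected set is exhausted by an increasing sequence of sets as soon as the edges inside it
lead from each member of the sequence to the next one. -/
theorem ConnOn.subset_of_step (h : ConnOn G X) (B : ℕ → Finset V) (hv : v ∈ X) (hvB : v ∈ B 0)
    (hmono : Monotone B)
    (hstep : ∀ i < X.card, ∀ x ∈ X, x ∈ B i → ∀ y ∈ X, G.Adj x y → y ∈ B (i + 1)) :
    X ⊆ B X.card := by
  have key : ∀ i ≤ X.card, X ⊆ B i ∨ i + 1 ≤ (X ∩ B i).card := by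
    intro i
    induction i with
    | zero => exact fun _ => .inr (Finset.card_pos.2 ⟨v, by simp [hv, hvB]⟩)
    | succ i ih =>
      intro hi
      by_cases hX : X ⊆ B i
      · exact .inl (hX.trans (hmono (Nat.le_succ i)))
      · right
        have hcard := (ih (by omega)).resolve_left hX
        obtain ⟨z, hzX, hz⟩ := Finset.not_subset.1 hX
        obtain ⟨a, ha, b, hb, haB, hbB, hadj⟩ :=
          h.2 (· ∈ B i) ⟨v, hv, hmono (Nat.zero_le i) hvB⟩ ⟨z, hzX, hz⟩
        have hlt : X ∩ B i ⊂ X ∩ B (i + 1) := by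
          rw [Finset.ssubset_iff_of_subset
            (Finset.inter_subset_inter_left (hmono (Nat.le_succ i)))]
          exact ⟨b, by simp [hb, hstep i (by omega) a ha haB b hb hadj], by simp [hbB]⟩
        have := Finset.card_lt_card hlt
        omega
  rcases key _ le_rfl with h1 | h1
  · exact h1
  · have := Finset.card_le_card (Finset.inter_subset_left : X ∩ B X.card ⊆ X)
    omega

end Cuts

variable {V : Type*}

/-- The graph of a configuration. A graph on a set of active vertices is encoded by one set of
unordered pairs, its configuration: the loops mark the active vertices, and the other pairs are the
edges. Activating a vertex and changing an edge thus both amount to changing one pair. -/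
def graph (E : Finset (Sym2 V)) : SimpleGraph V where
  Adj x y := s(x, y) ∈ E ∧ x ≠ y
  symm := ⟨fun x _ h => ⟨Sym2.eq_swap (a := x) ▸ h.1, h.2.symm⟩⟩
  loopless := ⟨fun _ h => h.2 rfl⟩

theorem graph_adj {E : Finset (Sym2 V)} {x y : V} :
    (graph E).Adj x y ↔ s(x, y) ∈ E ∧ x ≠ y := Iff.rfl

section Config

variable [DecidableEq V]

open Classical in
/-- The configuration with active set `A` and with the edges of `G[A]`. -/
noncomputable def config (G : SimpleGraph V) (A : Finset V) : Finset (Sym2 V) :=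
  ((A ×ˢ A).filter fun p => p.1 = p.2 ∨ G.Adj p.1 p.2).image fun p => s(p.1, p.2)

theorem mem_config {G : SimpleGraph V} {A : Finset V} {x y : V} :
    s(x, y) ∈ config G A ↔ x ∈ A ∧ y ∈ A ∧ (x = y ∨ G.Adj x y) := by
  simp only [config, Finset.mem_image, Finset.mem_filter, Finset.mem_product, Prod.exists,
    Sym2.eq_iff]
  constructor
  · rintro ⟨a, b, ⟨⟨ha, hb⟩, h⟩, ⟨rfl, rfl⟩ | ⟨rfl, rfl⟩⟩
    · exact ⟨ha, hb, h⟩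
    · exact ⟨hb, ha, h.imp Eq.symm fun e => e.symm⟩
  · rintro ⟨hx, hy, h⟩
    exact ⟨x, y, ⟨⟨hx, hy⟩, h⟩, .inl ⟨rfl, rfl⟩⟩

theorem graph_config_adj {G : SimpleGraph V} {A : Finset V} {x y : V} :
    (graph (config G A)).Adj x y ↔ x ∈ A ∧ y ∈ A ∧ G.Adj x y := by
  rw [graph_adj, mem_config]
  constructor
  · rintro ⟨⟨h1, h2, h3⟩, h4⟩
    exact ⟨h1, h2, h3.resolve_left h4⟩
  · rintro ⟨h1, h2, h3⟩
    exact ⟨⟨h1, h2, .inr h3⟩, h3.ne⟩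

theorem graph_config_eq {G : SimpleGraph V} {A : Finset V} (h : ∀ x y, G.Adj x y → x ∈ A) :
    graph (config G A) = G := by
  ext x y
  rw [graph_config_adj]
  exact ⟨fun h' => h'.2.2, fun h' => ⟨h x y h', h y x h'.symm, h'⟩⟩

end Config

variable [Fintype V]

open Classical in
/-- Every vertex has at most `d` neighbours. -/
def MaxDegLE (d : ℕ) (G : SimpleGraph V) : Prop := ∀ v, (Finset.univ.filter (G.Adj v)).card ≤ d

open Classical in
theorem MaxDegLE.card_le {G G' : SimpleGraph V} {d : ℕ} (h : MaxDegLE d G') {x : V}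
    (hx : ∀ y, G.Adj x y → G'.Adj x y) : (Finset.univ.filter (G.Adj x)).card ≤ d :=
  (Finset.card_le_card (Finset.monotone_filter_right _ fun y _ hy => hx y hy)).trans (h x)

variable [DecidableEq V]

open Classical in
/-- The closed neighbourhood of a set of vertices. -/
noncomputable def closedNbhd (G : SimpleGraph V) (X : Finset V) : Finset V :=
  X ∪ X.biUnion fun x => Finset.univ.filter (G.Adj x)

theorem mem_closedNbhd {G : SimpleGraph V} {X : Finset V} {y : V} :
    y ∈ closedNbhd G X ↔ y ∈ X ∨ ∃ x ∈ X, G.Adj x y := by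
  simp [closedNbhd]

theorem card_closedNbhd_le {G : SimpleGraph V} {d : ℕ} (hd : MaxDegLE d G) (X : Finset V) :
    (closedNbhd G X).card ≤ X.card * (d + 1) := by
  classical
  refine (Finset.card_union_le _ _).trans ?_
  have := Finset.card_biUnion_le_card_mul X (fun x => Finset.univ.filter (G.Adj x)) d
    (fun x _ => by convert hd x)
  rw [Nat.mul_add, mul_one, add_comm]
  convert Nat.add_le_add_right this _

/-- The ball of radius `r` around a set of vertices. -/
noncomputable def ball (G : SimpleGraph V) (X : Finset V) (r : ℕ) : Finset V :=
  (closedNbhd G)^[r] X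

theorem ball_succ (G : SimpleGraph V) (X : Finset V) (r : ℕ) :
    ball G X (r + 1) = closedNbhd G (ball G X r) := Function.iterate_succ_apply' _ _ _

theorem ball_add (G : SimpleGraph V) (X : Finset V) (r s : ℕ) :
    ball G X (r + s) = ball G (ball G X r) s := by
  rw [ball, add_comm, Function.iterate_add_apply]; rfl

theorem ball_mono (G : SimpleGraph V) (X : Finset V) : Monotone (ball G X) :=
  monotone_nat_of_le_succ fun r => by
    rw [ball_succ]
    exact fun x hx => mem_closedNbhd.2 (.inl hx)

theorem card_ball_le {G : SimpleGraph V} {d : ℕ} (hd : MaxDegLE d G) (X : Finset V) (r : ℕ) :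
    (ball G X r).card ≤ X.card * (d + 1) ^ r := by
  induction r with
  | zero => simp [ball]
  | succ r ih =>
    rw [ball_succ, pow_succ, ← mul_assoc]
    exact (card_closedNbhd_le hd _).trans (Nat.mul_le_mul_right _ ih)

theorem ConnOn.subset_ball {G : SimpleGraph V} {X S : Finset V} {v : V} (h : ConnOn G X)
    (hv : v ∈ X) (hvS : v ∈ S) : X ⊆ ball G S X.card :=
  h.subset_of_step (ball G S) hv hvS (ball_mono G S) fun i _ x _ hx y _ hadj => by
    rw [ball_succ]; exact mem_closedNbhd.2 (.inr ⟨x, hx, hadj⟩)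

/-- The active vertices of a configuration: those carrying a loop. -/
def active (E : Finset (Sym2 V)) : Finset V := Finset.univ.filter fun v => s(v, v) ∈ E

theorem mem_active {E : Finset (Sym2 V)} {v : V} : v ∈ active E ↔ s(v, v) ∈ E := by
  simp [active]

theorem config_ext {E F : Finset (Sym2 V)} (ha : active E = active F)
    (hg : ∀ x y, (graph E).Adj x y ↔ (graph F).Adj x y) : E = F := by
  ext e
  induction e with
  | _ x y =>
    by_cases hxy : x = y
    · subst hxy; rw [← mem_active, ha, mem_active]
    · simpa [graph_adj, hxy] using hg x y

theorem active_config (G : SimpleGraph V) (A : Finset V) : active (config G A) = A := by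
  ext v; simp [mem_active, mem_config]

/-- The edges of the configuration join active vertices. -/
def Supported (E : Finset (Sym2 V)) : Prop := ∀ x y, (graph E).Adj x y → x ∈ active E

theorem supported_config (G : SimpleGraph V) (A : Finset V) : Supported (config G A) :=
  fun x y h => by rw [active_config]; exact (graph_config_adj.1 h).1

/-- The graph of the configuration is consistent with `S` on the active vertices. -/
def ConsistentOn (k : ℕ) (S : Finset (Finset V)) (E : Finset (Sym2 V)) : Prop :=
  ∀ X ⊆ active E, X.card = k → (ConnOn (graph E) X ↔ X ∈ S)

/-- A partial solution: a connected graph of maximum degree at most `d` on the active vertices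
which is consistent with `S` there. -/
structure Good (k d : ℕ) (S : Finset (Finset V)) (E : Finset (Sym2 V)) : Prop where
  supp : Supported E
  deg : MaxDegLE d (graph E)
  conn : (active E).Nonempty → ConnOn (graph E) (active E)
  cons : ConsistentOn k S E

variable {k d : ℕ} {S : Finset (Finset V)} {E F H : Finset (Sym2 V)}

theorem Supported.subset_active (h : Supported E) {X : Finset V} (hX : ConnOn (graph E) X)
    (hc : 2 ≤ X.card) : X ⊆ active E := by
  intro x hx
  obtain ⟨y, hy, hyx⟩ := Finset.exists_mem_ne (show 1 < X.card by omega) x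
  obtain ⟨z, -, hz⟩ := hX.exists_adj hx hy hyx
  exact h x z hz

theorem ConsistentOn.sameConn (hk : 2 ≤ k) (hE : Supported E) (hF : Supported F)
    (ha : active E = active F) (hcE : ConsistentOn k S E) (hcF : ConsistentOn k S F) :
    SameConn k (graph E) (graph F) := by
  intro X hX
  by_cases hXA : X ⊆ active E
  · rw [hcE X hXA hX, hcF X (ha ▸ hXA) hX]
  · exact iff_of_false (fun h => hXA (hE.subset_active h (by omega)))
      (fun h => hXA (ha ▸ hF.subset_active h (by omega)))

/-- A full solution: a connected graph of maximum degree at most `d` whose connected `k`-sets are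
the members of `S`. -/
structure IsSolution (k d : ℕ) (S : Finset (Finset V)) (G : SimpleGraph V) : Prop where
  conn : ConnOn G Finset.univ
  deg : MaxDegLE d G
  cons : ∀ X : Finset V, X.card = k → (ConnOn G X ↔ X ∈ S)

theorem IsSolution.consistentOn_config {G : SimpleGraph V} (h : IsSolution k d S G)
    (A : Finset V) : ConsistentOn k S (config G A) := by
  intro X hXA hX
  rw [active_config] at hXA
  rw [← h.cons X hX]
  exact connOn_congr fun x hx y hy => by
    rw [graph_config_adj]; exact ⟨fun e => e.2.2, fun e => ⟨hXA hx, hXA hy, e⟩⟩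

theorem IsSolution.maxDegLE_config {G : SimpleGraph V} (h : IsSolution k d S G)
    (A : Finset V) : MaxDegLE d (graph (config G A)) := fun _ =>
  h.deg.card_le fun _ hy => (graph_config_adj.1 hy).2.2

theorem connOn_graph_config {G : SimpleGraph V} {A : Finset V} :
    ConnOn (graph (config G A)) A ↔ ConnOn G A :=
  connOn_congr fun x hx y hy => by simp [graph_config_adj, hx, hy]

theorem IsSolution.good_config {G : SimpleGraph V} (h : IsSolution k d S G) {A : Finset V}
    (hA : ConnOn G A) : Good k d S (config G A) where
  supp := supported_config G A
  deg := h.maxDegLE_config A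
  conn := fun _ => by rw [active_config]; exact connOn_graph_config.2 hA
  cons := h.consistentOn_config A

theorem Good.isSolution (h : Good k d S E) (ha : active E = Finset.univ) [Nonempty V] :
    IsSolution k d S (graph E) where
  conn := ha ▸ h.conn (by rw [ha]; exact Finset.univ_nonempty)
  deg := h.deg
  cons := fun X hX => h.cons X (by rw [ha]; exact Finset.subset_univ _) hX

/-- Inside the active set, a class of indistinguishable vertices has bounded size: all its members
lie in the closed neighbourhood of any connected `2 * k`-set containing one of them. -/
theorem Good.card_class_le (h : Good k d S E) (hk : 2 ≤ k) {r : V} (hr : r ∈ active E)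
    {D : Finset V} (hD : ∀ y ∈ D, y ∈ active E ∧ Indist k (graph E) r y) :
    D.card ≤ 2 * k * (d + 1) := by
  by_cases hA : 2 * k ≤ (active E).card
  · obtain ⟨W, hWA, hrW, hW, hWc⟩ := (h.conn ⟨r, hr⟩).exists_subset_card hr
      (m := 2 * k) (by omega) hA
    rw [← hW]
    refine (Finset.card_le_card fun y hy => ?_).trans (card_closedNbhd_le h.deg W)
    have h1 := ((hD y hy).2 W (by omega) hWc).1 (by rwa [Finset.insert_eq_of_mem hrW])
    rw [mem_closedNbhd]
    rcases hWc.insert_iff.1 h1 with h2 | ⟨w, hw, h2⟩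
    · exact .inl h2
    · exact .inr ⟨w, hw, h2.symm⟩
  · have h1 : D.card ≤ (active E).card := Finset.card_le_card fun y hy => (hD y hy).1
    have h2 : 2 * k * 1 ≤ 2 * k * (d + 1) := Nat.mul_le_mul_left _ (by omega)
    omega

/-- Mixing two partial solutions with the same active set along one class. -/
theorem Good.mix (hk : 2 ≤ k) (hE : Good k d S E) (hF : Good k d S F)
    (ha : active E = active F) (hA : k ≤ (active E).card) (q : V) :
    ∃ M, Good k d S M ∧ active M = active E ∧
      graph M = mix (graph E) (graph F) {y | Indist k (graph E) q y} := by
  have hS := hE.cons.sameConn hk hE.supp hF.supp ha hF.cons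
  have hmix := sameConn_mix hk hS q
  set Q : Set V := {y | Indist k (graph E) q y} with hQ
  have hsupp : ∀ x y, (KSets.mix (graph E) (graph F) Q).Adj x y → x ∈ active E := by
    rintro x y (h | h)
    · rw [ha]; exact hF.supp x y h.2
    · exact hE.supp x y h.2
  have hg : graph (config (KSets.mix (graph E) (graph F) Q) (active E)) = _ :=
    graph_config_eq hsupp
  refine ⟨config (KSets.mix (graph E) (graph F) Q) (active E), ⟨supported_config _ _, ?_, ?_, ?_⟩,
    active_config _ _, hg⟩
  · rw [hg]
    intro x
    by_cases hx : x ∈ Q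
    · refine hF.deg.card_le fun y hxy => ?_
      by_cases hy : y ∈ Q
      · exact (mix_adj_of_mem ⟨hx, hy⟩).1 hxy
      · rw [mix_adj_of_not_mem fun e => hy e.2] at hxy
        by_contra hne
        exact hy (Indist.trans hx (indist_of_not_iff hk hS fun e => hne (e.1 hxy)))
    · exact hE.deg.card_le fun y hxy => (mix_adj_of_not_mem fun e => hx e.1).1 hxy
  · rw [hg, active_config]
    exact fun hne => (hmix.connOn_iff hk hA).1 (hE.conn hne)
  · intro X hX hXk
    rw [active_config] at hX
    rw [hg, ← hE.cons X hX hXk]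
    exact (hmix X hXk).symm

/-- Mixing along all classes that meet a set `R`. -/
theorem Good.mix_classes (hk : 2 ≤ k) (hE : Good k d S E) (hF : Good k d S F)
    (ha : active E = active F) (hA : k ≤ (active E).card) (R : Finset V) :
    ∃ M, Good k d S M ∧ active M = active E ∧ ∀ x y,
      ((∃ r ∈ R, Indist k (graph E) r x ∧ Indist k (graph E) r y) →
        ((graph M).Adj x y ↔ (graph F).Adj x y)) ∧
      ((¬ ∃ r ∈ R, Indist k (graph E) r x ∧ Indist k (graph E) r y) →
        ((graph M).Adj x y ↔ (graph E).Adj x y)) := by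
  induction R using Finset.induction_on with
  | empty => exact ⟨E, hE, rfl, fun x y => by simp⟩
  | insert q R _ ih =>
    obtain ⟨M, hM, hMa, hMg⟩ := ih
    obtain ⟨M', hM', hMa', hMg'⟩ := hM.mix hk hF (hMa.trans ha) (hMa ▸ hA) q
    have hS : SameConn k (graph E) (graph M) :=
      hE.cons.sameConn hk hE.supp hM.supp hMa.symm hM.cons
    refine ⟨M', hM', hMa'.trans hMa, fun x y => ?_⟩
    have hiff : ∀ x, x ∈ {y | Indist k (graph M) q y} ↔ Indist k (graph E) q x :=
      fun x => (indist_congr hk hS).symm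
    rw [hMg']
    by_cases hq : Indist k (graph E) q x ∧ Indist k (graph E) q y
    · rw [mix_adj_of_mem (by rwa [hiff, hiff])]
      exact ⟨fun _ => Iff.rfl, fun hn => absurd ⟨q, by simp, hq⟩ hn⟩
    · rw [mix_adj_of_not_mem (by rwa [hiff, hiff])]
      simpa [hq] using hMg x y

/-- The mixture of `Good.mix_classes` differs from the first partial solution in few pairs. -/
theorem Good.card_symmDiff_le (hk : 2 ≤ k) (hE : Good k d S E) (hM : Good k d S F)
    (ha : active F = active E) {R : Finset V} (hR : R ⊆ active E)
    (h : ∀ x y, (¬ ∃ r ∈ R, Indist k (graph E) r x ∧ Indist k (graph E) r y) →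
        ((graph F).Adj x y ↔ (graph E).Adj x y)) :
    (symmDiff E F).card ≤ (R.card * (2 * k * (d + 1)) + 1) ^ 2 := by
  classical
  set D := R.biUnion fun r => (active E).filter fun y => Indist k (graph E) r y with hD
  have hDc : D.card ≤ R.card * (2 * k * (d + 1)) :=
    Finset.card_biUnion_le_card_mul _ _ _ fun r hr => hE.card_class_le hk (hR hr) (by simp)
  have hsub : symmDiff E F ⊆ D.sym2 := by
    intro e he
    induction e with
    | _ x y =>
      have hne : ¬ (s(x, y) ∈ F ↔ s(x, y) ∈ E) := by
        rw [Finset.mem_symmDiff] at he; tauto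
      have hxy : x ≠ y := by
        rintro rfl
        rw [← mem_active, ← mem_active, ha] at hne
        exact hne Iff.rfl
      have hadj : ¬ ((graph F).Adj x y ↔ (graph E).Adj x y) := by
        simpa [graph_adj, hxy] using hne
      obtain ⟨r, hr, hrx, hry⟩ : ∃ r ∈ R, Indist k (graph E) r x ∧ Indist k (graph E) r y := by
        by_contra hcon
        exact hadj (h x y hcon)
      have hact : x ∈ active E ∧ y ∈ active E := by
        by_cases h1 : (graph E).Adj x y
        · exact ⟨hE.supp _ _ h1, hE.supp _ _ h1.symm⟩
        · have h2 : (graph F).Adj x y := by tauto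
          exact ha ▸ ⟨hM.supp _ _ h2, hM.supp _ _ h2.symm⟩
      rw [Finset.mk_mem_sym2_iff]
      simp only [hD, Finset.mem_biUnion, Finset.mem_filter]
      exact ⟨⟨r, hr, hact.1, hrx⟩, ⟨r, hr, hact.2, hry⟩⟩
  refine (Finset.card_le_card hsub).trans ?_
  rw [Finset.card_sym2]
  refine (Nat.choose_le_pow _ _).trans (Nat.pow_le_pow_left (by omega) 2)

end KSets

/-! ### Extending and exchanging partial solutions by few changes -/

namespace KSets

variable {V : Type*} [Fintype V] [DecidableEq V]
variable {k d : ℕ} {S : Finset (Finset V)} {E F H : Finset (Sym2 V)}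

/-- The number of pairs that have to be changed to extend a partial solution by one vertex, or to
bring a solution closer to another one. The first summand bounds the changes of a mixture along
the classes of at most `(d + 1) ^ (k * k)` vertices, the second one the star of a new vertex, and the
last one all pairs of two configurations with at most `k` active vertices. -/
def toggleBound (k d : ℕ) : ℕ :=
  ((d + 1) ^ (k * k) * (2 * k * (d + 1)) + 1) ^ 2 + (d + 1) + 2 * (k + 1) ^ 2

theorem Supported.card_le (h : Supported E) : E.card ≤ ((active E).card + 1) ^ 2 := by
  have hsub : E ⊆ (active E).sym2 := by
    intro e he
    induction e with
    | _ x y =>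
      rw [Finset.mk_mem_sym2_iff]
      by_cases hxy : x = y
      · subst hxy; exact ⟨mem_active.2 he, mem_active.2 he⟩
      · have hadj : (graph E).Adj x y := ⟨he, hxy⟩
        exact ⟨h x y hadj, h y x hadj.symm⟩
  refine (Finset.card_le_card hsub).trans ?_
  rw [Finset.card_sym2]
  exact Nat.choose_le_pow _ _

theorem card_symmDiff_le_of_small (hE : Supported E) (hF : Supported F)
    (hEk : (active E).card ≤ k) (hFk : (active F).card ≤ k) :
    (symmDiff E F).card ≤ toggleBound k d := by
  have h1 : (symmDiff E F).card ≤ E.card + F.card :=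
    (Finset.card_le_card (symmDiff_le_sup (a := E) (b := F))).trans (Finset.card_union_le E F)
  have h2 := hE.card_le.trans (Nat.pow_le_pow_left (Nat.succ_le_succ hEk) 2)
  have h3 := hF.card_le.trans (Nat.pow_le_pow_left (Nat.succ_le_succ hFk) 2)
  have h4 : 2 * (k + 1) ^ 2 ≤ toggleBound k d := Nat.le_add_left _ _
  simp only [Nat.succ_eq_add_one] at h2 h3
  omega

/-- Two distinct solutions: the first can be changed in few pairs to a third one that is closer to
the second. -/
theorem Good.exists_closer (hk : 2 ≤ k) (hE : Good k d S E) (hF : Good k d S F)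
    (hEa : active E = Finset.univ) (hFa : active F = Finset.univ) (hne : E ≠ F) :
    ∃ M, Good k d S M ∧ active M = Finset.univ ∧ (symmDiff E M).card ≤ toggleBound k d ∧
      (symmDiff M F).card < (symmDiff E F).card := by
  have ha : active E = active F := hEa.trans hFa.symm
  by_cases hA : k ≤ (active E).card
  · have hS := hE.cons.sameConn hk hE.supp hF.supp ha hF.cons
    obtain ⟨x, y, hxy⟩ : ∃ x y, ¬ ((graph E).Adj x y ↔ (graph F).Adj x y) := by
      by_contra hcon
      push Not at hcon
      exact hne (config_ext ha hcon)
    obtain ⟨M, hM, hMa, hMg⟩ := hE.mix_classes hk hF ha hA {x}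
    refine ⟨M, hM, hMa.trans hEa, ?_, ?_⟩
    · refine (hE.card_symmDiff_le hk hM hMa (R := {x}) (by simp [hEa])
        fun a b => (hMg a b).2).trans ?_
      have h1 : 1 * (2 * k * (d + 1)) ≤ (d + 1) ^ (k * k) * (2 * k * (d + 1)) :=
        Nat.mul_le_mul_right _ (Nat.one_le_pow _ _ (by omega))
      have h2 := Nat.pow_le_pow_left (Nat.succ_le_succ h1) 2
      simp only [Finset.card_singleton, toggleBound, Nat.succ_eq_add_one] at h2 ⊢
      omega
    · apply Finset.card_lt_card
      have hne' : x ≠ y := by rintro rfl; simp at hxy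
      rw [Finset.ssubset_iff_of_subset]
      · refine ⟨s(x, y), ?_, ?_⟩
        · simp only [graph_adj, hne', ne_eq, not_false_eq_true, and_true] at hxy
          rw [Finset.mem_symmDiff]; tauto
        · have h1 := (hMg x y).1 ⟨x, by simp, Indist.refl _ _ _, indist_of_not_iff hk hS hxy⟩
          simp only [graph_adj, hne', ne_eq, not_false_eq_true, and_true] at h1
          rw [Finset.mem_symmDiff]; tauto
      · intro e he
        induction e with
        | _ a b =>
          rw [Finset.mem_symmDiff] at he ⊢
          by_cases hab : a = b
          · subst hab
            simp only [← mem_active, hMa, hEa, hFa] at he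
            simp at he
          · have h1 := hMg a b
            simp only [graph_adj, hab, ne_eq, not_false_eq_true, and_true] at h1
            by_cases hr : ∃ r ∈ ({x} : Finset V), Indist k (graph E) r a ∧ Indist k (graph E) r b
            · have := h1.1 hr; tauto
            · have := h1.2 hr; tauto
  · exact ⟨F, hF, hFa, card_symmDiff_le_of_small hE.supp hF.supp (by omega) (ha ▸ by omega),
      by rwa [symmDiff_self, Finset.bot_eq_empty, Finset.card_empty, Finset.card_pos,
        Finset.nonempty_iff_ne_empty, ← Finset.bot_eq_empty, Ne, symmDiff_eq_bot]⟩

/-- Extension of a partial solution on `A` to `A ∪ {v}`: near the new vertex `v` it is replaced by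
the given solution `G`, along whole classes of indistinguishable vertices, and then `v` is joined to
its neighbours in `G`. Edges of the new graph either are edges of `G` or join vertices of a connected
`k`-set of `G`, so a connected `k`-set through `v` stays within distance `k * k` of `v` in `G`, where
the new graph agrees with `G`. -/
theorem Good.exists_extension (hk : 2 ≤ k) (hE : Good k d S E) {G : SimpleGraph V}
    (hG : IsSolution k d S G) (hA : active E ≠ Finset.univ) :
    ∃ M, Good k d S M ∧ (active M).card = (active E).card + 1 ∧
      (symmDiff E M).card ≤ toggleBound k d := by
  classical
  have hlt : (active E).card < (Finset.univ : Finset V).card :=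
    Finset.card_lt_card (Finset.ssubset_univ_iff.2 hA)
  obtain ⟨x₀, hx₀⟩ := hG.conn.1
  by_cases hkA : k ≤ (active E).card
  swap
  · obtain ⟨A', -, -, hA'c, hA'⟩ := hG.conn.exists_subset_card hx₀
      (m := (active E).card + 1) (by omega) (by omega)
    refine ⟨config G A', hG.good_config hA', by rw [active_config, hA'c], ?_⟩
    exact card_symmDiff_le_of_small hE.supp (supported_config _ _) (by omega)
      (by rw [active_config]; omega)
  set A := active E with hAdef
  obtain ⟨a₀, ha₀⟩ : A.Nonempty := Finset.card_pos.1 (by omega)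
  obtain ⟨z₀, hz₀⟩ : ∃ z, z ∉ A := by
    by_contra hcon
    push Not at hcon
    exact hA (Finset.eq_univ_iff_forall.2 hcon)
  obtain ⟨a, -, v, -, ha, hv, hav⟩ :=
    hG.conn.2 (· ∈ A) ⟨a₀, Finset.mem_univ _, ha₀⟩ ⟨z₀, Finset.mem_univ _, hz₀⟩
  -- the solution `G` restricted to `A`
  have hS : SameConn k (graph E) (graph (config G A)) :=
    hE.cons.sameConn hk hE.supp (supported_config G A) (active_config G A).symm
      (hG.consistentOn_config A)
  have hGA : ConnOn G A :=
    connOn_graph_config.1 ((hS.connOn_iff hk hkA).1 (hE.conn ⟨a, ha⟩))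
  have hF := hG.good_config hGA
  have hGA' : ConnOn G (insert v A) := hGA.insert ha hav.symm
  set G' := graph (config G (insert v A)) with hG'
  have hG'deg : MaxDegLE d G' := hG.maxDegLE_config _
  -- the mixture on `A` along the classes near `v`
  set B := ball G' {v} with hB
  set R := (B (k * k)).filter (· ∈ A) with hR
  obtain ⟨M, hM, hMa, hMg⟩ := hE.mix_classes hk hF (active_config G A).symm hkA R
  have hMsub := hE.card_symmDiff_le hk hM hMa (R := R) (fun x hx => (Finset.mem_filter.1 hx).2)
    fun x y => (hMg x y).2
  have hvB : v ∈ B 0 := Finset.mem_singleton_self v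
  have hBmono : Monotone B := ball_mono G' {v}
  -- adding the star of `v` to the mixture
  set N := M ∪ (insert s(v, v) (((Finset.univ.filter (G'.Adj v)).image fun y => s(v, y)))) with hN
  have hvA : ∀ {x}, x ∈ A → x ≠ v := fun hx e => hv (e ▸ hx)
  have hMA : ∀ {x y}, (graph M).Adj x y → x ∈ A := fun h => by
    rw [hAdef, ← hMa]; exact hM.supp _ _ h
  have hG'A : ∀ {x y}, G'.Adj x y → x ∈ insert v A := fun h => (graph_config_adj.1 h).1
  have hNv : ∀ y, (graph N).Adj v y ↔ G'.Adj v y := by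
    intro y
    rw [graph_adj]
    simp only [hN, Finset.mem_union, Finset.mem_insert, Finset.mem_image, Finset.mem_filter,
      Finset.mem_univ, true_and]
    constructor
    · rintro ⟨h | h | ⟨z, hz, h⟩, hne⟩
      · exact absurd (hMA (show (graph M).Adj v y from ⟨h, hne⟩)) hv
      · rcases Sym2.eq_iff.1 h with h | h <;> exact absurd h.2.symm (by simpa using hne)
      · rcases Sym2.eq_iff.1 h with ⟨-, rfl⟩ | ⟨rfl, rfl⟩ <;> exact hz
    · exact fun h => ⟨.inr (.inr ⟨y, h, rfl⟩), h.ne⟩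
  have hNA : ∀ {x y}, x ≠ v → y ≠ v → ((graph N).Adj x y ↔ (graph M).Adj x y) := by
    intro x y hx hy
    rw [graph_adj, graph_adj]
    simp only [hN, Finset.mem_union, Finset.mem_insert, Finset.mem_image, Finset.mem_filter,
      Finset.mem_univ, true_and]
    constructor
    · rintro ⟨h | h | ⟨z, hz, h⟩, hne⟩
      · exact ⟨h, hne⟩
      · rcases Sym2.eq_iff.1 h with h | h <;> exact absurd h.1 hx
      · rcases Sym2.eq_iff.1 h with h | h
        · exact absurd h.1.symm hx
        · exact absurd h.1.symm hy
    · exact fun h => ⟨.inl h.1, h.2⟩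
  have hNa : active N = insert v A := by
    ext x
    simp only [mem_active, hN, Finset.mem_union, Finset.mem_insert, Finset.mem_image,
      Finset.mem_filter, Finset.mem_univ, true_and]
    rw [← mem_active, hMa]
    constructor
    · rintro (h | h | ⟨z, hz, h⟩)
      · exact .inr h
      · rcases Sym2.eq_iff.1 h with h | h <;> exact .inl h.1
      · rcases Sym2.eq_iff.1 h with ⟨rfl, rfl⟩ | ⟨rfl, rfl⟩ <;> exact .inl rfl
    · rintro (rfl | h)
      · exact .inr (.inl rfl)
      · exact .inl h
  -- near `v` the new graph agrees with `G`
  have hnear : ∀ {x y}, x ∈ B (k * k) → ((graph N).Adj x y ↔ G'.Adj x y) := by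
    intro x y hx
    by_cases hxv : x = v
    · rw [hxv]; exact hNv y
    by_cases hyv : y = v
    · rw [hyv, SimpleGraph.adj_comm, hNv, SimpleGraph.adj_comm]
    rw [hNA hxv hyv]
    have hG'F : G'.Adj x y ↔ (graph (config G A)).Adj x y := by
      rw [hG', graph_config_adj, graph_config_adj]; simp [hxv, hyv]
    rw [hG'F]
    by_cases hxA : x ∈ A
    · by_cases hr : ∃ r ∈ R, Indist k (graph E) r x ∧ Indist k (graph E) r y
      · exact (hMg x y).1 hr
      · rw [(hMg x y).2 hr]
        by_contra hne
        exact hr ⟨x, Finset.mem_filter.2 ⟨hx, hxA⟩, Indist.refl _ _ _,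
          indist_of_not_iff hk hS hne⟩
    · exact iff_of_false (fun h => hxA (hMA h)) (fun h => hxA (graph_config_adj.1 h).1)
  -- an edge of the new graph joins vertices that are close in `G`
  have hstep : ∀ i, ∀ x, x ∈ B (k * i) → ∀ y, (graph N).Adj x y → y ∈ B (k * (i + 1)) := by
    intro i x hx y hxy
    have hone : ∀ {z w}, z ∈ B (k * i) → G'.Adj z w → w ∈ B (k * (i + 1)) := fun hz hzw =>
      hBmono (show k * i + 1 ≤ k * (i + 1) by rw [Nat.mul_succ]; omega)
        (by rw [hB, ball_succ]; exact mem_closedNbhd.2 (.inr ⟨_, hz, hzw⟩))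
    by_cases hxv : x = v
    · subst hxv; exact hone hx ((hNv y).1 hxy)
    by_cases hyv : y = v
    · subst hyv; exact hone hx ((hNv x).1 hxy.symm).symm
    rw [hNA hxv hyv] at hxy
    have hGF : (graph (config G A)).Adj x y → G'.Adj x y := fun h =>
      have h' := graph_config_adj.1 h
      graph_config_adj.2 ⟨Finset.mem_insert_of_mem h'.1, Finset.mem_insert_of_mem h'.2.1, h'.2.2⟩
    by_cases hr : ∃ r ∈ R, Indist k (graph E) r x ∧ Indist k (graph E) r y
    · exact hone hx (hGF (((hMg x y).1 hr).1 hxy))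
    · have hxyE := ((hMg x y).2 hr).1 hxy
      have hxA := hE.supp _ _ hxyE
      have hyA := hE.supp _ _ hxyE.symm
      obtain ⟨Z, hZA, hxyZ, hZk, hZ⟩ := (hE.conn ⟨a, ha⟩).exists_between (ConnOn.pair hxyE)
        (by simp [Finset.insert_subset_iff, hxA, hyA]) (m := k)
        (by rw [Finset.card_pair hxyE.ne]; exact hk) hkA
      have hZ' : ConnOn G' Z := by
        have h1 := (hS Z hZk).1 hZ
        refine h1.mono_adj fun p _ q _ hpq => ?_
        have h' := graph_config_adj.1 hpq
        exact graph_config_adj.2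
          ⟨Finset.mem_insert_of_mem h'.1, Finset.mem_insert_of_mem h'.2.1, h'.2.2⟩
      have h2 := hZ'.subset_ball (S := B (k * i)) (v := x) (hxyZ (by simp)) hx
        (hxyZ (show y ∈ ({x, y} : Finset V) by simp))
      rwa [hZk, hB, ← ball_add, ← Nat.mul_succ] at h2
  refine ⟨N, ⟨?_, ?_, ?_, ?_⟩, ?_, ?_⟩
  · intro x y hxy
    rw [hNa]
    by_cases hxv : x = v
    · simp [hxv]
    by_cases hyv : y = v
    · subst hyv; exact hG'A ((hNv x).1 hxy.symm).symm
    exact Finset.mem_insert_of_mem (hMA ((hNA hxv hyv).1 hxy))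
  · intro x
    by_cases hx : x ∈ B (k * k)
    · exact hG'deg.card_le fun y hy => (hnear hx).1 hy
    · refine hM.deg.card_le fun y hy => ?_
      have hxv : x ≠ v := fun e => hx (e ▸ hBmono (Nat.zero_le _) hvB)
      have hyv : y ≠ v := by
        rintro rfl
        refine hx (hBmono (show k * (0 + 1) ≤ k * k from Nat.mul_le_mul_left k (by omega))
          (hstep 0 y (by simpa using hvB) x hy.symm))
      exact (hNA hxv hyv).1 hy
  · intro _
    rw [hNa]
    have hMc : ConnOn (graph M) A := by
      have := hM.conn (by rw [hMa]; exact ⟨a, ha⟩)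
      rwa [hMa] at this
    have h1 : ConnOn (graph N) A := by
      refine ConnOn.mono_adj (G := graph M) hMc fun x hx y hy h => ?_
      exact (hNA (hvA hx) (hvA hy)).2 h
    exact h1.insert ha ((hNv a).2 (graph_config_adj.2
      ⟨Finset.mem_insert_self _ _, Finset.mem_insert_of_mem ha, hav.symm⟩))
  · intro X hX hXk
    rw [hNa] at hX
    by_cases hvX : v ∈ X
    · have hgood : X ⊆ B (k * k) → (ConnOn (graph N) X ↔ ConnOn G' X) := fun hsub =>
        connOn_congr fun x hx y _ => hnear (hsub hx)
      have hiff : ConnOn (graph N) X ↔ ConnOn G' X := by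
        constructor
        · intro h
          refine (hgood ?_).1 h
          have := h.subset_of_step (fun i => B (k * i)) hvX (by simpa using hvB)
            (fun i j hij => hBmono (Nat.mul_le_mul_left k hij))
            fun i _ x _ hx y _ hxy => hstep i x hx y hxy
          rwa [hXk] at this
        · intro h
          refine (hgood ?_).2 h
          have := h.subset_ball (S := {v}) hvX (Finset.mem_singleton_self v)
          rw [hXk] at this
          exact this.trans (hBmono (Nat.le_mul_self k))
      rw [hiff, ← hG.cons X hXk]
      exact connOn_congr fun x hx y hy => by
        rw [hG', graph_config_adj]; exact ⟨fun e => e.2.2, fun e => ⟨hX hx, hX hy, e⟩⟩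
    · have hXA : X ⊆ A := fun x hx =>
        (Finset.mem_insert.1 (hX hx)).resolve_left fun e => hvX (e ▸ hx)
      rw [← hM.cons X (hMa ▸ hXA) hXk]
      exact connOn_congr fun x hx y hy => hNA (hvA (hXA hx)) (hvA (hXA hy))
  · rw [hNa, Finset.card_insert_of_notMem hv]
  · have h1 : symmDiff E N ⊆ symmDiff E M ∪
        insert s(v, v) (((Finset.univ.filter (G'.Adj v)).image fun y => s(v, y))) := by
      intro e he
      simp only [hN, Finset.mem_symmDiff, Finset.mem_union] at he ⊢
      tauto
    have h2 := (Finset.card_le_card h1).trans (Finset.card_union_le _ _)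
    have h3 := Finset.card_insert_le s(v, v) ((Finset.univ.filter (G'.Adj v)).image fun y => s(v, y))
    have h4 : ((Finset.univ.filter (G'.Adj v)).image fun y => s(v, y)).card ≤ d :=
      Finset.card_image_le.trans (by convert hG'deg v)
    have h5 : R.card ≤ (d + 1) ^ (k * k) := by
      refine (Finset.card_le_card (Finset.filter_subset _ _)).trans ?_
      simpa using card_ball_le hG'deg {v} (k * k)
    have h6 := Nat.pow_le_pow_left
      (Nat.succ_le_succ (Nat.mul_le_mul_right (2 * k * (d + 1)) h5)) 2
    simp only [Nat.succ_eq_add_one] at h6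
    rw [toggleBound]
    omega

end KSets

/-! ### Total correctness and running time of programs -/

namespace RAM

/-- The registers a program may write. -/
def Prog.regs : Prog → List ℕ
  | .nop => []
  | .assign x _ => [x]
  | .store _ _ _ => []
  | .emit _ => []
  | .seq p q => p.regs ++ q.regs
  | .ite _ p q => p.regs ++ q.regs
  | .loop _ p => p.regs

/-- The arrays a program may write. -/
def Prog.arrs : Prog → List ℕ
  | .nop => []
  | .assign _ _ => []
  | .store a _ _ => [a]
  | .emit _ => []
  | .seq p q => p.arrs ++ q.arrs
  | .ite _ p q => p.arrs ++ q.arrs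
  | .loop _ p => p.arrs

/-- The program contains no output instruction. -/
def Prog.silent : Prog → Bool
  | .emit _ => false
  | .seq p q => p.silent && q.silent
  | .ite _ p q => p.silent && q.silent
  | .loop _ p => p.silent
  | _ => true

/-- The number of steps of a program all of whose loops make at most `B` rounds. -/
def Prog.bound (B : ℕ) : Prog → ℕ
  | .nop => 1
  | .assign _ e => e.cost + 1
  | .store _ i e => i.cost + e.cost + 1
  | .emit e => e.cost + 1
  | .seq p q => p.bound B + q.bound B
  | .ite e p q => e.cost + 1 + (p.bound B + q.bound B)
  | .loop e p => (B + 1) * (e.cost + 1 + p.bound B)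

theorem Prog.exists_polynomial_bound (p : Prog) :
    ∃ P : Polynomial ℕ, ∀ B, p.bound B = P.eval B := by
  induction p with
  | nop => exact ⟨1, fun B => by simp [bound]⟩
  | assign x e => exact ⟨Polynomial.C (e.cost + 1), fun B => by simp [bound]⟩
  | store a i e => exact ⟨Polynomial.C (i.cost + e.cost + 1), fun B => by simp [bound]⟩
  | emit e => exact ⟨Polynomial.C (e.cost + 1), fun B => by simp [bound]⟩
  | seq p q hp hq =>
    obtain ⟨P, hP⟩ := hp
    obtain ⟨Q, hQ⟩ := hq
    exact ⟨P + Q, fun B => by simp [bound, hP, hQ]⟩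
  | ite e p q hp hq =>
    obtain ⟨P, hP⟩ := hp
    obtain ⟨Q, hQ⟩ := hq
    exact ⟨Polynomial.C (e.cost + 1) + (P + Q), fun B => by simp [bound, hP, hQ]⟩
  | loop e p hp =>
    obtain ⟨P, hP⟩ := hp
    exact ⟨(Polynomial.X + 1) * (Polynomial.C (e.cost + 1) + P), fun B => by simp [bound, hP]⟩

section StateLemmas

variable (s : State) (x v a i y b : ℕ)

@[simp] theorem State.reg_setReg : (s.setReg x v).reg y = if y = x then v else s.reg y := by
  simp [State.setReg, Function.update_apply]

@[simp] theorem State.arr_setReg : (s.setReg x v).arr = s.arr := rfl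

@[simp] theorem State.out_setReg : (s.setReg x v).out = s.out := rfl

@[simp] theorem State.reg_setArr : (s.setArr a i v).reg = s.reg := rfl

theorem State.arr_setArr (j : ℕ) : (s.setArr a i v).arr b j =
    if b = a ∧ j = i then v else s.arr b j := by
  by_cases hb : b = a
  · subst hb; simp [State.setArr, Function.update_apply]
  · simp [State.setArr, hb]

@[simp] theorem State.out_setArr : (s.setArr a i v).out = s.out := rfl

@[simp] theorem State.reg_emit : (s.emit v).reg = s.reg := rfl

@[simp] theorem State.arr_emit : (s.emit v).arr = s.arr := rfl

@[simp] theorem State.out_emit : (s.emit v).out = s.out ++ [v] := rfl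

end StateLemmas

attribute [simp] Expr.eval Prog.regs Prog.arrs Prog.silent

/-- What the program `p` does not write is the same in `s` and `s'`. -/
structure Frame (p : Prog) (s s' : State) : Prop where
  reg : ∀ x, x ∉ p.regs → s'.reg x = s.reg x
  arr : ∀ a, a ∉ p.arrs → s'.arr a = s.arr a
  out : p.silent = true → s'.out = s.out

theorem Frame.refl (p : Prog) (s : State) : Frame p s s :=
  ⟨fun _ _ => rfl, fun _ _ => rfl, fun _ => rfl⟩

theorem Frame.trans {p : Prog} {s s' s'' : State} (h : Frame p s s') (h' : Frame p s' s'') :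
    Frame p s s'' :=
  ⟨fun x hx => (h'.reg x hx).trans (h.reg x hx), fun a ha => (h'.arr a ha).trans (h.arr a ha),
    fun ho => (h'.out ho).trans (h.out ho)⟩

theorem Frame.mono {p q : Prog} {s s' : State} (h : Frame p s s')
    (hr : ∀ x, x ∈ p.regs → x ∈ q.regs) (ha : ∀ x, x ∈ p.arrs → x ∈ q.arrs)
    (ho : q.silent = true → p.silent = true) : Frame q s s' :=
  ⟨fun x hx => h.reg x fun e => hx (hr x e), fun a hx => h.arr a fun e => hx (ha a e),
    fun e => h.out (ho e)⟩

theorem Prog.Run.frame {p : Prog} {s s' : State} {t : ℕ} (h : p.Run s s' t) : Frame p s s' := by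
  induction h with
  | nop s => exact Frame.refl _ _
  | assign s x e =>
    refine ⟨fun y hy => ?_, fun _ _ => rfl, fun _ => rfl⟩
    simp only [Prog.regs, List.mem_singleton] at hy
    simp [hy]
  | store s a i e =>
    refine ⟨fun _ _ => rfl, fun b hb => ?_, fun _ => rfl⟩
    simp only [Prog.arrs, List.mem_singleton] at hb
    funext j
    simp [State.arr_setArr, hb]
  | emit s e => exact ⟨fun _ _ => rfl, fun _ _ => rfl, fun h => by simp [Prog.silent] at h⟩
  | seq _ _ h1 h2 =>
    exact (h1.mono (by simp +contextual [Prog.regs]) (by simp +contextual [Prog.arrs])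
      (by simp +contextual [Prog.silent])).trans
      (h2.mono (by simp +contextual [Prog.regs]) (by simp +contextual [Prog.arrs])
      (by simp +contextual [Prog.silent]))
  | ite_true _ _ h =>
    exact h.mono (by simp +contextual [Prog.regs]) (by simp +contextual [Prog.arrs])
      (by simp +contextual [Prog.silent])
  | ite_false _ _ h =>
    exact h.mono (by simp +contextual [Prog.regs]) (by simp +contextual [Prog.arrs])
      (by simp +contextual [Prog.silent])
  | loop_true _ _ _ h1 h2 =>
    exact (h1.mono (by simp [Prog.regs]) (by simp [Prog.arrs]) (by simp [Prog.silent])).trans h2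
  | loop_false _ => exact Frame.refl _ _

/-- Total correctness with a time bound: started in `s`, the program `p` halts in a state satisfying
`Q`, within the number of steps allotted to it if loops make at most `B` rounds. -/
def Spec (B : ℕ) (p : Prog) (s : State) (Q : State → Prop) : Prop :=
  ∃ s' t, p.Run s s' t ∧ t ≤ p.bound B ∧ Q s'

variable {B : ℕ} {p q : Prog} {s : State} {Q R : State → Prop} {e : Expr}

/-- The rule of consequence. What `p` does not write may be used in deriving the postcondition. -/
theorem Spec.conseq (h : Spec B p s Q) (hR : ∀ s', Frame p s s' → Q s' → R s') : Spec B p s R := by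
  obtain ⟨s', t, hrun, ht, hQ⟩ := h
  exact ⟨s', t, hrun, ht, hR s' hrun.frame hQ⟩

theorem Spec.nop (h : Q s) : Spec B .nop s Q := ⟨s, 1, .nop s, le_rfl, h⟩

theorem Spec.assign {x : ℕ} (h : Q (s.setReg x (e.eval s))) : Spec B (.assign x e) s Q :=
  ⟨_, _, .assign s x e, le_rfl, h⟩

theorem Spec.store {a : ℕ} {i : Expr} (h : Q (s.setArr a (i.eval s) (e.eval s))) :
    Spec B (.store a i e) s Q :=
  ⟨_, _, .store s a i e, le_rfl, h⟩

theorem Spec.emit (h : Q (s.emit (e.eval s))) : Spec B (.emit e) s Q :=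
  ⟨_, _, .emit s e, le_rfl, h⟩

theorem Spec.seq (h : Spec B p s fun s' => Spec B q s' Q) : Spec B (.seq p q) s Q := by
  obtain ⟨s₁, t₁, hrun₁, ht₁, s₂, t₂, hrun₂, ht₂, hQ⟩ := h
  exact ⟨s₂, t₁ + t₂, .seq hrun₁ hrun₂, Nat.add_le_add ht₁ ht₂, hQ⟩

theorem Spec.ite (h1 : e.eval s ≠ 0 → Spec B p s Q) (h2 : e.eval s = 0 → Spec B q s Q) :
    Spec B (.ite e p q) s Q := by
  by_cases he : e.eval s = 0
  · obtain ⟨s', t, hrun, ht, hQ⟩ := h2 he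
    exact ⟨s', _, .ite_false he hrun, by simp only [Prog.bound]; omega, hQ⟩
  · obtain ⟨s', t, hrun, ht, hQ⟩ := h1 he
    exact ⟨s', _, .ite_true he hrun, by simp only [Prog.bound]; omega, hQ⟩

/-- The rule for loops; `I i` holds at the beginning of round `i`. -/
theorem Spec.loop (I : ℕ → State → Prop) (h0 : I 0 s)
    (hstep : ∀ i s', I i s' → e.eval s' ≠ 0 → i < B ∧ Spec B p s' (I (i + 1)))
    (hQ : ∀ i s', I i s' → e.eval s' = 0 → Q s') : Spec B (.loop e p) s Q := by
  have key : ∀ r i s', i + r = B → I i s' →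
      ∃ s'' t, (Prog.loop e p).Run s' s'' t ∧ t ≤ (r + 1) * (e.cost + 1 + p.bound B) ∧ Q s'' := by
    intro r
    induction r with
    | zero =>
      intro i s' hi hI
      have he : e.eval s' = 0 := by
        by_contra he
        have := (hstep i s' hI he).1
        omega
      exact ⟨s', _, .loop_false he, by rw [zero_add, one_mul]; omega, hQ i s' hI he⟩
    | succ r ih =>
      intro i s' hi hI
      by_cases he : e.eval s' = 0
      · refine ⟨s', _, .loop_false he, ?_, hQ i s' hI he⟩
        rw [Nat.succ_mul]; omega
      · obtain ⟨s₁, t₁, hrun₁, ht₁, hI₁⟩ := (hstep i s' hI he).2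
        obtain ⟨s₂, t₂, hrun₂, ht₂, hQ₂⟩ := ih (i + 1) s₁ (by omega) hI₁
        exact ⟨s₂, _, .loop_true he hrun₁ hrun₂, by rw [Nat.succ_mul]; omega, hQ₂⟩
  exact key B 0 s (by omega) h0

/-- The counting loop: `x` runs from `0` to the value of `e`. -/
def Prog.for (x : ℕ) (e : Expr) (p : Prog) : Prog :=
  .seq (.assign x (.lit 0)) (.loop (.sub e (.reg x)) (.seq p (.assign x (.add (.reg x) (.lit 1)))))

@[simp] theorem Prog.mem_regs_for {x y : ℕ} : y ∈ (Prog.for x e p).regs ↔ y = x ∨ y ∈ p.regs := by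
  simp only [Prog.for, Prog.regs, List.mem_append, List.mem_singleton]; tauto

@[simp] theorem Prog.arrs_for {x : ℕ} : (Prog.for x e p).arrs = p.arrs := by
  simp [Prog.for, Prog.arrs]

@[simp] theorem Prog.silent_for {x : ℕ} : (Prog.for x e p).silent = p.silent := by
  simp [Prog.for, Prog.silent]

theorem Frame.setReg_for {x v : ℕ} {s' : State} (h : Frame (.for x e p) s s') :
    Frame (.for x e p) s (s'.setReg x v) :=
  h.trans ⟨fun y hy => by simp only [Prog.mem_regs_for, not_or] at hy; simp [hy.1],
    fun _ _ => rfl, fun _ => rfl⟩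

/-- The rule for counting loops. The loop variable and the bound must not be touched by the body. -/
theorem Spec.for {x N : ℕ} (hx : x ∉ p.regs) (hN : N ≤ B)
    (he : ∀ s', Frame (.for x e p) s s' → e.eval s' = N) (I : ℕ → State → Prop)
    (h0 : I 0 (s.setReg x 0))
    (hstep : ∀ i s', i < N → Frame (.for x e p) s s' → s'.reg x = i → I i s' →
      Spec B p s' fun s'' => I (i + 1) (s''.setReg x (i + 1)))
    (hQ : ∀ s', Frame (.for x e p) s s' → I N s' → Q s') : Spec B (.for x e p) s Q := by
  refine Spec.seq (Spec.assign ?_)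
  refine Spec.loop
    (fun i s' => i ≤ N ∧ Frame (.for x e p) s s' ∧ s'.reg x = i ∧ I i s') ?_ ?_ ?_
  · exact ⟨Nat.zero_le _, (Frame.refl _ _).setReg_for, by simp, h0⟩
  · rintro i s' ⟨hi, hF, hxi, hI⟩ hne
    simp only [Expr.eval, he s' hF, hxi] at hne
    refine ⟨by omega, Spec.seq ((hstep i s' (by omega) hF hxi hI).conseq fun s'' hF' hI' => ?_)⟩
    refine Spec.assign ?_
    have hxi' : s''.reg x = i := (hF'.reg x hx).trans hxi
    simp only [Expr.eval, hxi']
    refine ⟨by omega, ?_, by simp, hI'⟩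
    exact (hF.trans (hF'.mono (by simp +contextual) (by simp) (by simp))).setReg_for
  · rintro i s' ⟨hi, hF, hxi, hI⟩ hz
    simp only [Expr.eval, he s' hF, hxi] at hz
    obtain rfl : i = N := by omega
    exact hQ s' hF hI

end RAM

/-! ### Storage layout -/

namespace KSets

open RAM

-- Names of registers. `rN` and `rSq` hold the number of vertices and its square; `rLen` the number
-- of stored configurations and `rEnd` the first free index of the store; `rPtr` the number of
-- configurations whose neighbourhood has been searched and `rSrc` the index in the store of the next
-- one; `rOk` vanishes once the current configuration has been rejected. The others are auxiliary.
notation "rN" => (0 : ℕ)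
notation "rSq" => (1 : ℕ)
notation "rLen" => (2 : ℕ)
notation "rEnd" => (3 : ℕ)
notation "rPtr" => (4 : ℕ)
notation "rSrc" => (5 : ℕ)
notation "rOk" => (6 : ℕ)
notation "rCnt" => (7 : ℕ)
notation "rRoot" => (8 : ℕ)
notation "rSum" => (9 : ℕ)
notation "rU" => (10 : ℕ)
notation "rV" => (11 : ℕ)
notation "rT" => (12 : ℕ)
notation "rPos" => (13 : ℕ)
notation "rJ" => (14 : ℕ)
notation "rQ" => (15 : ℕ)
notation "rEq" => (16 : ℕ)
notation "rI" => (17 : ℕ)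

-- Names of arrays: the input word, the multiples of the number of vertices, the current matrix, the
-- stored matrices one after the other, and the marks of the reachability test.
notation "aIn" => (0 : ℕ)
notation "aMul" => (1 : ℕ)
notation "aMat" => (2 : ℕ)
notation "aStore" => (3 : ℕ)
notation "aReach" => (4 : ℕ)

variable {n : ℕ}

open Classical in
/-- The entry in row `u` and column `v` of the symmetric `0`-`1`-matrix of a configuration. -/
noncomputable def entry (E : Finset (Sym2 (Fin n))) (u v : ℕ) : ℕ :=
  if ∃ (hu : u < n) (hv : v < n), s((⟨u, hu⟩ : Fin n), ⟨v, hv⟩) ∈ E then 1 else 0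

/-- The matrix of a configuration, row by row. -/
noncomputable def enc (E : Finset (Sym2 (Fin n))) (j : ℕ) : ℕ := entry E (j / n) (j % n)

theorem entry_fin (E : Finset (Sym2 (Fin n))) (u v : Fin n) :
    entry E u v = if s(u, v) ∈ E then 1 else 0 := by
  simp [entry]

theorem entry_fin_ne_zero {E : Finset (Sym2 (Fin n))} {u v : Fin n} :
    entry E u v ≠ 0 ↔ s(u, v) ∈ E := by
  simp [entry_fin]

theorem enc_mul_add (E : Finset (Sym2 (Fin n))) {u v : ℕ} (hv : v < n) :
    enc E (u * n + v) = entry E u v := by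
  have hn : 0 < n := by omega
  rw [enc, Nat.add_comm, Nat.add_mul_div_right _ _ hn, Nat.div_eq_of_lt hv, Nat.zero_add,
    Nat.add_mul_mod_self_right, Nat.mod_eq_of_lt hv]

theorem mul_add_lt_sq {u v : ℕ} (hu : u < n) (hv : v < n) : u * n + v < n * n := by
  have h : (u + 1) * n ≤ n * n := Nat.mul_le_mul_right n hu
  rw [Nat.add_mul, Nat.one_mul] at h
  omega

theorem enc_injective {E F : Finset (Sym2 (Fin n))} (h : ∀ j < n * n, enc E j = enc F j) :
    E = F := by
  ext e
  induction e with
  | _ x y =>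
    have h1 := h (x * n + y) (mul_add_lt_sq x.2 y.2)
    rw [enc_mul_add _ y.2, enc_mul_add _ y.2] at h1
    rw [← entry_fin_ne_zero, ← entry_fin_ne_zero, h1]

/-- The constants of the computation: the number of vertices, its square, the multiples of the
number of vertices, and the input word. -/
structure Ctx (n : ℕ) (w : List ℕ) (s : State) : Prop where
  num : s.reg rN = n
  sq : s.reg rSq = n * n
  mul : ∀ u < n, s.arr aMul u = u * n
  inp : ∀ i, s.arr aIn i = w.getD i 0

/-- The program does not write the constants of the computation. -/
def Safe (p : Prog) : Prop := (∀ x ∈ p.regs, 2 ≤ x) ∧ ∀ a ∈ p.arrs, 2 ≤ a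

theorem Ctx.frame {w : List ℕ} {s s' : State} {p : Prog} (h : Ctx n w s) (hF : Frame p s s')
    (hp : Safe p) : Ctx n w s' := by
  have hr : ∀ x < 2, s'.reg x = s.reg x := fun x hx =>
    hF.reg x fun hm => absurd (hp.1 x hm) (by omega)
  have ha : ∀ x < 2, s'.arr x = s.arr x := fun x hx =>
    hF.arr x fun hm => absurd (hp.2 x hm) (by omega)
  exact ⟨(hr _ (by norm_num)).trans h.num, (hr _ (by norm_num)).trans h.sq,
    fun u hu => by rw [ha _ (by norm_num), h.mul u hu], fun i => by rw [ha _ (by norm_num), h.inp]⟩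

theorem Ctx.setReg {w : List ℕ} {s : State} (h : Ctx n w s) {x v : ℕ} (hx : 2 ≤ x) :
    Ctx n w (s.setReg x v) :=
  ⟨by rw [← h.num, State.reg_setReg, if_neg (by omega)],
    by rw [← h.sq, State.reg_setReg, if_neg (by omega)], h.mul, h.inp⟩

theorem Ctx.setArr {w : List ℕ} {s : State} (h : Ctx n w s) {a i v : ℕ} (ha : 2 ≤ a) :
    Ctx n w (s.setArr a i v) :=
  ⟨h.num, h.sq, fun u hu => by rw [← h.mul u hu, State.arr_setArr, if_neg (by omega)],
    fun j => by rw [← h.inp j, State.arr_setArr, if_neg (by omega)]⟩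

/-- The current matrix is that of the configuration `E`. -/
def Mat (E : Finset (Sym2 (Fin n))) (s : State) : Prop := ∀ j < n * n, s.arr aMat j = enc E j

theorem Mat.frame {E : Finset (Sym2 (Fin n))} {s s' : State} {p : Prog} (h : Mat E s)
    (hF : Frame p s s') (hp : aMat ∉ p.arrs) : Mat E s' := fun j hj => by
  rw [hF.arr _ hp, h j hj]

/-- The index in the matrix of the entry in row `e` and column `f`. -/
def indexE (e f : Expr) : Expr := .add (.get aMul e) f

/-- The entry of the matrix in row `e` and column `f`. -/
def entryE (e f : Expr) : Expr := .get aMat (indexE e f)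

theorem eval_indexE {w : List ℕ} {s : State} (hc : Ctx n w s) {e f : Expr} {u v : ℕ}
    (he : e.eval s = u) (hf : f.eval s = v) (hu : u < n) : (indexE e f).eval s = u * n + v := by
  simp [indexE, he, hf, hc.mul u hu]

theorem eval_entryE {w : List ℕ} {s : State} {E : Finset (Sym2 (Fin n))} (hc : Ctx n w s)
    (hm : Mat E s) {e f : Expr} {u v : ℕ} (he : e.eval s = u) (hf : f.eval s = v) (hu : u < n)
    (hv : v < n) : (entryE e f).eval s = entry E u v := by
  rw [entryE, Expr.eval, eval_indexE hc he hf hu, hm _ (mul_add_lt_sq hu hv), enc_mul_add _ hv]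

/-- The absolute difference. -/
def absDiff (e f : Expr) : Expr := .add (.sub e f) (.sub f e)

theorem eval_absDiff {s : State} {e f : Expr} :
    (absDiff e f).eval s = 0 ↔ e.eval s = f.eval s := by
  simp only [absDiff, Expr.eval]; omega

/-! ### Testing degrees, the number of active vertices, and connectivity -/

/-- Record that the current configuration is rejected. -/
def reject : Prog := .assign rOk (.lit 0)

/-- Test that the row sums are at most `d + 1` (a loop counts) and that inactive rows vanish. -/
def rowsCheck (d : ℕ) : Prog :=
  .for rU (.reg rN)
    (.seq (.assign rSum (.lit 0))
    (.seq (.for rV (.reg rN)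
      (.assign rSum (.add (.reg rSum) (entryE (.reg rU) (.reg rV)))))
    (.seq (.ite (.sub (.reg rSum) (.lit (d + 1))) reject .nop)
      (.ite (entryE (.reg rU) (.reg rU)) .nop (.ite (.reg rSum) reject .nop)))))

variable {w : List ℕ} {s : State} {E : Finset (Sym2 (Fin n))} {B : ℕ}

theorem rowsCheck_spec (hc : Ctx n w s) (hm : Mat E s) (hn : n ≤ B) (d : ℕ) :
    Spec B (rowsCheck d) s fun s' => s'.reg rOk ≠ 0 ↔ s.reg rOk ≠ 0 ∧
      ∀ u < n, ∑ v ∈ Finset.range n, entry E u v ≤ d + 1 ∧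
        (entry E u u = 0 → ∑ v ∈ Finset.range n, entry E u v = 0) := by
  set P : ℕ → Prop := fun u => ∑ v ∈ Finset.range n, entry E u v ≤ d + 1 ∧
        (entry E u u = 0 → ∑ v ∈ Finset.range n, entry E u v = 0) with hP
  refine Spec.for (by simp [reject]) hn
    (fun s' hF => (hF.reg _ (by simp [reject])).trans hc.num)
    (fun i s' => s'.reg rOk ≠ 0 ↔ s.reg rOk ≠ 0 ∧ ∀ u < i, P u) (by simp) ?_ (fun s' _ h => h)
  intro u s₁ hu hF₁ hu₁ hI
  have hc₁ := hc.frame hF₁ (by simp [Safe, reject, or_imp, forall_and])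
  have hm₁ := hm.frame hF₁ (by simp [reject])
  refine Spec.seq (Spec.assign (Spec.seq ?_))
  refine Spec.for (N := n) (by simp) hn (fun s' hF => by
      have := hF.reg rN (by simp); simpa [hc₁.num] using this)
    (fun i s' => s'.reg rSum = ∑ v ∈ Finset.range i, entry E u v) (by simp) ?_ ?_
  · intro v s₂ hv hF₂ hv₂ hI₂
    refine Spec.assign ?_
    have hc₂ := (hc₁.setReg (x := rSum) (by norm_num)).frame hF₂ (by simp [Safe])
    have hm₂ : Mat E s₂ := Mat.frame (s := s₁.setReg rSum 0) hm₁ hF₂ (by simp)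
    have hu₂ : s₂.reg rU = u := by
      have := hF₂.reg rU (by simp); simpa [hu₁] using this
    simp only [Expr.eval, State.reg_setReg]
    rw [eval_entryE hc₂ hm₂ (e := .reg rU) (f := .reg rV) hu₂ hv₂ hu hv, Finset.sum_range_succ,
      hI₂]
    simp
  · intro s₂ hF₂ hI₂
    have hc₂ := (hc₁.setReg (x := rSum) (by norm_num)).frame hF₂ (by simp [Safe])
    have hm₂ : Mat E s₂ := Mat.frame (s := s₁.setReg rSum 0) hm₁ hF₂ (by simp)
    have hu₂ : s₂.reg rU = u := by
      have := hF₂.reg rU (by simp); simpa [hu₁] using this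
    have hok : s₂.reg rOk = s₁.reg rOk := by
      have := hF₂.reg rOk (by simp); simpa using this
    have hsplit : (s.reg rOk ≠ 0 ∧ ∀ u' < u + 1, P u') ↔ s₂.reg rOk ≠ 0 ∧ P u := by
      rw [hok, hI, Nat.forall_lt_succ_right, and_assoc]
    simp only [hsplit]
    refine Spec.seq (Spec.conseq (Q := fun s₃ => s₃.reg rOk ≠ 0 ↔
      s₂.reg rOk ≠ 0 ∧ ∑ v ∈ Finset.range n, entry E u v ≤ d + 1) (Spec.ite ?_ ?_) ?_)
    · intro h
      simp only [Expr.eval, hI₂] at h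
      exact Spec.assign (by simp; omega)
    · intro h
      simp only [Expr.eval, hI₂] at h
      exact Spec.nop (by simp; omega)
    · intro s₃ hF₃ hQ
      have hc₃ := hc₂.frame hF₃ (by simp [Safe, reject])
      have hm₃ := hm₂.frame hF₃ (by simp [reject])
      have hu₃ : s₃.reg rU = u := (hF₃.reg rU (by simp [reject])).trans hu₂
      have hs₃ : s₃.reg rSum = ∑ v ∈ Finset.range n, entry E u v :=
        (hF₃.reg rSum (by simp [reject])).trans hI₂
      have hent := eval_entryE hc₃ hm₃ (e := .reg rU) (f := .reg rU) hu₃ hu₃ hu hu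
      refine Spec.ite (fun h => Spec.nop ?_) fun h => Spec.ite (fun h' => Spec.assign ?_)
        fun h' => Spec.nop ?_
      · rw [hent] at h
        simp only [State.reg_setReg, hP]
        simp [hQ, h]
      · rw [hent] at h
        simp only [Expr.eval, hs₃] at h'
        simp only [State.reg_setReg, hP]
        simp only [Expr.eval]
        constructor
        · intro h; simp at h
        · exact fun hh => absurd (hh.2.2 h) h'
      · rw [hent] at h
        simp only [Expr.eval, hs₃] at h'
        simp only [State.reg_setReg, hP]
        simp [hQ, h, h']

/-- Count the active vertices and determine one of them. -/
def countActive : Prog :=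
  .seq (.assign rCnt (.lit 0)) (.seq (.assign rRoot (.lit 0))
    (.for rU (.reg rN) (.ite (entryE (.reg rU) (.reg rU))
      (.seq (.assign rCnt (.add (.reg rCnt) (.lit 1))) (.assign rRoot (.reg rU))) .nop)))

theorem countActive_spec (hc : Ctx n w s) (hm : Mat E s) (hn : n ≤ B) :
    Spec B countActive s fun s' => s'.reg rCnt = ∑ u ∈ Finset.range n, entry E u u ∧
      ∀ u < n, entry E u u ≠ 0 → s'.reg rRoot < n ∧ entry E (s'.reg rRoot) (s'.reg rRoot) ≠ 0 := by
  refine Spec.seq (Spec.assign (Spec.seq (Spec.assign ?_)))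
  set s₀ := (s.setReg rCnt (Expr.eval s (.lit 0))).setReg rRoot
    (Expr.eval (s.setReg rCnt (Expr.eval s (.lit 0))) (.lit 0)) with hs₀
  have hc₀ : Ctx n w s₀ := ⟨by simpa [hs₀] using hc.num, by simpa [hs₀] using hc.sq, hc.mul, hc.inp⟩
  have hm₀ : Mat E s₀ := hm
  refine Spec.for (N := n) (by simp) hn (fun s' hF => (hF.reg _ (by simp)).trans hc₀.num)
    (fun i s' => s'.reg rCnt = ∑ u ∈ Finset.range i, entry E u u ∧
      ∀ u < i, entry E u u ≠ 0 → s'.reg rRoot < n ∧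
        entry E (s'.reg rRoot) (s'.reg rRoot) ≠ 0) (by simp [hs₀]) ?_ (fun _ _ h => h)
  intro u s₁ hu hF₁ hu₁ ⟨hI, hI'⟩
  have hc₁ := hc₀.frame hF₁ (by simp [Safe])
  have hm₁ := hm₀.frame hF₁ (by simp)
  have hent := eval_entryE hc₁ hm₁ (e := .reg rU) (f := .reg rU) hu₁ hu₁ hu hu
  have hle : entry E u u ≤ 1 := by unfold entry; split <;> simp
  refine Spec.ite (fun h => Spec.seq (Spec.assign (Spec.assign ?_))) fun h => Spec.nop ?_
  · rw [hent] at h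
    have h1 : entry E u u = 1 := by omega
    simp [Finset.sum_range_succ, hI, h1, hu₁, hu]
  · rw [hent] at h
    simp only [State.reg_setReg, Finset.sum_range_succ, h]
    refine ⟨by simpa using hI, fun v hv hne => ?_⟩
    have hvu : v < u := lt_of_le_of_ne (by omega) (by rintro rfl; exact hne h)
    simpa using hI' v hvu hne

/-- Test that the number of active vertices is the number of stored configurations, or the number
of vertices if this is smaller. -/
def countCheck : Prog :=
  .seq countActive
    (.ite (absDiff (.reg rCnt) (.sub (.reg rN) (.sub (.reg rN) (.reg rLen)))) reject .nop)

theorem countCheck_spec (hc : Ctx n w s) (hm : Mat E s) (hn : n ≤ B) :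
    Spec B countCheck s fun s' => (s'.reg rOk ≠ 0 ↔ s.reg rOk ≠ 0 ∧
        ∑ u ∈ Finset.range n, entry E u u = min (s.reg rLen) n) ∧
      ∀ u < n, entry E u u ≠ 0 → s'.reg rRoot < n ∧ entry E (s'.reg rRoot) (s'.reg rRoot) ≠ 0 := by
  refine Spec.seq ((countActive_spec hc hm hn).conseq fun s₁ hF₁ ⟨h1, h2⟩ => ?_)
  have hlen : s₁.reg rLen = s.reg rLen := hF₁.reg _ (by simp [countActive])
  have hnum : s₁.reg rN = n := (hF₁.reg _ (by simp [countActive])).trans hc.num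
  have hok : s₁.reg rOk = s.reg rOk := hF₁.reg _ (by simp [countActive])
  refine Spec.ite (fun h => Spec.assign ⟨?_, by simpa using h2⟩) fun h => Spec.nop ⟨?_, h2⟩
  · rw [Ne, eval_absDiff] at h
    simp only [Expr.eval, hlen, hnum, h1] at h
    simp; omega
  · rw [eval_absDiff] at h
    simp only [Expr.eval, hlen, hnum, h1] at h
    rw [hok]
    constructor
    · exact fun h' => ⟨h', by omega⟩
    · exact fun h' => h'.1

/-- `level E r t v`: the vertex `v` can be reached from `r` by at most `t` steps along entries of
the matrix. -/
def level (E : Finset (Sym2 (Fin n))) (r : ℕ) : ℕ → ℕ → Prop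
  | 0, v => v = r
  | t + 1, v => level E r t v ∨ ∃ u < n, level E r t u ∧ v < n ∧ entry E u v ≠ 0

/-- Mark the vertices reachable from the root, and test that all active vertices are marked. -/
def reachCheck : Prog :=
  .seq (.for rV (.reg rN) (.store aReach (.reg rV) (.lit 0)))
  (.seq (.store aReach (.reg rRoot) (.lit 1))
  (.seq (.for rT (.reg rN) (.for rU (.reg rN) (.for rV (.reg rN)
    (.ite (.get aReach (.reg rU))
      (.ite (entryE (.reg rU) (.reg rV)) (.store aReach (.reg rV) (.lit 1)) .nop) .nop))))
    (.for rV (.reg rN) (.ite (entryE (.reg rV) (.reg rV))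
      (.ite (.get aReach (.reg rV)) .nop reject) .nop))))

/-- Here `R` is the set of marked vertices. -/
theorem reachCheck_spec (hc : Ctx n w s) (hm : Mat E s) (hn : n ≤ B) {r : ℕ}
    (hr : s.reg rRoot = r) :
    Spec B reachCheck s fun s' => ∃ R : ℕ → Prop,
      (s'.reg rOk ≠ 0 ↔ s.reg rOk ≠ 0 ∧ ∀ v < n, entry E v v ≠ 0 → R v) ∧
      (∀ v < n, level E r n v → R v) ∧ ∀ v < n, R v → ∃ t, level E r t v := by
  refine Spec.seq (Spec.for (N := n) (by simp) hn
    (fun s' hF => (hF.reg _ (by simp)).trans hc.num)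
    (fun i s' => ∀ v < i, s'.arr aReach v = 0) (by simp) ?_ ?_)
  · intro v s₁ _ _ hv₁ hI
    refine Spec.store ?_
    intro v' hv'
    simp only [Expr.eval, State.arr_setReg, State.arr_setArr, true_and, hv₁]
    split
    · rfl
    · exact hI v' (by omega)
  intro s₁ hF₁ hz
  have hc₁ := hc.frame hF₁ (by simp [Safe])
  have hm₁ := hm.frame hF₁ (by simp)
  have hr₁ : s₁.reg rRoot = r := (hF₁.reg _ (by simp)).trans hr
  have hok₁ : s₁.reg rOk = s.reg rOk := hF₁.reg _ (by simp)
  refine Spec.seq (Spec.store ?_)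
  simp only [Expr.eval, hr₁]
  set s₂ := s₁.setArr aReach r 1 with hs₂
  have hc₂ : Ctx n w s₂ := hc₁.setArr (by norm_num)
  have hm₂ : Mat E s₂ := fun j hj => by
    rw [← hm₁ j hj, hs₂, State.arr_setArr, if_neg (by simp)]
  -- `sound` and `lev t` are kept by all the loops; `lev (t + 1)` is what a round of the outer loop
  -- achieves
  set sound : State → Prop := fun s' => ∀ v < n, s'.arr aReach v ≠ 0 → ∃ t, level E r t v
    with hsound
  set lev : ℕ → State → Prop := fun t s' => ∀ v < n, level E r t v → s'.arr aReach v ≠ 0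
    with hlev
  have hbody : ∀ (s₅ : State) (u v : ℕ), Ctx n w s₅ → Mat E s₅ → u < n → v < n →
      s₅.reg rU = u → s₅.reg rV = v → sound s₅ →
      Spec B (.ite (.get aReach (.reg rU))
        (.ite (entryE (.reg rU) (.reg rV)) (.store aReach (.reg rV) (.lit 1)) .nop) .nop) s₅
        fun s₆ => sound s₆ ∧ (∀ x, s₅.arr aReach x ≠ 0 → s₆.arr aReach x ≠ 0) ∧
          (s₅.arr aReach u ≠ 0 → entry E u v ≠ 0 → s₆.arr aReach v ≠ 0) := by
    intro s₅ u v hc₅ hm₅ hu hv hu₅ hv₅ hs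
    have hent := eval_entryE hc₅ hm₅ (e := .reg rU) (f := .reg rV) hu₅ hv₅ hu hv
    refine Spec.ite (fun h => Spec.ite (fun h' => Spec.store ?_) fun h' => Spec.nop ?_)
      fun h => Spec.nop ?_
    · simp only [Expr.eval, hu₅] at h
      rw [hent] at h'
      simp only [Expr.eval, hv₅, State.arr_setArr, hsound, true_and]
      refine ⟨fun x hx hne => ?_, fun x hx => ?_, fun _ _ => by simp⟩
      · by_cases hxv : x = v
        · obtain ⟨t, ht⟩ := hs u hu h
          exact ⟨t + 1, .inr ⟨u, hu, ht, hx, hxv ▸ h'⟩⟩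
        · exact hs x hx (by simpa [hxv] using hne)
      · split
        · simp
        · exact hx
    · rw [hent] at h'
      exact ⟨hs, fun _ h => h, fun _ h'' => absurd h' h''⟩
    · simp only [Expr.eval, hu₅] at h
      exact ⟨hs, fun _ h => h, fun h'' => absurd h h''⟩
  refine Spec.seq (Spec.for (N := n) (by simp) hn
    (fun s' hF => (hF.reg _ (by simp)).trans hc₂.num) (fun t s' => sound s' ∧ lev t s') ?_ ?_ ?_)
  · constructor
    · intro v hv hne
      refine ⟨0, ?_⟩
      by_contra hvr
      have hvr : v ≠ r := hvr
      simp [hs₂, State.arr_setArr, hvr, hz v hv] at hne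
    · rintro v hv h
      have h : v = r := h
      simp [hs₂, State.arr_setArr, h]
  · rintro t s₃ ht hF₃ ht₃ ⟨hS₃, hL₃⟩
    have hc₃ := hc₂.frame hF₃ (by simp [Safe])
    have hm₃ := hm₂.frame hF₃ (by simp)
    refine Spec.for (N := n) (by simp) hn (fun s' hF => (hF.reg _ (by simp)).trans hc₃.num)
      (fun i s' => sound s' ∧ lev t s' ∧ ∀ u < i, level E r t u → ∀ v < n, entry E u v ≠ 0 →
        s'.arr aReach v ≠ 0) ⟨hS₃, hL₃, by simp⟩ ?_ ?_
    · rintro u s₄ hu hF₄ hu₄ ⟨hS₄, hL₄, hU₄⟩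
      have hc₄ := hc₃.frame hF₄ (by simp [Safe])
      have hm₄ := hm₃.frame hF₄ (by simp)
      refine Spec.for (N := n) (by simp) hn (fun s' hF => (hF.reg _ (by simp)).trans hc₄.num)
        (fun i s' => sound s' ∧ (∀ x, s₄.arr aReach x ≠ 0 → s'.arr aReach x ≠ 0) ∧
          (level E r t u → ∀ v < i, entry E u v ≠ 0 → s'.arr aReach v ≠ 0))
        ⟨hS₄, fun _ h => h, by simp⟩ ?_ ?_
      · rintro v s₅ hv hF₅ hv₅ ⟨hS₅, hM₅, hV₅⟩
        refine (hbody s₅ u v (hc₄.frame hF₅ (by simp [Safe])) (hm₄.frame hF₅ (by simp)) hu hv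
          ((hF₅.reg _ (by simp)).trans hu₄) hv₅ hS₅).conseq fun s₆ _ ⟨h1, h2, h3⟩ => ?_
        refine ⟨h1, fun x hx => h2 x (hM₅ x hx), fun hl v' hv' hne => ?_⟩
        rcases Nat.lt_succ_iff_lt_or_eq.1 hv' with h | rfl
        · exact h2 v' (hV₅ hl v' h hne)
        · exact h3 (hM₅ u (hL₄ u hu hl)) hne
      · rintro s₅ hF₅ ⟨hS₅, hM₅, hV₅⟩
        refine ⟨hS₅, fun v hv hl => hM₅ v (hL₄ v hv hl), fun u' hu' hl v hv hne => ?_⟩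
        rcases Nat.lt_succ_iff_lt_or_eq.1 hu' with h | rfl
        · exact hM₅ v (hU₄ u' h hl v hv hne)
        · exact hV₅ hl v hv hne
    · rintro s₄ hF₄ ⟨hS₄, hL₄, hU₄⟩
      refine ⟨hS₄, fun v hv hl => ?_⟩
      rcases hl with hl | ⟨u, hu, hl, -, hne⟩
      · exact hL₄ v hv hl
      · exact hU₄ u hu hl v hv hne
  · rintro s₃ hF₃ ⟨hS₃, hL₃⟩
    have hc₃ := hc₂.frame hF₃ (by simp [Safe])
    have hm₃ := hm₂.frame hF₃ (by simp)
    have hok₃ : s₃.reg rOk = s.reg rOk := (hF₃.reg _ (by simp)).trans hok₁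
    refine Spec.for (N := n) (by simp [reject]) hn
      (fun s' hF => (hF.reg _ (by simp [reject])).trans hc₃.num)
      (fun i s' => s'.reg rOk ≠ 0 ↔
        s.reg rOk ≠ 0 ∧ ∀ v < i, entry E v v ≠ 0 → s₃.arr aReach v ≠ 0) (by simp [hok₃]) ?_ ?_
    · intro v s₄ hv hF₄ hv₄ hI
      have hent := eval_entryE (hc₃.frame hF₄ (by simp [Safe, reject]))
        (hm₃.frame hF₄ (by simp [reject])) (e := .reg rV) (f := .reg rV) hv₄ hv₄ hv hv
      have ha : s₄.arr aReach = s₃.arr aReach := hF₄.arr _ (by simp [reject])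
      rw [Nat.forall_lt_succ_right, ← and_assoc, ← hI]
      refine Spec.ite (fun h => Spec.ite (fun h' => Spec.nop ?_) fun h' => Spec.assign ?_)
        fun h => Spec.nop ?_
      · simp only [Expr.eval, hv₄, ha] at h'
        simp [h']
      · simp only [Expr.eval, hv₄, ha] at h'
        rw [hent] at h
        simp [h', h]
      · rw [hent] at h
        simp [h]
    · intro s₄ _ hI
      exact ⟨fun v => s₃.arr aReach v ≠ 0, hI, hL₃, hS₃⟩

end KSets

/-! ### Testing consistency -/

namespace KSets

open RAM

variable {n : ℕ} {w : List ℕ} {s : State} {E : Finset (Sym2 (Fin n))} {B k d : ℕ}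

/-- The sum of a list of expressions. -/
def sumE : List Expr → Expr
  | [] => .lit 0
  | e :: l => .add e (sumE l)

theorem eval_sumE_eq_zero {l : List Expr} :
    (sumE l).eval s = 0 ↔ ∀ e ∈ l, e.eval s = 0 := by
  induction l with
  | nil => simp [sumE]
  | cons e l ih => simp [sumE, ih]

/-- The `i`-th element of the listed set that starts at the position in register `rPos`. -/
def elemE (i : ℕ) : Expr := .get aIn (.add (.reg rPos) (.lit i))

/-- The number of inactive elements of the current listed set. -/
def inactiveE (k : ℕ) : Expr :=
  sumE ((List.range k).map fun i => .sub (.lit 1) (entryE (elemE i) (elemE i)))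

/-- The number of cuts of the current listed set, given as a set of positions, that are crossed by
no edge. -/
noncomputable def emptyCutsE (k : ℕ) : Expr :=
  sumE (((Finset.univ : Finset (Finset (Fin k))).filter
      fun Y => Y.Nonempty ∧ Y ≠ Finset.univ).toList.map fun Y =>
    .sub (.lit 1) (sumE ((Y ×ˢ Yᶜ).toList.map fun p => entryE (elemE p.1) (elemE p.2))))

theorem eval_inactiveE (hc : Ctx n w s) (hm : Mat E s) {x : Fin k → Fin n}
    (hx : ∀ i : Fin k, s.arr aIn (s.reg rPos + i) = x i) :
    (inactiveE k).eval s = 0 ↔ ∀ i, x i ∈ active E := by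
  simp only [inactiveE, eval_sumE_eq_zero, List.forall_mem_map, List.mem_range, Expr.eval,
    mem_active]
  constructor
  · intro h i
    have h1 := h i i.2
    rw [eval_entryE hc hm (e := elemE i) (f := elemE i) (hx i) (hx i) (x i).2 (x i).2,
      entry_fin] at h1
    by_contra hcon
    simp [hcon] at h1
  · intro h i hi
    rw [eval_entryE hc hm (e := elemE i) (f := elemE i) (hx ⟨i, hi⟩) (hx ⟨i, hi⟩) (x _).2 (x _).2,
      entry_fin]
    simp [h ⟨i, hi⟩]

theorem eval_emptyCutsE (hc : Ctx n w s) (hm : Mat E s) (hk : 1 ≤ k) {x : Fin k → Fin n}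
    (hinj : Function.Injective x) (hx : ∀ i : Fin k, s.arr aIn (s.reg rPos + i) = x i) :
    (emptyCutsE k).eval s = 0 ↔ ConnOn (graph E) (Finset.univ.image x) := by
  have hterm : ∀ Y : Finset (Fin k),
      (Expr.sub (.lit 1) (sumE ((Y ×ˢ Yᶜ).toList.map fun p =>
        entryE (elemE p.1) (elemE p.2)))).eval s = 0 ↔
      ∃ i ∈ Y, ∃ j, j ∉ Y ∧ (graph E).Adj (x i) (x j) := by
    intro Y
    have h1 : ∀ a : ℕ, 1 - a = 0 ↔ ¬ a = 0 := by omega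
    rw [Expr.eval, Expr.eval, h1, eval_sumE_eq_zero]
    simp only [List.forall_mem_map, Finset.mem_toList, Finset.mem_product, Finset.mem_compl,
      Prod.forall, not_forall]
    have h2 : ∀ i j : Fin k, (entryE (elemE i) (elemE j)).eval s = entry E (x i) (x j) := fun i j =>
      eval_entryE hc hm (hx i) (hx j) (x i).2 (x j).2
    constructor
    · rintro ⟨i, j, ⟨hi, hj⟩, h⟩
      rw [h2] at h
      exact ⟨i, hi, j, hj, entry_fin_ne_zero.1 h, fun e => hj (hinj e ▸ hi)⟩
    · rintro ⟨i, hi, j, hj, h⟩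
      exact ⟨i, j, ⟨hi, hj⟩, by rw [h2]; exact entry_fin_ne_zero.2 h.1⟩
  rw [emptyCutsE, eval_sumE_eq_zero]
  simp only [List.forall_mem_map, Finset.mem_toList, Finset.mem_filter, Finset.mem_univ, true_and,
    hterm]
  constructor
  · intro h
    refine ⟨⟨x ⟨0, hk⟩, by simp⟩, ?_⟩
    rintro P ⟨y, hy, hPy⟩ ⟨z, hz, hPz⟩
    simp only [Finset.mem_image, Finset.mem_univ, true_and] at hy hz
    obtain ⟨i, rfl⟩ := hy
    obtain ⟨j, rfl⟩ := hz
    classical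
    obtain ⟨a, ha, b, hb, hab⟩ := h (Finset.univ.filter fun i => P (x i))
      ⟨⟨i, by simp [hPy]⟩, fun e => hPz (by simpa using (Finset.ext_iff.1 e j).2 (by simp))⟩
    exact ⟨x a, by simp, x b, by simp, by simpa using ha, by simpa using hb, hab⟩
  · rintro h Y ⟨⟨i, hi⟩, hY⟩
    obtain ⟨j, hj⟩ : ∃ j, j ∉ Y := by
      by_contra hcon
      push Not at hcon
      exact hY (Finset.eq_univ_iff_forall.2 hcon)
    obtain ⟨a, -, b, hb, ⟨a', ha', rfl⟩, hbY, hab⟩ := h.2 (fun v => ∃ i ∈ Y, x i = v)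
      ⟨x i, by simp, i, hi, rfl⟩
      ⟨x j, by simp, by rintro ⟨i', hi', h'⟩; exact hj (hinj h' ▸ hi')⟩
    simp only [Finset.mem_image, Finset.mem_univ, true_and] at hb
    obtain ⟨b', rfl⟩ := hb
    exact ⟨a', ha', b', fun hb' => hbY ⟨b', hb', rfl⟩, hab⟩

/-- Run through a list of sets whose length stands at position `c` of the input, and test for those
consisting of active vertices whether they are connected, resp. disconnected. -/
noncomputable def listCheck (k c : ℕ) (connected : Bool) : Prog :=
  .for rJ (.get aIn (.lit c))
    (.seq (.ite (inactiveE k) .nop (.ite (emptyCutsE k) (bif connected then reject else .nop)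
      (bif connected then .nop else reject)))
    (.assign rPos (.add (.reg rPos) (.lit k))))

theorem mem_regs_listCheck {c : ℕ} {b : Bool} {x : ℕ} (h : x ∈ (listCheck k c b).regs) :
    x = rJ ∨ x = rOk ∨ x = rPos := by
  cases b <;> simp [listCheck, reject] at h <;> omega

theorem arrs_listCheck {c : ℕ} {b : Bool} : (listCheck k c b).arrs = [] := by
  cases b <;> simp [listCheck, reject]

theorem safe_listCheck {c : ℕ} {b : Bool} : Safe (listCheck k c b) :=
  ⟨fun _ hx => by have := mem_regs_listCheck hx; omega, by simp [arrs_listCheck]⟩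

theorem listCheck_spec (hc : Ctx n w s) (hm : Mat E s) (hk : 1 ≤ k) (c p₀ : ℕ) (b : Bool)
    (L : List (List (Fin n))) (hL : ∀ l ∈ L, l.Nodup ∧ l.length = k) (hLB : L.length ≤ B)
    (hwc : w.getD c 0 = L.length) (hp₀ : s.reg rPos = p₀)
    (hw : ∀ j (hj : j < L.length) i (hi : i < (L[j]).length),
      w.getD (p₀ + k * j + i) 0 = ((L[j])[i] : Fin n)) :
    Spec B (listCheck k c b) s fun s' => s'.reg rPos = p₀ + k * L.length ∧
      (s'.reg rOk ≠ 0 ↔ s.reg rOk ≠ 0 ∧ ∀ l ∈ L, (∀ v ∈ l, v ∈ active E) →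
        (ConnOn (graph E) l.toFinset ↔ b = true)) := by
  set P : List (Fin n) → Prop := fun l => (∀ v ∈ l, v ∈ active E) →
        (ConnOn (graph E) l.toFinset ↔ b = true) with hP
  refine Spec.for (N := L.length) (by cases b <;> simp [reject]) hLB ?_
    (fun i s' => s'.reg rPos = p₀ + k * i ∧ (s'.reg rOk ≠ 0 ↔ s.reg rOk ≠ 0 ∧
      ∀ j (hj : j < L.length), j < i → P L[j])) (by simp [hp₀]) ?_ ?_
  · intro s' hF
    have := (hc.frame hF safe_listCheck).inp c
    exact this.trans hwc
  · rintro j s₁ hj hF₁ hj₁ ⟨hpos, hI⟩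
    have hc₁ := hc.frame hF₁ safe_listCheck
    have hm₁ := hm.frame hF₁ (show aMat ∉ (listCheck k c b).arrs by simp [arrs_listCheck])
    obtain ⟨hnd, hlen⟩ := hL L[j] (List.getElem_mem hj)
    set x : Fin k → Fin n := fun i => (L[j])[i.1]'(by rw [hlen]; exact i.2) with hx
    have hinj : Function.Injective x := fun a a' haa => by
      have := (hnd.getElem_inj_iff).1 haa
      exact Fin.ext this
    have hxs : ∀ i : Fin k, s₁.arr aIn (s₁.reg rPos + i) = x i := fun i => by
      rw [hpos, hc₁.inp, hw j hj i (by rw [hlen]; exact i.2)]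
    have himg : Finset.univ.image x = (L[j]).toFinset := by
      ext v
      simp only [Finset.mem_image, Finset.mem_univ, true_and, List.mem_toFinset,
        List.mem_iff_getElem, hx]
      constructor
      · rintro ⟨i, rfl⟩; exact ⟨i, by rw [hlen]; exact i.2, rfl⟩
      · rintro ⟨i, hi, rfl⟩; exact ⟨⟨i, by rwa [hlen] at hi⟩, rfl⟩
    have hact : (∀ i, x i ∈ active E) ↔ ∀ v ∈ L[j], v ∈ active E := by
      simp only [← List.mem_toFinset, ← himg, Finset.mem_image, Finset.mem_univ, true_and,
        forall_exists_index, forall_apply_eq_imp_iff]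
    have h1 := eval_inactiveE hc₁ hm₁ hxs
    have h2 := eval_emptyCutsE hc₁ hm₁ hk hinj hxs
    rw [himg] at h2
    rw [hact] at h1
    have hsplit : (s.reg rOk ≠ 0 ∧ ∀ j' (hj' : j' < L.length), j' < j + 1 → P L[j']) ↔
        s₁.reg rOk ≠ 0 ∧ P L[j] := by
      rw [hI, and_assoc]
      refine and_congr_right fun _ => ⟨fun h => ⟨fun j' hj' hlt => h j' hj' (by omega),
        h j hj (by omega)⟩, fun h j' hj' hlt => ?_⟩
      rcases Nat.lt_succ_iff_lt_or_eq.1 hlt with h' | rfl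
      · exact h.1 j' hj' h'
      · exact h.2
    refine Spec.seq (Spec.conseq (Q := fun s₂ => s₂.reg rOk ≠ 0 ↔ s₁.reg rOk ≠ 0 ∧ P L[j])
      (Spec.ite (fun h => Spec.nop ?_) fun h => ?_) fun s₂ hF₂ h => Spec.assign ⟨?_, ?_⟩)
    · have : P L[j] := fun ha => absurd (h1.2 ha) h
      simp [this]
    · have ha := h1.1 h
      have hPj : P L[j] ↔ (ConnOn (graph E) (L[j]).toFinset ↔ b = true) :=
        ⟨fun h' => h' ha, fun h' _ => h'⟩
      refine Spec.ite (fun h => ?_) fun h => ?_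
      · have h3 : ¬ ConnOn (graph E) (L[j]).toFinset := fun e => h (h2.2 e)
        cases b
        · exact Spec.nop (by simp [hPj, h3])
        · exact Spec.assign (by simp [hPj, h3])
      · have h3 := h2.1 h
        cases b
        · exact Spec.assign (by simp [hPj, h3])
        · exact Spec.nop (by simp [hPj, h3])
    · have : s₂.reg rPos = s₁.reg rPos := hF₂.reg _ (by cases b <;> simp [reject])
      simp [this, hpos, Nat.mul_add, Nat.add_assoc]
    · rw [hsplit, ← h]
      simp
  · rintro s₁ - ⟨hpos, hI⟩
    refine ⟨hpos, hI.trans (and_congr_right fun _ => ⟨fun h l hl => ?_, fun h j hj _ =>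
      h _ (List.getElem_mem hj)⟩)⟩
    obtain ⟨j, hj, rfl⟩ := List.mem_iff_getElem.1 hl
    exact h j hj hj

theorem getElem?_flatten_of_length {α : Type*} (L : List (List α)) (hL : ∀ l ∈ L, l.length = k)
    (T : List α) {j i : ℕ} (hj : j < L.length) (hi : i < (L[j]).length) :
    (L.flatten ++ T)[k * j + i]? = some (L[j])[i] := by
  induction L generalizing j with
  | nil => simp at hj
  | cons l L ih =>
    have hl : l.length = k := hL l (by simp)
    cases j with
    | zero =>
      simp only [List.getElem_cons_zero] at hi
      rw [List.flatten_cons, List.append_assoc, Nat.mul_zero, Nat.zero_add,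
        List.getElem?_append_left hi]
      simp [hi]
    | succ j =>
      rw [List.flatten_cons, List.append_assoc, List.getElem?_append_right (by
        rw [hl, Nat.mul_succ]; omega), hl]
      have h1 : k * (j + 1) + i - k = k * j + i := by rw [Nat.mul_succ]; omega
      rw [h1]
      exact ih (fun l' hl' => hL l' (by simp [hl'])) (by simpa using hj) (by simpa using hi)

/-- Test consistency with the two lists of sets. -/
noncomputable def setsCheck (k : ℕ) : Prog :=
  .seq (.assign rPos (.lit 3)) (.seq (listCheck k 1 true) (listCheck k 2 false))

theorem setsCheck_spec {L L' : List (List (Fin n))} (hc : Ctx n (inputWord n L L') s)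
    (hm : Mat E s) (hk : 1 ≤ k)
    (hL : ∀ l ∈ L, l.Nodup ∧ l.length = k) (hL' : ∀ l ∈ L', l.Nodup ∧ l.length = k)
    (hLB : L.length ≤ B) (hLB' : L'.length ≤ B) :
    Spec B (setsCheck k) s fun s' => s'.reg rOk ≠ 0 ↔ s.reg rOk ≠ 0 ∧
      (∀ l ∈ L, (∀ v ∈ l, v ∈ active E) → ConnOn (graph E) l.toFinset) ∧
      ∀ l ∈ L', (∀ v ∈ l, v ∈ active E) → ¬ ConnOn (graph E) l.toFinset := by
  have hflat : L.flatten.length = k * L.length := by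
    rw [List.length_flatten, List.eq_replicate_of_mem (l := L.map List.length) (a := k)]
    · simp [mul_comm]
    · simp only [List.mem_map]
      rintro b ⟨l, hl, rfl⟩
      exact (hL l hl).2
  refine Spec.seq (Spec.assign (Spec.seq ?_))
  have hc₀ := hc.setReg (x := rPos) (v := 3) (by norm_num)
  refine (listCheck_spec (B := B) hc₀ (show Mat E (s.setReg rPos 3) from hm) hk 1 3 true L hL hLB
    (by simp [inputWord]) (by simp) ?_).conseq ?_
  · intro j hj i hi
    have h1 := getElem?_flatten_of_length L (fun l hl => (hL l hl).2) L'.flatten hj hi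
    have h2 : 3 + k * j + i = k * j + i + 1 + 1 + 1 := by omega
    rw [inputWord, h2, List.getD_cons_succ, List.getD_cons_succ, List.getD_cons_succ,
      List.getD_eq_getElem?_getD, List.getElem?_map, h1]
    rfl
  rintro s₁ hF₁ ⟨hpos, hok⟩
  have hc₁ := hc₀.frame hF₁ safe_listCheck
  have hm₁ : Mat E s₁ := Mat.frame (s := s.setReg rPos 3) hm hF₁ (by simp [arrs_listCheck])
  refine (listCheck_spec (B := B) hc₁ hm₁ hk 2 _ false L' hL' hLB'
    (by simp [inputWord]) hpos ?_).conseq ?_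
  · intro j hj i hi
    have h1 := getElem?_flatten_of_length L' (fun l hl => (hL' l hl).2) [] hj hi
    rw [List.append_nil] at h1
    have h2 : 3 + k * L.length + k * j + i = k * L.length + (k * j + i) + 1 + 1 + 1 := by omega
    rw [inputWord, h2, List.getD_cons_succ, List.getD_cons_succ, List.getD_cons_succ,
      List.getD_eq_getElem?_getD, List.getElem?_map, List.getElem?_append_right (by omega), hflat,
      Nat.add_sub_cancel_left, h1]
    rfl
  rintro s₂ - ⟨-, hok'⟩
  rw [hok', hok]
  simp [and_assoc]

end KSets

/-! ### Visiting a configuration -/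

namespace KSets

open RAM

variable {n : ℕ} {w : List ℕ} {s : State} {E : Finset (Sym2 (Fin n))} {B k d : ℕ}

theorem sum_entry_diag (E : Finset (Sym2 (Fin n))) :
    ∑ u ∈ Finset.range n, entry E u u = (active E).card := by
  rw [Finset.sum_range]
  simp only [entry_fin, Finset.sum_boole, active, Nat.cast_id]

open Classical in
theorem sum_entry_row (E : Finset (Sym2 (Fin n))) (u : Fin n) :
    ∑ v ∈ Finset.range n, entry E u v =
      (Finset.univ.filter ((graph E).Adj u)).card + if u ∈ active E then 1 else 0 := by
  rw [Finset.sum_range]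
  simp only [entry_fin, Finset.sum_boole, Nat.cast_id]
  rw [← Finset.card_filter_add_card_filter_not (s := Finset.univ.filter fun v => s(u, v) ∈ E)
    (fun v => u ≠ v), Finset.filter_filter, Finset.filter_filter]
  congr 1
  · apply congrArg
    ext v
    simp [graph_adj]
  split
  next h =>
    rw [Finset.card_eq_one]
    refine ⟨u, ?_⟩
    ext v
    simp only [Finset.mem_filter, Finset.mem_univ, true_and, ne_eq, not_not, Finset.mem_singleton]
    exact ⟨fun h' => h'.2.symm, fun h' => ⟨by rw [h']; exact mem_active.1 h, h'.symm⟩⟩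
  next h =>
    rw [Finset.card_eq_zero, Finset.filter_eq_empty_iff]
    rintro v - ⟨h1, h2⟩
    rw [ne_eq, not_not] at h2
    subst h2
    exact h (mem_active.2 h1)

/-- The meaning of the test `rowsCheck`. -/
theorem rows_iff (E : Finset (Sym2 (Fin n))) :
    (∀ u < n, ∑ v ∈ Finset.range n, entry E u v ≤ d + 1 ∧
      (entry E u u = 0 → ∑ v ∈ Finset.range n, entry E u v = 0)) ↔
    Supported E ∧ MaxDegLE d (graph E) := by
  classical
  constructor
  · intro h
    refine ⟨fun x y hxy => ?_, fun u => ?_⟩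
    · by_contra hx
      have h1 := (h x x.2).2 (by rw [entry_fin, if_neg (fun e => hx (mem_active.2 e))])
      rw [sum_entry_row, Nat.add_eq_zero_iff, Finset.card_eq_zero,
        Finset.filter_eq_empty_iff] at h1
      exact h1.1 (Finset.mem_univ y) hxy
    · have h1 := h u u.2
      rw [sum_entry_row] at h1
      by_cases hu : u ∈ active E
      · rw [if_pos hu] at h1
        convert Nat.le_of_succ_le_succ h1.1
      · have h2 := h1.2 (by rw [entry_fin, if_neg (fun e => hu (mem_active.2 e))])
        have h3 : (Finset.univ.filter ((graph E).Adj u)).card ≤ d := by omega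
        convert h3
  · rintro ⟨hs, hd⟩ u hu
    have h1 := sum_entry_row E ⟨u, hu⟩
    simp only at h1
    rw [h1]
    refine ⟨Nat.add_le_add (by convert hd ⟨u, hu⟩) (by split <;> simp), fun h => ?_⟩
    have hua : (⟨u, hu⟩ : Fin n) ∉ active E := fun e => by
      have := entry_fin_ne_zero.2 (mem_active.1 e)
      exact this h
    rw [if_neg hua, Nat.add_zero, Finset.card_eq_zero, Finset.filter_eq_empty_iff]
    exact fun y _ hy => hua (hs _ y hy)

theorem level_mono (E : Finset (Sym2 (Fin n))) (r v : ℕ) : Monotone fun t => level E r t v :=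
  monotone_nat_of_le_succ fun _ h => .inl h

/-- The meaning of the test `reachCheck` when the root is an active vertex. -/
theorem reach_iff (hs : Supported E) {r : ℕ}
    (hr : ∀ u < n, entry E u u ≠ 0 → r < n ∧ entry E r r ≠ 0) {R : ℕ → Prop}
    (hR : ∀ v < n, level E r n v → R v) (hR' : ∀ v < n, R v → ∃ t, level E r t v) :
    (∀ v < n, entry E v v ≠ 0 → R v) ↔
      ((active E).Nonempty → ConnOn (graph E) (active E)) := by
  classical
  constructor
  · rintro h ⟨u, hu⟩
    obtain ⟨hrn, hrr⟩ := hr u u.2 (entry_fin_ne_zero.2 (mem_active.1 hu))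
    have hra : (⟨r, hrn⟩ : Fin n) ∈ active E := mem_active.2 (entry_fin_ne_zero.1 hrr)
    obtain ⟨A, hA, hrA, hAc, hmax⟩ := exists_component (graph E) hra
    have key : ∀ t, ∀ v : Fin n, level E r t v → v ∈ A := by
      intro t
      induction t with
      | zero =>
        intro v hv
        have hv : (v : ℕ) = r := hv
        rwa [show v = ⟨r, hrn⟩ from Fin.ext hv]
      | succ t ih =>
        rintro v (hv | ⟨x, hx, hl, -, hne⟩)
        · exact ih v hv
        · have hxA := ih ⟨x, hx⟩ hl
          have hmem : s(⟨x, hx⟩, v) ∈ E := entry_fin_ne_zero.1 hne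
          by_cases hxv : (⟨x, hx⟩ : Fin n) = v
          · exact hxv ▸ hxA
          · have hadj : (graph E).Adj ⟨x, hx⟩ v := ⟨hmem, hxv⟩
            by_contra hvA
            exact hmax _ hxA v (hs _ _ hadj.symm) hvA hadj
    rwa [Finset.Subset.antisymm hA fun v hv => by
      obtain ⟨t, ht⟩ := hR' v v.2 (h v v.2 (entry_fin_ne_zero.2 (mem_active.1 hv)))
      exact key t v ht] at hAc
  · intro h v hv hne
    have hva : (⟨v, hv⟩ : Fin n) ∈ active E := mem_active.2 (entry_fin_ne_zero.1 hne)
    obtain ⟨hrn, hrr⟩ := hr v hv hne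
    have hra : (⟨r, hrn⟩ : Fin n) ∈ active E := mem_active.2 (entry_fin_ne_zero.1 hrr)
    have h1 := (h ⟨_, hva⟩).subset_of_step (fun t => Finset.univ.filter fun v : Fin n =>
      level E r t v) hra (Finset.mem_filter.2 ⟨Finset.mem_univ _, rfl⟩) (fun a b hab v => by
        simpa using level_mono E r v hab) (fun t _ x _ hx y _ hxy => by
        simp only [Finset.mem_filter, Finset.mem_univ, true_and] at hx ⊢
        exact .inr ⟨x, x.2, hx, y.2, entry_fin_ne_zero.2 hxy.1⟩) hva
    simp only [Finset.mem_filter, Finset.mem_univ, true_and] at h1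
    exact hR v hv (level_mono E r v (by simpa using Finset.card_le_univ (active E)) h1)

theorem IsListing.nodup_length {S : Finset (Finset (Fin n))} {L : List (List (Fin n))}
    (hL : IsListing S L) (hc : ∀ X ∈ S, X.card = k) : ∀ l ∈ L, l.Nodup ∧ l.length = k := by
  intro l hl
  refine ⟨hL.1 l hl, ?_⟩
  rw [← List.toFinset_card_of_nodup (hL.1 l hl)]
  exact hc _ ((hL.2.2 _).1 (List.mem_map_of_mem hl))

theorem IsListing.forall_iff {S : Finset (Finset (Fin n))} {L : List (List (Fin n))}
    (hL : IsListing S L) (A : Finset (Fin n)) (P : Finset (Fin n) → Prop) :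
    (∀ l ∈ L, (∀ v ∈ l, v ∈ A) → P l.toFinset) ↔ ∀ X ∈ S, X ⊆ A → P X := by
  constructor
  · intro h X hX hXA
    obtain ⟨l, hl, rfl⟩ := List.mem_map.1 ((hL.2.2 X).2 hX)
    exact h l hl fun v hv => hXA (List.mem_toFinset.2 hv)
  · exact fun h l hl ha => h _ ((hL.2.2 _).1 (List.mem_map_of_mem hl)) fun v hv =>
      ha v (List.mem_toFinset.1 hv)

theorem IsComplete.consistentOn_iff {S S' : Finset (Finset (Fin n))} (h : IsComplete k S S') :
    ConsistentOn k S E ↔ (∀ X ∈ S, X ⊆ active E → ConnOn (graph E) X) ∧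
      ∀ X ∈ S', X ⊆ active E → ¬ ConnOn (graph E) X := by
  constructor
  · refine fun hE => ⟨fun X hX hXA => (hE X hXA ((h.2 X).1 (.inl hX))).2 hX, fun X hX hXA hc => ?_⟩
    exact Finset.disjoint_left.1 h.1 ((hE X hXA ((h.2 X).1 (.inr hX))).1 hc) hX
  · rintro ⟨h1, h2⟩ X hXA hXk
    refine ⟨fun hc => ?_, fun hX => h1 X hX hXA⟩
    exact ((h.2 X).2 hXk).resolve_right fun hX => h2 X hX hXA hc

/-- The stored configurations are those in the list `T`, each occupying `n * n` cells. -/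
structure Store (T : List (Finset (Sym2 (Fin n)))) (s : State) : Prop where
  len : s.reg rLen = T.length
  next : s.reg rEnd = T.length * (n * n)
  get : ∀ i (hi : i < T.length), ∀ j < n * n, s.arr aStore (i * (n * n) + j) = enc T[i] j

variable {T : List (Finset (Sym2 (Fin n)))}

theorem Store.frame {s' : State} {p : Prog} (h : Store T s) (hF : Frame p s s')
    (h1 : rLen ∉ p.regs) (h2 : rEnd ∉ p.regs) (h3 : aStore ∉ p.arrs) : Store T s' :=
  ⟨(hF.reg _ h1).trans h.len, (hF.reg _ h2).trans h.next, fun i hi j hj => by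
    rw [hF.arr _ h3, h.get i hi j hj]⟩

/-- Test that the current configuration is not among the stored ones. -/
def memberCheck : Prog :=
  .seq (.assign rQ (.lit 0))
    (.for rI (.reg rLen)
      (.seq (.assign rEq (.lit 1))
      (.seq (.for rJ (.reg rSq)
        (.seq (.ite (absDiff (.get aStore (.reg rQ)) (.get aMat (.reg rJ)))
          (.assign rEq (.lit 0)) .nop)
        (.assign rQ (.add (.reg rQ) (.lit 1)))))
      (.ite (.reg rEq) reject .nop))))

theorem memberCheck_spec (hc : Ctx n w s) (hm : Mat E s) (hT : Store T s) (hn : n * n ≤ B)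
    (hTB : T.length ≤ B) :
    Spec B memberCheck s fun s' => s'.reg rOk ≠ 0 ↔ s.reg rOk ≠ 0 ∧ E ∉ T := by
  refine Spec.seq (Spec.assign ?_)
  have hc₀ := hc.setReg (x := rQ) (v := 0) (by norm_num)
  have hm₀ : Mat E (s.setReg rQ 0) := hm
  have hT₀ : Store T (s.setReg rQ 0) := ⟨by simpa using hT.len, by simpa using hT.next, hT.get⟩
  refine Spec.for (N := T.length) (by simp [reject]) hTB
    (fun s' hF => (hF.reg _ (by simp [reject])).trans hT₀.len)
    (fun i s' => s'.reg rQ = i * (n * n) ∧ (s'.reg rOk ≠ 0 ↔ s.reg rOk ≠ 0 ∧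
      ∀ j (hj : j < T.length), j < i → E ≠ T[j])) (by simp) ?_ ?_
  · rintro i s₁ hi hF₁ hi₁ ⟨hq, hI⟩
    have hc₁ := hc₀.frame hF₁ (by simp [Safe, reject, or_imp, forall_and])
    have hm₁ := hm₀.frame hF₁ (by simp [reject])
    have hT₁ := hT₀.frame hF₁ (by simp [reject]) (by simp [reject]) (by simp [reject])
    have hsplit : (s.reg rOk ≠ 0 ∧ ∀ j' (hj' : j' < T.length), j' < i + 1 → E ≠ T[j']) ↔
        s₁.reg rOk ≠ 0 ∧ E ≠ T[i] := by
      rw [hI, and_assoc]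
      refine and_congr_right fun _ => ⟨fun h => ⟨fun j' hj' hlt => h j' hj' (by omega),
        h i hi (by omega)⟩, fun h j' hj' hlt => ?_⟩
      rcases Nat.lt_succ_iff_lt_or_eq.1 hlt with h' | rfl
      · exact h.1 j' hj' h'
      · exact h.2
    refine Spec.seq (Spec.assign (Spec.seq ?_))
    have hc₂ := hc₁.setReg (x := rEq) (v := 1) (by norm_num)
    have hm₂ : Mat E (s₁.setReg rEq 1) := hm₁
    refine Spec.for (N := n * n) (by simp) hn
      (fun s' hF => (hF.reg _ (by simp)).trans hc₂.sq)
      (fun j s' => s'.reg rQ = i * (n * n) + j ∧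
        (s'.reg rEq ≠ 0 ↔ ∀ j' < j, enc T[i] j' = enc E j')) (by simp [hq]) ?_ ?_
    · rintro j s₃ hj hF₃ hj₃ ⟨hq₃, hI₃⟩
      have hs₃ : s₃.arr aStore = s₁.arr aStore := hF₃.arr _ (by simp)
      have hm₃ := hm₂.frame hF₃ (by simp)
      have h1 : (Expr.get aStore (.reg rQ)).eval s₃ = enc T[i] j := by
        simp only [Expr.eval, hq₃, hs₃]
        exact hT₁.get i hi j hj
      have h2 : (Expr.get aMat (.reg rJ)).eval s₃ = enc E j := by
        simp only [Expr.eval, hj₃]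
        exact hm₃ j hj
      refine Spec.seq (Spec.ite (fun h => Spec.assign (Spec.assign ?_))
        fun h => Spec.nop (Spec.assign ?_))
      · rw [Ne, eval_absDiff, h1, h2] at h
        refine ⟨by simp [hq₃, Nat.add_assoc], ?_⟩
        simp only [State.reg_setReg, Expr.eval]
        rw [Nat.forall_lt_succ_right]
        simp [h]
      · rw [eval_absDiff, h1, h2] at h
        refine ⟨by simp [hq₃, Nat.add_assoc], ?_⟩
        rw [Nat.forall_lt_succ_right, ← hI₃]
        simp [h]
    · rintro s₃ hF₃ ⟨hq₃, hI₃⟩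
      have hok₃ : s₃.reg rOk = s₁.reg rOk := by
        have := hF₃.reg rOk (by simp); simpa using this
      have heq : s₃.reg rEq ≠ 0 ↔ E = T[i] := by
        rw [hI₃]
        exact ⟨fun h => (enc_injective h).symm, fun h j' _ => by rw [← h]⟩
      rw [hsplit]
      have hq' : i * (n * n) + n * n = (i + 1) * (n * n) := by rw [Nat.succ_mul]
      refine Spec.ite (fun h => Spec.assign ⟨by simp [hq₃, hq'], ?_⟩)
        fun h => Spec.nop ⟨by simp [hq₃, hq'], ?_⟩
      · simp [heq.1 h]
      · have h' : E ≠ T[i] := fun e => heq.2 e h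
        simp [h', hok₃]
  · rintro s₁ - ⟨-, hI⟩
    refine hI.trans (and_congr_right fun _ => ⟨fun h hE => ?_, fun h j hj _ e =>
      h (e ▸ List.getElem_mem hj)⟩)
    obtain ⟨j, hj, rfl⟩ := List.mem_iff_getElem.1 hE
    exact h j hj hj rfl

/-- Store the current configuration unless it has been rejected. -/
def append : Prog :=
  .ite (.reg rOk)
    (.seq (.for rJ (.reg rSq)
      (.seq (.store aStore (.reg rEnd) (.get aMat (.reg rJ)))
        (.assign rEnd (.add (.reg rEnd) (.lit 1)))))
    (.assign rLen (.add (.reg rLen) (.lit 1)))) .nop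

theorem append_spec (hc : Ctx n w s) (hm : Mat E s) (hT : Store T s) (hn : n * n ≤ B) :
    Spec B append s fun s' =>
      (s.reg rOk ≠ 0 → Store (T ++ [E]) s') ∧ (s.reg rOk = 0 → Store T s') := by
  refine Spec.ite (fun h => Spec.seq ?_) fun h => Spec.nop ⟨fun h' => absurd h h', fun _ => hT⟩
  refine Spec.for (N := n * n) (by simp) hn (fun s' hF => (hF.reg _ (by simp)).trans hc.sq)
    (fun j s' => s'.reg rEnd = T.length * (n * n) + j ∧
      (∀ i (hi : i < T.length), ∀ j' < n * n, s'.arr aStore (i * (n * n) + j') = enc T[i] j') ∧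
      ∀ j' < j, s'.arr aStore (T.length * (n * n) + j') = enc E j')
    ⟨by simp [hT.next], hT.get, by simp⟩ ?_ ?_
  · rintro j s₁ hj hF₁ hj₁ ⟨hend, hold, hnew⟩
    refine Spec.seq (Spec.store (Spec.assign ⟨by simp [hend, Nat.add_assoc], ?_, ?_⟩))
    · intro i hi j' hj'
      have h1 : (i + 1) * (n * n) ≤ T.length * (n * n) := Nat.mul_le_mul_right _ hi
      rw [Nat.succ_mul] at h1
      simp only [State.arr_setReg, State.arr_setArr, Expr.eval, hend, true_and]
      rw [if_neg (by omega), hold i hi j' hj']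
    · intro j' hj'
      simp only [State.arr_setReg, State.arr_setArr, Expr.eval, hend, true_and,
        Nat.add_left_cancel_iff]
      have hm₁ := hm.frame hF₁ (by simp)
      split
      next h => subst h; rw [hj₁, hm₁ j' hj]
      next h => exact hnew j' (by omega)
  · rintro s₁ hF₁ ⟨hend, hold, hnew⟩
    refine Spec.assign ⟨fun _ => ?_, fun h' => absurd h' h⟩
    have hlen : s₁.reg rLen = T.length := (hF₁.reg _ (by simp)).trans hT.len
    refine ⟨by simp [hlen], by simp [hend, Nat.succ_mul], fun i hi j hj => ?_⟩
    rw [State.arr_setReg, List.getElem_append]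
    split
    next h => exact hold i h j hj
    next h =>
      rw [List.length_append, List.length_singleton] at hi
      obtain rfl : i = T.length := by omega
      simpa using hnew j hj

/-- Test whether the current configuration is to be stored. -/
noncomputable def check (k d : ℕ) : Prog :=
  .seq (.assign rOk (.lit 1)) (.seq (rowsCheck d) (.seq countCheck (.seq reachCheck
    (.seq (setsCheck k) memberCheck))))

/-- The input describes a complete set of `k`-sets, and `B` bounds the lengths of its parts. -/
structure Valid (n B k : ℕ) (S S' : Finset (Finset (Fin n))) (L L' : List (List (Fin n))) :
    Prop where
  two_le : 2 ≤ k
  complete : IsComplete k S S'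
  listing : IsListing S L
  listing' : IsListing S' L'
  sq_le : n * n ≤ B
  length_le : L.length ≤ B
  length_le' : L'.length ≤ B

theorem Valid.le {S S' : Finset (Finset (Fin n))} {L L' : List (List (Fin n))}
    (h : Valid n B k S S' L L') : n ≤ B := (Nat.le_mul_self n).trans h.sq_le

theorem mem_regs_check {x : ℕ} (h : x ∈ (check k d).regs) : 6 ≤ x ∧ x ≤ 17 := by
  simp only [check, rowsCheck, countCheck, countActive, reachCheck, setsCheck, memberCheck, reject,
    Prog.regs, List.mem_append, List.mem_singleton, Prog.mem_regs_for, List.not_mem_nil, or_false,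
    false_or] at h
  rcases h with h | h | h | h | (h | h | h) | h
  any_goals omega
  all_goals have := mem_regs_listCheck h; omega

theorem mem_arrs_check {x : ℕ} (h : x ∈ (check k d).arrs) : x = aReach := by
  simpa [check, rowsCheck, countCheck, countActive, reachCheck, setsCheck, memberCheck, reject,
    arrs_listCheck] using h

theorem check_spec {S S' : Finset (Finset (Fin n))} {L L' : List (List (Fin n))}
    (hv : Valid n B k S S' L L') (hc : Ctx n (inputWord n L L') s)
    (hm : Mat E s) (hT : Store T s) (hTB : T.length ≤ B) :
    Spec B (check k d) s fun s' => s'.reg rOk ≠ 0 ↔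
      Good k d S E ∧ (active E).card = min T.length n ∧ E ∉ T := by
  have hk := hv.two_le
  have hL := hv.listing.nodup_length (k := k) fun X hX => (hv.complete.2 X).1 (.inl hX)
  have hL' := hv.listing'.nodup_length (k := k) fun X hX => (hv.complete.2 X).1 (.inr hX)
  refine Spec.seq (Spec.assign (Spec.seq ?_))
  have hc₀ := hc.setReg (x := rOk) (v := 1) (by norm_num)
  have hm₀ : Mat E (s.setReg rOk 1) := hm
  have hT₀ : Store T (s.setReg rOk 1) := ⟨by simpa using hT.len, by simpa using hT.next, hT.get⟩
  refine (rowsCheck_spec (B := B) hc₀ hm₀ hv.le d).conseq fun s₁ hF₁ h₁ => ?_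
  have hc₁ := hc₀.frame hF₁ (by simp [Safe, rowsCheck, reject, or_imp, forall_and])
  have hm₁ := hm₀.frame hF₁ (by simp [rowsCheck, reject])
  have hT₁ := hT₀.frame hF₁ (by simp [rowsCheck, reject]) (by simp [rowsCheck, reject])
    (by simp [rowsCheck, reject])
  refine Spec.seq ((countCheck_spec (B := B) hc₁ hm₁ hv.le).conseq fun s₂ hF₂ ⟨h₂, hr⟩ => ?_)
  have hc₂ := hc₁.frame hF₂ (by simp [Safe, countCheck, countActive, reject, or_imp, forall_and])
  have hm₂ := hm₁.frame hF₂ (by simp [countCheck, countActive, reject])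
  have hT₂ := hT₁.frame hF₂ (by simp [countCheck, countActive, reject])
    (by simp [countCheck, countActive, reject]) (by simp [countCheck, countActive, reject])
  refine Spec.seq ((reachCheck_spec (B := B) hc₂ hm₂ hv.le rfl).conseq
    fun s₃ hF₃ ⟨R, h₃, hR, hR'⟩ => ?_)
  have hc₃ := hc₂.frame hF₃ (by simp [Safe, reachCheck, reject, or_imp, forall_and])
  have hm₃ := hm₂.frame hF₃ (by simp [reachCheck, reject])
  have hT₃ := hT₂.frame hF₃ (by simp [reachCheck, reject])
    (by simp [reachCheck, reject]) (by simp [reachCheck, reject])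
  refine Spec.seq ((setsCheck_spec (B := B) hc₃ hm₃ (by omega) hL hL' hv.length_le
    hv.length_le').conseq fun s₄ hF₄ h₄ => ?_)
  have hregs : ∀ x ∈ (setsCheck k).regs, x = rJ ∨ x = rOk ∨ x = rPos := by
    intro x hx
    simp only [setsCheck, Prog.regs, List.mem_append, List.mem_singleton] at hx
    rcases hx with h | h | h
    · simp [h]
    · exact mem_regs_listCheck h
    · exact mem_regs_listCheck h
  have hc₄ := hc₃.frame hF₄ ⟨fun x hx => by have := hregs x hx; omega,
    by simp [setsCheck, arrs_listCheck]⟩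
  have hm₄ := hm₃.frame hF₄ (by simp [setsCheck, arrs_listCheck])
  have hT₄ := hT₃.frame hF₄ (fun hx => by have := hregs _ hx; omega)
    (fun hx => by have := hregs _ hx; omega) (by simp [setsCheck, arrs_listCheck])
  refine (memberCheck_spec (B := B) hc₄ hm₄ hT₄ hv.sq_le hTB).conseq fun s₅ _ h₅ => ?_
  rw [h₅, h₄, h₃, h₂, h₁, rows_iff, sum_entry_diag, hT₁.len,
    hv.listing.forall_iff (active E) (ConnOn (graph E)),
    hv.listing'.forall_iff (active E) fun X => ¬ ConnOn (graph E) X, ← hv.complete.consistentOn_iff]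
  constructor
  · rintro ⟨⟨⟨⟨⟨-, hs, hd⟩, hcard⟩, hreach⟩, hcons⟩, hmem⟩
    exact ⟨⟨hs, hd, (reach_iff hs hr hR hR').1 hreach, hcons⟩, hcard, hmem⟩
  · rintro ⟨hg, hcard, hmem⟩
    exact ⟨⟨⟨⟨⟨by simp, hg.supp, hg.deg⟩, hcard⟩, (reach_iff hg.supp hr hR hR').2 hg.conn⟩,
      hg.cons⟩, hmem⟩

/-- Store the current configuration if it is good, has the right number of active vertices, and is
new. -/
noncomputable def visit (k d : ℕ) : Prog := .seq (check k d) append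

theorem mem_regs_visit {x : ℕ} (h : x ∈ (visit k d).regs) : x = rLen ∨ x = rEnd ∨ 6 ≤ x ∧ x ≤ 17 := by
  simp only [visit, Prog.regs, List.mem_append] at h
  rcases h with h | h
  · exact .inr (.inr (mem_regs_check h))
  · simp [append] at h; omega

theorem mem_arrs_visit {x : ℕ} (h : x ∈ (visit k d).arrs) : x = aStore ∨ x = aReach := by
  simp only [visit, Prog.arrs, List.mem_append] at h
  rcases h with h | h
  · exact .inr (mem_arrs_check h)
  · simp [append] at h; omega

theorem silent_visit : (visit k d).silent = true := by
  simp [visit, append, check, rowsCheck, countCheck, countActive, reachCheck, setsCheck,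
    memberCheck, reject, listCheck]

open Classical in
theorem visit_spec {S S' : Finset (Finset (Fin n))} {L L' : List (List (Fin n))}
    (hv : Valid n B k S S' L L') (hc : Ctx n (inputWord n L L') s)
    (hm : Mat E s) (hT : Store T s) (hTB : T.length ≤ B) :
    Spec B (visit k d) s fun s' =>
      Store (if Good k d S E ∧ (active E).card = min T.length n ∧ E ∉ T then T ++ [E] else T) s' := by
  refine Spec.seq ((check_spec hv hc hm hT hTB).conseq fun s₁ hF₁ h₁ => ?_)
  have hc₁ := hc.frame hF₁ ⟨fun x hx => by have := mem_regs_check hx; omega,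
    fun x hx => by have := mem_arrs_check hx; omega⟩
  have hm₁ := hm.frame hF₁ fun hx => by have := mem_arrs_check hx; omega
  have hT₁ := hT.frame hF₁ (fun hx => by have := mem_regs_check hx; omega)
    (fun hx => by have := mem_regs_check hx; omega) fun hx => by have := mem_arrs_check hx; omega
  refine (append_spec hc₁ hm₁ hT₁ hv.sq_le).conseq fun s₂ _ ⟨h2, h2'⟩ => ?_
  split
  next h => exact h2 (h₁.2 h)
  next h => exact h2' (by by_contra hne; exact h (h₁.1 hne))

end KSets

/-! ### Searching the neighbourhood of a configuration -/

namespace KSets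

open RAM

variable {n : ℕ} {w : List ℕ} {s : State} {E : Finset (Sym2 (Fin n))} {B k d : ℕ}
  {S S' : Finset (Finset (Fin n))} {L L' : List (List (Fin n))}
  {T T' T'' : List (Finset (Sym2 (Fin n)))}

/-- Change the membership of the pair in registers `x` and `y`. The second entry is copied from the
first one, so that the two assignments do not cancel on a loop. -/
def toggle (x y : ℕ) : Prog :=
  .seq (.store aMat (indexE (.reg x) (.reg y))
      (.sub (.lit 1) (entryE (.reg x) (.reg y))))
    (.store aMat (indexE (.reg y) (.reg x)) (entryE (.reg x) (.reg y)))

theorem mul_add_inj {a b u v : ℕ} (hb : b < n) (hv : v < n) :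
    a * n + b = u * n + v ↔ a = u ∧ b = v := by
  constructor
  · intro h
    have hn : 0 < n := by omega
    have h1 : (a * n + b) / n = a := by
      rw [Nat.add_comm, Nat.add_mul_div_right _ _ hn, Nat.div_eq_of_lt hb, Nat.zero_add]
    have h2 : (u * n + v) / n = u := by
      rw [Nat.add_comm, Nat.add_mul_div_right _ _ hn, Nat.div_eq_of_lt hv, Nat.zero_add]
    have h3 : a = u := by rw [← h1, ← h2, h]
    subst h3
    exact ⟨rfl, by omega⟩
  · rintro ⟨rfl, rfl⟩; rfl

theorem mat_of_entry (h : ∀ a b : Fin n, s.arr aMat (a * n + b) = entry E a b) : Mat E s := by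
  intro j hj
  have hn : 0 < n := by
    by_contra h0
    have : n = 0 := by omega
    simp [this] at hj
  have h1 := h ⟨j / n, Nat.div_lt_of_lt_mul hj⟩ ⟨j % n, Nat.mod_lt _ hn⟩
  simp only at h1
  rwa [Nat.mul_comm, Nat.div_add_mod] at h1

theorem toggle_spec (hc : Ctx n w s) (hm : Mat E s) {x y : ℕ} {u v : Fin n} (hx : s.reg x = u)
    (hy : s.reg y = v) : Spec B (toggle x y) s (Mat (symmDiff E {s(u, v)})) := by
  have hent := eval_entryE hc hm (e := .reg x) (f := .reg y) hx hy u.2 v.2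
  have hidx := eval_indexE hc (e := .reg x) (f := .reg y) hx hy u.2
  refine Spec.seq (Spec.store (Spec.store (mat_of_entry fun a b => ?_)))
  rw [hidx, Expr.eval, hent]
  set s₁ := s.setArr aMat (u * n + v) (Expr.eval s (.lit 1) - entry E u v) with hs₁
  have hc₁ : Ctx n w s₁ := hc.setArr (by norm_num)
  rw [eval_indexE hc₁ (e := .reg y) (f := .reg x) hy hx v.2, entryE, Expr.eval,
    eval_indexE hc₁ (e := .reg x) (f := .reg y) hx hy u.2]
  have hold : s.arr aMat (a * n + b) = entry E a b := by
    rw [hm _ (mul_add_lt_sq a.2 b.2), enc_mul_add _ b.2]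
  simp only [hs₁, State.arr_setArr, true_and, and_self, if_true, Expr.eval,
    mul_add_inj b.2 u.2, mul_add_inj b.2 v.2, hold, ← Fin.ext_iff, entry_fin,
    Finset.mem_symmDiff, Finset.mem_singleton, Sym2.eq_iff]
  by_cases h1 : a = v ∧ b = u
  · obtain ⟨rfl, rfl⟩ := h1
    rw [Sym2.eq_swap (a := b)]
    by_cases h2 : s(a, b) ∈ E <;> simp [h2]
  · by_cases h2 : a = u ∧ b = v
    · obtain ⟨rfl, rfl⟩ := h2
      by_cases h3 : s(a, b) ∈ E <;> simp [h1, h3]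
    · simp [h1, h2]

/-- Visit all configurations that differ from the current one in at most `c` pairs. Each level of the
recursion has its own two loop variables; registers from `20` on are not used otherwise. -/
noncomputable def search (k d : ℕ) : ℕ → Prog
  | 0 => visit k d
  | c + 1 => .seq (visit k d)
      (.for (20 + 2 * c) (.reg rN) (.for (21 + 2 * c) (.reg rN)
        (.seq (toggle (20 + 2 * c) (21 + 2 * c))
          (.seq (search k d c) (toggle (20 + 2 * c) (21 + 2 * c))))))

theorem mem_regs_search {c x : ℕ} (h : x ∈ (search k d c).regs) :
    x = rLen ∨ x = rEnd ∨ 6 ≤ x ∧ x < 20 + 2 * c := by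
  induction c with
  | zero => have := mem_regs_visit h; omega
  | succ c ih =>
    simp only [search, toggle, Prog.regs, List.mem_append, Prog.mem_regs_for, List.not_mem_nil,
      false_or, or_false] at h
    rcases h with h | h | h | h
    · have := mem_regs_visit h; omega
    · omega
    · omega
    · have := ih h; omega

theorem mem_arrs_search {c x : ℕ} (h : x ∈ (search k d c).arrs) :
    x = aMat ∨ x = aStore ∨ x = aReach := by
  induction c with
  | zero => have := mem_arrs_visit h; omega
  | succ c ih =>
    simp only [search, toggle, Prog.arrs, List.mem_append, Prog.arrs_for,
      List.mem_singleton] at h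
    rcases h with h | (h | h) | h | h | h
    · have := mem_arrs_visit h; omega
    · omega
    · omega
    · exact ih h
    · omega
    · omega

theorem safe_search {c : ℕ} : Safe (search k d c) :=
  ⟨fun _ hx => by have := mem_regs_search hx; omega,
    fun _ hx => by have := mem_arrs_search hx; omega⟩

theorem silent_search {c : ℕ} : (search k d c).silent = true := by
  induction c with
  | zero => exact silent_visit
  | succ c ih => simp [search, silent_visit, toggle, ih]

/-- The list holds distinct partial solutions, the `i`-th one with `min i n` active vertices. So one
partial solution is kept for each number of active vertices below `n`, and its length exceeds the
number of full solutions by at most `n`. -/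
structure Stored (k d : ℕ) (S : Finset (Finset (Fin n))) (T : List (Finset (Sym2 (Fin n)))) :
    Prop where
  good : ∀ i (hi : i < T.length), Good k d S T[i]
  card : ∀ i (hi : i < T.length), (active T[i]).card = min i n
  nodup : T.Nodup

open Classical in
/-- The number of full solutions. -/
noncomputable def numSolutions (k d : ℕ) (S : Finset (Finset (Fin n))) : ℕ :=
  (Finset.univ.filter fun E => Good k d S E ∧ active E = Finset.univ).card

theorem Stored.mem_drop (h : Stored k d S T) :
    E ∈ T.drop n ↔ E ∈ T ∧ active E = Finset.univ := by
  have hcard : ∀ E : Finset (Sym2 (Fin n)), active E = Finset.univ ↔ (active E).card = n := by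
    intro E
    rw [← Finset.card_eq_iff_eq_univ, Fintype.card_fin]
  rw [hcard]
  constructor
  · intro hE
    obtain ⟨i, hi, rfl⟩ := List.mem_iff_getElem.1 hE
    rw [List.length_drop] at hi
    rw [List.getElem_drop, h.card]
    exact ⟨List.getElem_mem _, by omega⟩
  · rintro ⟨hE, ha⟩
    obtain ⟨i, hi, rfl⟩ := List.mem_iff_getElem.1 hE
    rw [h.card i hi] at ha
    rw [List.mem_iff_getElem]
    refine ⟨i - n, by rw [List.length_drop]; omega, ?_⟩
    rw [List.getElem_drop]
    congr 1
    omega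

theorem Stored.good_of_mem (h : Stored k d S T) (hE : E ∈ T) : Good k d S E := by
  obtain ⟨i, hi, rfl⟩ := List.mem_iff_getElem.1 hE
  exact h.good i hi

theorem Stored.length_drop_le (h : Stored k d S T) : (T.drop n).length ≤ numSolutions k d S := by
  classical
  have hnd : (T.drop n).Nodup := h.nodup.sublist (List.drop_sublist n T)
  rw [← List.toFinset_card_of_nodup hnd]
  refine Finset.card_le_card fun E hE => ?_
  rw [List.mem_toFinset, h.mem_drop] at hE
  simp [h.good_of_mem hE.1, hE.2]

theorem Stored.length_le (h : Stored k d S T) : T.length ≤ n + numSolutions k d S := by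
  have := h.length_drop_le
  rw [List.length_drop] at this
  omega

/-- If `H` has been visited while the length of the list passed from at least `m` to its final
value, and `H` was to be stored throughout, then `H` is in the list. -/
def Visited (k d : ℕ) (S : Finset (Finset (Fin n))) (m : ℕ) (T : List (Finset (Sym2 (Fin n))))
    (H : Finset (Sym2 (Fin n))) : Prop :=
  Good k d S H → (∀ j, m ≤ j → j ≤ T.length → (active H).card = min j n) → H ∈ T

theorem Visited.mono {m m' : ℕ} {H : Finset (Sym2 (Fin n))} (h : Visited k d S m T H)
    (hm : m' ≤ m) (hT : T <+: T') : Visited k d S m' T' H := fun hg hj =>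
  hT.subset (h hg fun j h1 h2 => hj j (hm.trans h1) (h2.trans hT.length_le))

/-- The list `T` has been extended to `T'` by visiting at least the configurations in `Hs`. -/
structure Progress (k d : ℕ) (S : Finset (Finset (Fin n))) (Hs : Set (Finset (Sym2 (Fin n))))
    (T T' : List (Finset (Sym2 (Fin n)))) : Prop where
  pre : T <+: T'
  stored : Stored k d S T'
  visited : ∀ H ∈ Hs, Visited k d S T.length T' H

theorem Progress.trans {Hs Hs' : Set (Finset (Sym2 (Fin n)))} (h : Progress k d S Hs T T')
    (h' : Progress k d S Hs' T' T'') : Progress k d S (Hs ∪ Hs') T T'' where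
  pre := h.pre.trans h'.pre
  stored := h'.stored
  visited := by
    rintro H (hH | hH)
    · exact (h.visited H hH).mono le_rfl h'.pre
    · exact (h'.visited H hH).mono h.pre.length_le (List.prefix_refl _)

theorem Progress.mono {Hs Hs' : Set (Finset (Sym2 (Fin n)))} (h : Progress k d S Hs T T')
    (hs : Hs' ⊆ Hs) : Progress k d S Hs' T T' :=
  ⟨h.pre, h.stored, fun H hH => h.visited H (hs hH)⟩

theorem Progress.refl (h : Stored k d S T) : Progress k d S ∅ T T :=
  ⟨List.prefix_refl _, h, by simp⟩

theorem Stored.concat (h : Stored k d S T) (hE : Good k d S E)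
    (hcard : (active E).card = min T.length n) (hmem : E ∉ T) : Stored k d S (T ++ [E]) where
  good := fun i hi => by
    rw [List.getElem_append]
    split
    · exact h.good i _
    · simpa using hE
  card := fun i hi => by
    rw [List.getElem_append]
    split
    · exact h.card i _
    · rw [List.length_append, List.length_singleton] at hi
      obtain rfl : i = T.length := by omega
      simpa using hcard
  nodup := by
    rw [List.nodup_append]
    refine ⟨h.nodup, by simp, fun a ha b hb => ?_⟩
    rw [List.mem_singleton] at hb
    rintro rfl
    exact hmem (hb ▸ ha)

theorem visit_progress (hv : Valid n B k S S' L L') (hB : n + numSolutions k d S ≤ B)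
    (hc : Ctx n (inputWord n L L') s) (hm : Mat E s) (hT : Store T s) (hS : Stored k d S T) :
    Spec B (visit k d) s fun s' => Mat E s' ∧ ∃ T', Store T' s' ∧ Progress k d S {E} T T' := by
  classical
  refine (visit_spec (d := d) hv hc hm hT (hS.length_le.trans hB)).conseq fun s' hF h => ?_
  refine ⟨hm.frame hF fun hx => by have := mem_arrs_visit hx; omega, _, h, ?_⟩
  split
  next h1 =>
    refine ⟨List.prefix_append _ _, hS.concat h1.1 h1.2.1 h1.2.2, ?_⟩
    rintro H rfl _ _
    simp
  next h1 =>
    refine ⟨List.prefix_refl _, hS, ?_⟩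
    rintro H rfl hg hj
    by_contra hmem
    exact h1 ⟨hg, hj _ le_rfl le_rfl, hmem⟩

/-- The search leaves the current configuration unchanged in the end. -/
theorem search_spec (hv : Valid n B k S S' L L') (hB : n + numSolutions k d S ≤ B) (c : ℕ)
    (hc : Ctx n (inputWord n L L') s) (hm : Mat E s) (hT : Store T s) (hS : Stored k d S T) :
    Spec B (search k d c) s fun s' => Mat E s' ∧ ∃ T', Store T' s' ∧
      Progress k d S {H | (symmDiff E H).card ≤ c} T T' := by
  induction c generalizing s E T with
  | zero =>
    refine (visit_progress hv hB hc hm hT hS).conseq fun s' _ ⟨h1, T', h2, h3⟩ => ⟨h1, T', h2, ?_⟩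
    refine h3.mono fun H hH => ?_
    have h0 : symmDiff E H = ⊥ := Finset.card_eq_zero.1 (Nat.le_zero.1 hH)
    exact (symmDiff_eq_bot.1 h0).symm
  | succ c ih =>
    obtain ⟨x, hx⟩ : ∃ x, x = 20 + 2 * c := ⟨_, rfl⟩
    obtain ⟨y, hy⟩ : ∃ y, y = 21 + 2 * c := ⟨_, rfl⟩
    rw [search, ← hx, ← hy]
    have hsr : ∀ z, z ∈ (search k d c).regs → z ≠ x ∧ z ≠ y := fun z hz => by
      have := mem_regs_search hz; omega
    have hxs : x ∉ (search k d c).regs := fun h => (hsr _ h).1 rfl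
    have hys : y ∉ (search k d c).regs := fun h => (hsr _ h).2 rfl
    have h0s : rN ∉ (search k d c).regs := fun h => by have := mem_regs_search h; omega
    have hxy : x ≠ y := by omega
    have hx2 : 2 ≤ x := by omega
    have hy2 : 2 ≤ y := by omega
    have hss : Safe (.seq (toggle x y) (.seq (search k d c) (toggle x y))) := by
      constructor
      · intro z hz
        simp only [toggle, Prog.regs, List.mem_append, List.not_mem_nil, false_or, or_false] at hz
        exact safe_search.1 z hz
      · intro z hz
        simp only [toggle, Prog.arrs, List.mem_append, List.mem_singleton] at hz
        rcases hz with (hz | hz) | hz | hz | hz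
        any_goals omega
        exact safe_search.2 z hz
    refine Spec.seq ((visit_progress hv hB hc hm hT hS).conseq fun s₁ hF₁ ⟨hm₁, T₁, hT₁, hP₁⟩ => ?_)
    have hc₁ := hc.frame hF₁ ⟨fun x hx => by have := mem_regs_visit hx; omega,
      fun x hx => by have := mem_arrs_visit hx; omega⟩
    refine Spec.for (N := n) (by simp [toggle, hxs, hxy]) hv.le
      (fun s' hF => (hF.reg _ (by simp [toggle, h0s]; omega)).trans hc₁.num)
      (fun i s' => Mat E s' ∧ ∃ T', Store T' s' ∧
        Progress k d S {H | ∃ a b : Fin n, a < i ∧ (symmDiff (symmDiff E {s(a, b)}) H).card ≤ c}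
          T₁ T') ?_ ?_ ?_
    · refine ⟨hm₁, T₁, ⟨?_, ?_, hT₁.get⟩, (Progress.refl hP₁.stored).mono ?_⟩
      · rw [State.reg_setReg, if_neg (by omega), hT₁.len]
      · rw [State.reg_setReg, if_neg (by omega), hT₁.next]
      · rintro H ⟨a, b, h, -⟩; omega
    · rintro i s₂ hi hF₂ hi₂ ⟨hm₂, T₂, hT₂, hP₂⟩
      have hc₂ := hc₁.frame hF₂ ⟨fun z hz => by
          simp only [Prog.mem_regs_for] at hz
          rcases hz with hz | hz | hz
          · omega
          · omega
          · exact hss.1 z hz,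
        fun z hz => by
          simp only [Prog.arrs_for] at hz
          exact hss.2 z hz⟩
      refine Spec.for (N := n) (by simp [toggle, hys]) hv.le
        (fun s' hF => (hF.reg _ (by simp [toggle, h0s]; omega)).trans hc₂.num)
        (fun j s' => Mat E s' ∧ ∃ T', Store T' s' ∧
          Progress k d S {H | ∃ b : Fin n, b < j ∧
            (symmDiff (symmDiff E {s((⟨i, hi⟩ : Fin n), b)}) H).card ≤ c} T₂ T') ?_ ?_ ?_
      · refine ⟨hm₂, T₂, ⟨?_, ?_, hT₂.get⟩, (Progress.refl hP₂.stored).mono ?_⟩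
        · rw [State.reg_setReg, if_neg (by omega), hT₂.len]
        · rw [State.reg_setReg, if_neg (by omega), hT₂.next]
        · rintro H ⟨b, h, -⟩; omega
      · rintro j s₃ hj hF₃ hj₃ ⟨hm₃, T₃, hT₃, hP₃⟩
        have hc₃ := hc₂.frame hF₃ ⟨fun z hz => by
            simp only [Prog.mem_regs_for] at hz
            rcases hz with hz | hz
            · omega
            · exact hss.1 z hz,
          fun z hz => by
            simp only [Prog.arrs_for] at hz
            exact hss.2 z hz⟩
        have hi₃ : s₃.reg x = i := (hF₃.reg _ (by simp [toggle, hxs, hxy])).trans hi₂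
        refine Spec.seq ((toggle_spec hc₃ hm₃ (u := ⟨i, hi⟩) (v := ⟨j, hj⟩) hi₃ hj₃).conseq
          fun s₄ hF₄ hm₄ => ?_)
        have hc₄ := hc₃.frame hF₄ (by simp [Safe, toggle])
        have hT₄ := hT₃.frame hF₄ (by simp [toggle]) (by simp [toggle]) (by simp [toggle])
        refine Spec.seq ((ih hc₄ hm₄ hT₄ hP₃.stored).conseq fun s₅ hF₅ ⟨hm₅, T₅, hT₅, hP₅⟩ => ?_)
        have hc₅ := hc₄.frame hF₅ safe_search
        have hi₅ : s₅.reg x = i :=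
          (hF₅.reg _ hxs).trans ((hF₄.reg _ (by simp [toggle])).trans hi₃)
        have hj₅ : s₅.reg y = j :=
          (hF₅.reg _ hys).trans ((hF₄.reg _ (by simp [toggle])).trans hj₃)
        refine (toggle_spec hc₅ hm₅ (u := ⟨i, hi⟩) (v := ⟨j, hj⟩) hi₅ hj₅).conseq
          fun s₆ hF₆ hm₆ => ?_
        rw [symmDiff_symmDiff_cancel_right] at hm₆
        have hT₆ := hT₅.frame hF₆ (by simp [toggle]) (by simp [toggle]) (by simp [toggle])
        refine ⟨hm₆, T₅, ⟨?_, ?_, hT₆.get⟩, (hP₃.trans hP₅).mono ?_⟩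
        · rw [State.reg_setReg, if_neg (by omega), hT₆.len]
        · rw [State.reg_setReg, if_neg (by omega), hT₆.next]
        · rintro H ⟨b, hb, hH⟩
          rcases Nat.lt_succ_iff_lt_or_eq.1 hb with hb | hb
          · exact .inl ⟨b, hb, hH⟩
          · exact .inr (by rwa [show b = ⟨j, hj⟩ from Fin.ext hb] at hH)
      · rintro s₃ - ⟨hm₃, T₃, hT₃, hP₃⟩
        refine ⟨hm₃, T₃, ⟨?_, ?_, hT₃.get⟩, (hP₂.trans hP₃).mono ?_⟩
        · rw [State.reg_setReg, if_neg (by omega), hT₃.len]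
        · rw [State.reg_setReg, if_neg (by omega), hT₃.next]
        · rintro H ⟨a, b, ha, hH⟩
          rcases Nat.lt_succ_iff_lt_or_eq.1 ha with ha | ha
          · exact .inl ⟨a, b, ha, hH⟩
          · exact .inr ⟨b, b.2, by rwa [show a = ⟨i, hi⟩ from Fin.ext ha] at hH⟩
    · rintro s₂ - ⟨hm₂, T₂, hT₂, hP₂⟩
      refine ⟨hm₂, T₂, hT₂, (hP₁.trans hP₂).mono fun H hH => ?_⟩
      by_cases hne : E = H
      · exact .inl hne.symm
      · obtain ⟨e, he⟩ : (symmDiff E H).Nonempty := by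
          rwa [Finset.nonempty_iff_ne_empty, ← Finset.bot_eq_empty, Ne, symmDiff_eq_bot]
        induction e with
        | _ a b =>
          refine .inr ⟨a, b, a.2, ?_⟩
          have h1 : symmDiff (symmDiff E {s(a, b)}) H = (symmDiff E H).erase s(a, b) := by
            rw [symmDiff_right_comm]
            ext e
            rw [Finset.mem_symmDiff, Finset.mem_erase, Finset.mem_singleton]
            constructor
            · rintro (⟨h1, h2⟩ | ⟨rfl, h2⟩)
              · exact ⟨h2, h1⟩
              · exact absurd he h2
            · exact fun h => .inl ⟨h.2, h.1⟩
          rw [h1, Finset.card_erase_of_mem he]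
          have hH : (symmDiff E H).card ≤ c + 1 := hH
          omega

end KSets

/-! ### The whole program -/

namespace KSets

open RAM

variable {n : ℕ} {w : List ℕ} {s : State} {E : Finset (Sym2 (Fin n))} {B k d : ℕ}
  {S S' : Finset (Finset (Fin n))} {L L' : List (List (Fin n))}
  {T : List (Finset (Sym2 (Fin n)))}

/-- Compute the constants, and store the configuration without active vertices. -/
def setup : Prog :=
  .seq (.assign rN (.get aIn (.lit 0)))
  (.seq (.for rU (.reg rN) (.seq (.store aMul (.reg rU) (.reg rSq))
    (.assign rSq (.add (.reg rSq) (.reg rN)))))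
  (.seq (.assign rLen (.lit 1)) (.assign rEnd (.reg rSq))))

theorem enc_empty (j : ℕ) : enc (∅ : Finset (Sym2 (Fin n))) j = 0 := by
  simp [enc, entry]

theorem setup_spec (hw : w.getD 0 0 = n) (hn : n ≤ B) :
    Spec B setup (initState w) fun s' => Ctx n w s' ∧ Store [(∅ : Finset (Sym2 (Fin n)))] s' ∧
      s'.reg rPtr = 0 ∧ s'.reg rSrc = 0 ∧ s'.out = [] := by
  refine Spec.seq (Spec.assign (Spec.seq ?_))
  have h0 : Expr.eval (initState w) (.get aIn (.lit 0)) = n := by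
    simpa [initState] using hw
  rw [h0]
  set s₀ := (initState w).setReg rN n with hs₀
  refine Spec.for (N := n) (by simp) hn (fun s' hF => (hF.reg _ (by simp)).trans (by simp [hs₀]))
    (fun i s' => s'.reg rSq = i * n ∧ ∀ u < i, s'.arr aMul u = u * n)
    (by simp [hs₀, initState]) ?_ ?_
  · rintro i s₁ hi hF₁ hi₁ ⟨hsq, hI⟩
    have hN : s₁.reg rN = n := (hF₁.reg _ (by simp)).trans (by simp [hs₀])
    refine Spec.seq (Spec.store (Spec.assign ⟨by simp [hsq, hN, Nat.succ_mul], fun u hu => ?_⟩))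
    simp only [State.arr_setReg, State.arr_setArr, Expr.eval, hi₁, hsq, true_and]
    split
    next h => rw [h]
    next h => exact hI u (by omega)
  · rintro s₁ hF₁ ⟨hsq, hI⟩
    have hN : s₁.reg rN = n := (hF₁.reg _ (by simp)).trans (by simp [hs₀])
    have hin : s₁.arr aIn = s₀.arr aIn := hF₁.arr _ (by simp)
    have hst : s₁.arr aStore = s₀.arr aStore := hF₁.arr _ (by simp)
    have hptr : s₁.reg rPtr = s₀.reg rPtr := hF₁.reg _ (by simp)
    have hsrc : s₁.reg rSrc = s₀.reg rSrc := hF₁.reg _ (by simp)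
    have hout : s₁.out = s₀.out := hF₁.out (by simp)
    refine Spec.seq (Spec.assign (Spec.assign ⟨⟨by simp [hN], by simp [hsq], by simpa using hI, ?_⟩,
      ⟨by simp, by simp [hsq], ?_⟩, ?_, ?_, ?_⟩))
    · intro i
      simp [hin, hs₀, initState]
    · intro i hi j hj
      simp only [List.length_singleton, Nat.lt_one_iff] at hi
      subst hi
      simp [hst, hs₀, initState, enc_empty]
    · simp [hptr, hs₀, initState]
    · simp [hsrc, hs₀, initState]
    · simp [hout, hs₀, initState]

/-- Make the next stored configuration the current one. -/
def load : Prog :=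
  .for rJ (.reg rSq) (.seq (.store aMat (.reg rJ) (.get aStore (.reg rSrc)))
    (.assign rSrc (.add (.reg rSrc) (.lit 1))))

theorem load_spec (hc : Ctx n w s) (hT : Store T s) (hn : n * n ≤ B) {i : ℕ} (hi : i < T.length)
    (hsrc : s.reg rSrc = i * (n * n)) :
    Spec B load s fun s' => Mat T[i] s' ∧ s'.reg rSrc = (i + 1) * (n * n) := by
  refine Spec.for (N := n * n) (by simp) hn (fun s' hF => (hF.reg _ (by simp)).trans hc.sq)
    (fun j s' => s'.reg rSrc = i * (n * n) + j ∧ ∀ j' < j, s'.arr aMat j' = enc T[i] j')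
    (by simp [hsrc]) ?_ ?_
  · rintro j s₁ hj hF₁ hj₁ ⟨hsrc₁, hI⟩
    have hst : s₁.arr aStore = s.arr aStore := hF₁.arr _ (by simp)
    refine Spec.seq (Spec.store (Spec.assign ⟨by simp [hsrc₁, Nat.add_assoc], fun j' hj' => ?_⟩))
    simp only [State.arr_setReg, State.arr_setArr, Expr.eval, hj₁, hsrc₁, true_and]
    split
    next h => rw [h, hst, hT.get i hi j hj]
    next h => exact hI j' (by omega)
  · rintro s₁ - ⟨h1, h2⟩
    exact ⟨h2, by rw [h1, Nat.succ_mul]⟩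

/-- Search the neighbourhoods of all stored configurations, including those stored meanwhile. -/
noncomputable def explore (k d c : ℕ) : Prog :=
  .loop (.sub (.reg rLen) (.reg rPtr))
    (.seq load (.seq (search k d c) (.assign rPtr (.add (.reg rPtr) (.lit 1)))))

/-- Every configuration differing in at most `c` pairs from one of the first `m` members of the list
has been visited. -/
def Explored (k d c : ℕ) (S : Finset (Finset (Fin n))) (m : ℕ)
    (T : List (Finset (Sym2 (Fin n)))) : Prop :=
  ∀ i (hi : i < T.length), i < m → ∀ H, (symmDiff T[i] H).card ≤ c → Visited k d S (i + 1) T H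

/-- A round of the loop needs a stored configuration not treated yet, so there are at most
`n + numSolutions k d S` rounds. -/
theorem explore_spec (hv : Valid n B k S S' L L') (hB : n + numSolutions k d S ≤ B) (c : ℕ)
    (hc : Ctx n (inputWord n L L') s) (hT : Store T s) (hS : Stored k d S T) (hne : T ≠ [])
    (hptr : s.reg rPtr = 0) (hsrc : s.reg rSrc = 0) (hout : s.out = []) :
    Spec B (explore k d c) s fun s' => Ctx n (inputWord n L L') s' ∧ s'.out = [] ∧
      ∃ T', Store T' s' ∧ Stored k d S T' ∧ T' ≠ [] ∧ Explored k d c S T'.length T' := by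
  refine Spec.loop (fun i s' => Ctx n (inputWord n L L') s' ∧ s'.out = [] ∧ s'.reg rPtr = i ∧
    s'.reg rSrc = i * (n * n) ∧ ∃ T', Store T' s' ∧ Stored k d S T' ∧ T' ≠ [] ∧
      Explored k d c S i T') ?_ ?_ ?_
  · exact ⟨hc, hout, hptr, by simp [hsrc], T, hT, hS, hne, fun i _ h => by omega⟩
  · rintro i s₁ ⟨hc₁, hout₁, hptr₁, hsrc₁, T₁, hT₁, hS₁, hne₁, hE₁⟩ hnz
    simp only [Expr.eval, hT₁.len, hptr₁] at hnz
    have hi : i < T₁.length := by omega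
    refine ⟨by have := hS₁.length_le; omega, Spec.seq ((load_spec hc₁ hT₁ hv.sq_le hi hsrc₁).conseq
      fun s₂ hF₂ ⟨hm₂, hsrc₂⟩ => ?_)⟩
    have hc₂ := hc₁.frame hF₂ (by simp [Safe, load])
    have hT₂ := hT₁.frame hF₂ (by simp [load]) (by simp [load]) (by simp [load])
    have hptr₂ : s₂.reg rPtr = i := (hF₂.reg _ (by simp [load])).trans hptr₁
    have hout₂ : s₂.out = [] := (hF₂.out (by simp [load])).trans hout₁
    refine Spec.seq ((search_spec hv hB c hc₂ hm₂ hT₂ hS₁).conseq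
      fun s₃ hF₃ ⟨_, T₃, hT₃, hP⟩ => Spec.assign ?_)
    have hptr₃ : s₃.reg rPtr = i :=
      (hF₃.reg _ fun h => by have := mem_regs_search h; omega).trans hptr₂
    have hsrc₃ : s₃.reg rSrc = (i + 1) * (n * n) :=
      (hF₃.reg _ fun h => by have := mem_regs_search h; omega).trans hsrc₂
    refine ⟨(hc₂.frame hF₃ safe_search).setReg (by norm_num), (hF₃.out silent_search).trans hout₂,
      by simp [hptr₃], by simp [hsrc₃], T₃, ⟨by simpa using hT₃.len, by simpa using hT₃.next,
        hT₃.get⟩, hP.stored, ?_, ?_⟩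
    · rintro rfl
      exact hne₁ (List.prefix_nil.1 hP.pre)
    · intro i' hi' hlt H hH
      have hi₁ : i' < T₁.length := by omega
      rw [← hP.pre.getElem hi₁] at hH
      rcases Nat.lt_succ_iff_lt_or_eq.1 hlt with h | rfl
      · exact (hE₁ i' hi₁ h H hH).mono le_rfl hP.pre
      · exact (hP.visited H hH).mono hi (List.prefix_refl _)
  · rintro i s₁ ⟨hc₁, hout₁, hptr₁, -, T₁, hT₁, hS₁, hne₁, hE₁⟩ hz
    simp only [Expr.eval, hT₁.len, hptr₁] at hz
    exact ⟨hc₁, hout₁, T₁, hT₁, hS₁, hne₁, fun i' hi' _ => hE₁ i' hi' (by omega)⟩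

/-- Write the stored configurations with all vertices active, omitting the loops. -/
def output : Prog :=
  .seq (.assign rQ (.lit 0))
    (.for rI (.reg rLen) (.for rU (.reg rN) (.for rV (.reg rN)
      (.seq (.ite (.sub (.add (.reg rI) (.lit 1)) (.reg rN))
        (.ite (absDiff (.reg rU) (.reg rV)) (.emit (.get aStore (.reg rQ))) (.emit (.lit 0))) .nop)
      (.assign rQ (.add (.reg rQ) (.lit 1)))))))

open Classical in
theorem output_spec (hc : Ctx n w s) (hT : Store T s) (hn : n ≤ B) (hTB : T.length ≤ B)
    (hout : s.out = []) :
    Spec B output s fun s' => s'.out = (List.range T.length).flatMap fun i =>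
      if n ≤ i then (List.range n).flatMap fun u => (List.range n).map fun v =>
        if u = v then 0 else entry (T.getD i ∅) u v else [] := by
  refine Spec.seq (Spec.assign ?_)
  have hc₀ := hc.setReg (x := rQ) (v := 0) (by norm_num)
  have hT₀ : Store T (s.setReg rQ 0) := ⟨by simpa using hT.len, by simpa using hT.next, hT.get⟩
  refine Spec.for (N := T.length) (by simp) hTB (fun s' hF => (hF.reg _ (by simp)).trans hT₀.len)
    (fun m s' => s'.reg rQ = m * (n * n) ∧ s'.out = (List.range m).flatMap fun i =>
      if n ≤ i then (List.range n).flatMap fun u => (List.range n).map fun v =>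
        if u = v then 0 else entry (T.getD i ∅) u v else []) (by simp [hout]) ?_
    (fun _ _ h => h.2)
  rintro i s₁ hi hF₁ hi₁ ⟨hq₁, ho₁⟩
  have hc₁ := hc₀.frame hF₁ (by simp [Safe])
  have hT₁ := hT₀.frame hF₁ (by simp) (by simp) (by simp)
  refine Spec.for (N := n) (by simp) hn (fun s' hF => (hF.reg _ (by simp)).trans hc₁.num)
    (fun m s' => s'.reg rQ = i * (n * n) + m * n ∧ s'.out = s₁.out ++
      if n ≤ i then (List.range m).flatMap fun u => (List.range n).map fun v =>
        if u = v then 0 else entry (T.getD i ∅) u v else []) (by simp [hq₁]) ?_ ?_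
  · rintro u s₂ hu hF₂ hu₂ ⟨hq₂, ho₂⟩
    have hc₂ := hc₁.frame hF₂ (by simp [Safe])
    have hT₂ := hT₁.frame hF₂ (by simp) (by simp) (by simp)
    have hi₂ : s₂.reg rI = i := (hF₂.reg _ (by simp)).trans hi₁
    refine Spec.for (N := n) (by simp) hn (fun s' hF => (hF.reg _ (by simp)).trans hc₂.num)
      (fun m s' => s'.reg rQ = i * (n * n) + (u * n + m) ∧ s'.out = s₂.out ++
        if n ≤ i then (List.range m).map fun v =>
          if u = v then 0 else entry (T.getD i ∅) u v else []) (by simp [hq₂]) ?_ ?_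
    · rintro v s₃ hv hF₃ hv₃ ⟨hq₃, ho₃⟩
      have hi₃ : s₃.reg rI = i := (hF₃.reg _ (by simp)).trans hi₂
      have hu₃ : s₃.reg rU = u := (hF₃.reg _ (by simp)).trans hu₂
      have hN₃ : s₃.reg rN = n := (hF₃.reg _ (by simp)).trans hc₂.num
      have hget : s₃.arr aStore (s₃.reg rQ) = entry (T.getD i ∅) u v := by
        rw [hF₃.arr _ (by simp), hq₃, hT₂.get i hi _ (mul_add_lt_sq hu hv), enc_mul_add _ hv,
          List.getD_eq_getElem _ _ hi]
      refine Spec.seq (Spec.ite (fun h => Spec.ite (fun h' => Spec.emit (Spec.assign ?_))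
        fun h' => Spec.emit (Spec.assign ?_)) fun h => Spec.nop (Spec.assign ?_))
      · rw [Ne, eval_absDiff] at h'
        simp only [Expr.eval, hi₃, hN₃, hu₃, hv₃] at h h'
        have hni : n ≤ i := by omega
        refine ⟨by simp [hq₃, Nat.add_assoc], ?_⟩
        simp [hni, List.range_succ, ho₃, hget, h']
      · rw [eval_absDiff] at h'
        simp only [Expr.eval, hi₃, hN₃, hu₃, hv₃] at h h'
        have hni : n ≤ i := by omega
        refine ⟨by simp [hq₃, Nat.add_assoc], ?_⟩
        simp [hni, List.range_succ, ho₃, h']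
      · simp only [Expr.eval, hi₃, hN₃] at h
        have hni : ¬ n ≤ i := by omega
        refine ⟨by simp [hq₃, Nat.add_assoc], ?_⟩
        simp [hni, ho₃]
    · rintro s₃ - ⟨hq₃, ho₃⟩
      refine ⟨by simp [hq₃, Nat.succ_mul], ?_⟩
      rw [State.out_setReg, ho₃, ho₂]
      split <;> simp [List.range_succ]
  · rintro s₂ - ⟨hq₂, ho₂⟩
    refine ⟨by simp [hq₂, Nat.succ_mul], ?_⟩
    rw [State.out_setReg, ho₂, ho₁]
    simp [List.range_succ]

/-! ### Correctness of the enumeration -/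

theorem stored_singleton_empty (hk : 2 ≤ k) :
    Stored k d S [(∅ : Finset (Sym2 (Fin n)))] := by
  have ha : active (∅ : Finset (Sym2 (Fin n))) = ∅ := by simp [active]
  refine ⟨fun i hi => ?_, fun i hi => ?_, by simp⟩
  · simp only [List.getElem_singleton]
    refine ⟨fun x y h => by simp [graph_adj] at h, fun v => by simp [graph_adj],
      fun h => by simp [ha] at h, fun X hX hXk => ?_⟩
    rw [ha, Finset.subset_empty] at hX
    simp [hX] at hXk
    omega
  · simp only [List.length_singleton, Nat.lt_one_iff] at hi
    subst hi
    simp [ha]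

/-- Once all neighbourhoods have been searched, all full solutions are in the list: the partial
solutions extend up to a full one, and any full solution leads to any other. -/
theorem Explored.mem_of_good (hk : 2 ≤ k) (hS : Stored k d S T) (hne : T ≠ [])
    (hE : Explored k d (toggleBound k d) S T.length T) (hn : 0 < n) (hg : Good k d S E)
    (ha : active E = Finset.univ) : E ∈ T := by
  have : Nonempty (Fin n) := ⟨⟨0, hn⟩⟩
  have hlen : 0 < T.length := List.length_pos_iff.2 hne
  have hnT : n < T.length := by
    by_contra hcon
    have hcard := hS.card (T.length - 1) (by omega)
    have hnuniv : active T[T.length - 1] ≠ Finset.univ := by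
      intro e
      rw [e, Finset.card_univ, Fintype.card_fin] at hcard
      omega
    obtain ⟨H, hH, hHc, hHd⟩ := (hS.good (T.length - 1) (by omega)).exists_extension hk
      (hg.isSolution ha) hnuniv
    have hmem := hE (T.length - 1) (by omega) (by omega) H hHd hH fun j h1 h2 => by omega
    obtain ⟨i, hi, rfl⟩ := List.mem_iff_getElem.1 hmem
    have := hS.card i hi
    omega
  have key : ∀ m, ∀ F ∈ T.drop n, (symmDiff F E).card ≤ m → E ∈ T := by
    intro m
    induction m with
    | zero =>
      intro F hF hm
      have h0 : symmDiff F E = ⊥ := Finset.card_eq_zero.1 (Nat.le_zero.1 hm)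
      exact symmDiff_eq_bot.1 h0 ▸ List.mem_of_mem_drop hF
    | succ m ih =>
      intro F hF hm
      have hF' := hS.mem_drop.1 hF
      by_cases hFE : F = E
      · exact hFE ▸ hF'.1
      obtain ⟨M, hM, hMa, hMd, hMlt⟩ :=
        (hS.good_of_mem hF'.1).exists_closer hk hg hF'.2 ha hFE
      refine ih M (hS.mem_drop.2 ⟨?_, hMa⟩) (by omega)
      obtain ⟨i, hi, rfl⟩ := List.mem_iff_getElem.1 hF
      rw [List.length_drop] at hi
      rw [List.getElem_drop] at hMd
      refine hE (n + i) (by omega) (by omega) M hMd hM fun j h1 _ => ?_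
      rw [hMa, Finset.card_univ, Fintype.card_fin]
      omega
  exact key _ T[n] (hS.mem_drop.2 ⟨List.getElem_mem _, by
    rw [← Finset.card_eq_iff_eq_univ, hS.card n hnT, Fintype.card_fin]; omega⟩) le_rfl

theorem isSolution_iff (hc : IsComplete k S S') (G : SimpleGraph (Fin n)) :
    IsSolution k d S G ↔
      G.Connected ∧ (∀ v, (G.neighborSet v).ncard ≤ d) ∧ Consistent G k S S' := by
  classical
  have hconn : ConnOn G Finset.univ ↔ G.Connected := by
    rw [connOn_iff_connected_induce, Finset.coe_univ]
    exact (SimpleGraph.induceUnivIso G).connected_iff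
  have hdeg : MaxDegLE d G ↔ ∀ v, (G.neighborSet v).ncard ≤ d := by
    refine forall_congr' fun v => ?_
    rw [Set.ncard_eq_toFinset_card']
    have : (Finset.univ.filter (G.Adj v)) = (G.neighborSet v).toFinset := by ext; simp
    rw [← this]
  have hcons : (∀ X : Finset (Fin n), X.card = k → (ConnOn G X ↔ X ∈ S)) ↔
      Consistent G k S S' := by
    simp only [Consistent, connectedKSets, disconnectedKSets, Set.ext_iff, Set.mem_ofPred_eq,
      Finset.mem_coe, ← connOn_iff_connected_induce]
    constructor
    · refine fun h => ⟨fun X => ⟨fun hX => (h X hX.1).1 hX.2, fun hX => ?_⟩,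
        fun X => ⟨fun hX => ?_, fun hX => ?_⟩⟩
      · have := (hc.2 X).1 (.inl hX)
        exact ⟨this, (h X this).2 hX⟩
      · exact ((hc.2 X).2 hX.1).resolve_left fun e => hX.2 ((h X hX.1).2 e)
      · have := (hc.2 X).1 (.inr hX)
        exact ⟨this, fun e => Finset.disjoint_left.1 hc.1 ((h X this).1 e) hX⟩
    · exact fun h X hX => ⟨fun e => (h.1 X).1 ⟨hX, e⟩, fun e => ((h.1 X).2 e).2⟩
  rw [← hconn, ← hdeg, ← hcons]
  exact ⟨fun h => ⟨h.conn, h.deg, h.cons⟩, fun h => ⟨h.1, h.2.1, h.2.2⟩⟩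

open Classical in
theorem graphWord_graph (E : Finset (Sym2 (Fin n))) :
    graphWord (graph E) = (List.range n).flatMap fun u => (List.range n).map fun v =>
      if u = v then 0 else entry E u v := by
  have hr : List.range n = (List.finRange n).map Fin.val := by
    apply List.ext_getElem <;> simp
  rw [graphWord, hr, List.flatMap_map]
  refine congrArg (fun f => List.flatMap f (List.finRange n)) (funext fun u => ?_)
  rw [List.map_map]
  refine List.map_congr_left fun v _ => ?_
  simp only [Function.comp_apply, graph_adj, entry_fin, ← Fin.ext_iff]
  by_cases h : u = v <;> simp [h]

theorem flatMap_range_eq_drop {α β : Type*} (l : List α) (a : α) (m : ℕ) (f : α → List β) :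
    ((List.range l.length).flatMap fun i => if m ≤ i then f (l.getD i a) else []) =
      (l.drop m).flatMap f := by
  induction l using List.reverseRecOn with
  | nil => simp
  | append_singleton l b ih =>
    rw [List.length_append, List.length_singleton, List.range_succ, List.flatMap_append,
      List.drop_append, List.flatMap_append, ← ih]
    congr 1
    · rw [List.flatMap_def, List.flatMap_def]
      refine congrArg List.flatten (List.map_congr_left fun i hi => ?_)
      rw [List.getD_append _ _ _ _ (List.mem_range.1 hi)]
    · by_cases h : m ≤ l.length
      · simp [h]
      · have : m - l.length ≠ 0 := by omega
        obtain ⟨j, hj⟩ := Nat.exists_eq_succ_of_ne_zero this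
        simp [h, hj]

theorem length_graphWord (G : SimpleGraph (Fin n)) : (graphWord G).length = n * n := by
  simp [graphWord, List.length_flatMap]

/-- The enumeration program. -/
noncomputable def enumerate (k d : ℕ) : Prog :=
  .seq setup (.seq (explore k d (toggleBound k d)) output)

end KSets

namespace KSets

open RAM

variable {n : ℕ} {k d B : ℕ} {S S' : Finset (Finset (Fin n))} {L L' : List (List (Fin n))}
  {T : List (Finset (Sym2 (Fin n)))}

theorem IsListing.length_le (hL : IsListing S L) (hc : ∀ X ∈ S, X.card = k) :
    L.length ≤ n ^ k := by
  have h : (L.map List.toFinset).toFinset ⊆ Finset.univ.powersetCard k := fun X hX => by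
    rw [List.mem_toFinset, hL.2.2] at hX
    exact Finset.mem_powersetCard.2 ⟨Finset.subset_univ _, hc X hX⟩
  calc L.length = (L.map List.toFinset).toFinset.card := by
        rw [List.toFinset_card_of_nodup hL.2.1, List.length_map]
    _ ≤ n.choose k := by simpa using Finset.card_le_card h
    _ ≤ n ^ k := Nat.choose_le_pow n k

theorem length_flatMap_graphWord (Gs : List (SimpleGraph (Fin n))) :
    (Gs.flatMap graphWord).length = Gs.length * (n * n) := by
  simp [List.length_flatMap, length_graphWord]

theorem Stored.nodup_map_graph (hS : Stored k d S T) : ((T.drop n).map graph).Nodup := by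
  refine (hS.nodup.sublist (List.drop_sublist n T)).map_on fun E hE F hF h => ?_
  exact config_ext ((hS.mem_drop.1 hE).2.trans (hS.mem_drop.1 hF).2.symm) fun x y => by rw [h]

theorem Explored.mem_map_graph_iff (hk : 2 ≤ k) (hS : Stored k d S T) (hne : T ≠ [])
    (hE : Explored k d (toggleBound k d) S T.length T) (hn : 0 < n) (G : SimpleGraph (Fin n)) :
    G ∈ (T.drop n).map graph ↔ IsSolution k d S G := by
  have : Nonempty (Fin n) := ⟨⟨0, hn⟩⟩
  rw [List.mem_map]
  constructor
  · rintro ⟨E, hE', rfl⟩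
    have h := hS.mem_drop.1 hE'
    exact (hS.good_of_mem h.1).isSolution h.2
  · intro h
    have ha := active_config G Finset.univ
    refine ⟨config G Finset.univ, hS.mem_drop.2 ⟨?_, ha⟩,
      graph_config_eq fun x _ _ => Finset.mem_univ x⟩
    exact hE.mem_of_good hk hS hne hn (h.good_config h.conn) ha

/-- The search finds every full solution. -/
theorem Explored.length_drop (hk : 2 ≤ k) (hS : Stored k d S T) (hne : T ≠ [])
    (hE : Explored k d (toggleBound k d) S T.length T) (hn : 0 < n) :
    (T.drop n).length = numSolutions k d S := by
  classical
  refine le_antisymm hS.length_drop_le ?_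
  rw [← List.toFinset_card_of_nodup (hS.nodup.sublist (List.drop_sublist n T)), numSolutions]
  refine Finset.card_le_card fun E h => ?_
  have h := (Finset.mem_filter.1 h).2
  exact List.mem_toFinset.2 (hS.mem_drop.2 ⟨hE.mem_of_good hk hS hne hn h.1 h.2, h.2⟩)

/-- The length of the store is at most a polynomial in `n` plus the output size. The summand `1` is
needed for `n = 0`, where the only full configuration has an empty word. -/
theorem add_numSolutions_le :
    n + numSolutions k d S ≤ n ^ k + n * n + n + 1 + numSolutions k d S * (n * n) := by
  rcases Nat.eq_zero_or_pos n with rfl | hn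
  · have : numSolutions k d S ≤ 1 := by
      rw [numSolutions]
      refine (Finset.card_le_univ _).trans ?_
      simp
    generalize 0 ^ k = a
    omega
  · have := Nat.le_mul_of_pos_right (numSolutions k d S) (Nat.mul_pos hn hn)
    omega

theorem enumerate_spec (hk : 2 ≤ k) (hv : Valid n B k S S' L L')
    (hB : n + numSolutions k d S ≤ B) :
    Spec B (enumerate k d) (initState (inputWord n L L')) fun s' =>
      ∃ T : List (Finset (Sym2 (Fin n))), Stored k d S T ∧ T ≠ [] ∧
        Explored k d (toggleBound k d) S T.length T ∧
        s'.out = ((T.drop n).map graph).flatMap graphWord := by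
  refine Spec.seq ((setup_spec (by simp [inputWord]) hv.le).conseq
    fun s₁ _ ⟨hc₁, hT₁, hptr₁, hsrc₁, hout₁⟩ => Spec.seq ((explore_spec hv hB _ hc₁ hT₁
      (stored_singleton_empty hk) (by simp) hptr₁ hsrc₁ hout₁).conseq ?_))
  rintro s₂ - ⟨hc₂, hout₂, T, hT, hS, hne, hE⟩
  refine (output_spec hc₂ hT hv.le (hS.length_le.trans hB) hout₂).conseq
    fun s₃ _ h => ⟨T, hS, hne, hE, ?_⟩
  rw [h, List.flatMap_map, ← flatMap_range_eq_drop T ∅]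
  simp only [graphWord_graph]

end KSets

theorem mainTheorem4 (k d : ℕ) (hk : 2 ≤ k) (hd : 1 ≤ d) :
    ∃ (p : RAM.Prog) (B : MvPolynomial (Fin 2) ℕ),
      ∀ (n : ℕ) (S S' : Finset (Finset (Fin n))), KSets.IsComplete k S S' →
        ∀ L L' : List (List (Fin n)), KSets.IsListing S L → KSets.IsListing S' L' →
          ∃ (s : RAM.State) (t : ℕ) (Gs : List (SimpleGraph (Fin n))),
            p.Run (RAM.initState (KSets.inputWord n L L')) s t ∧
            s.out = Gs.flatMap KSets.graphWord ∧
            Gs.Nodup ∧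
            (∀ G : SimpleGraph (Fin n), G ∈ Gs ↔
              G.Connected ∧ (∀ v, (G.neighborSet v).ncard ≤ d) ∧ KSets.Consistent G k S S') ∧
            t ≤ MvPolynomial.eval ![n, s.out.length] B := by
  obtain ⟨P, hP⟩ := (KSets.enumerate k d).exists_polynomial_bound
  let q : MvPolynomial (Fin 2) ℕ := .X 0 ^ k + .X 0 * .X 0 + .X 0 + 1 + .X 1
  have hq : ∀ n m : ℕ, MvPolynomial.eval ![n, m] (P.eval₂ MvPolynomial.C q) =
      P.eval (n ^ k + n * n + n + 1 + m) := fun n m => by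
    rw [Polynomial.hom_eval₂, Polynomial.eval, Subsingleton.elim (RingHom.comp _ _) (RingHom.id ℕ)]
    simp [q]
  refine ⟨KSets.enumerate k d, P.eval₂ MvPolynomial.C q, fun n S S' hc L L' hL hL' => ?_⟩
  have hl := hL.length_le fun X hX => (hc.2 X).1 (.inl hX)
  have hl' := hL'.length_le fun X hX => (hc.2 X).1 (.inr hX)
  obtain ⟨s, t, hrun, ht, T, hS, hne, hE, hout⟩ := KSets.enumerate_spec hk
    (B := n ^ k + n * n + n + 1 + KSets.numSolutions k d S * (n * n))
    ⟨hk, hc, hL, hL', by omega, by omega, by omega⟩ (KSets.add_numSolutions_le (k := k) (d := d))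
  have hlen : s.out.length = (T.drop n).length * (n * n) := by
    rw [hout, KSets.length_flatMap_graphWord, List.length_map]
  have hlen' : s.out.length = KSets.numSolutions k d S * (n * n) := by
    rcases Nat.eq_zero_or_pos n with rfl | hn
    · simp [hlen]
    · rw [hlen, hE.length_drop hk hS hne hn]
  rw [hP, ← hlen', ← hq] at ht
  rcases Nat.eq_zero_or_pos n with rfl | hn
  · -- The search finds the graph without vertices here, which does not count as connected; its word
    -- is empty.
    refine ⟨s, t, [], hrun, List.eq_nil_of_length_eq_zero (by simp [hlen]), List.nodup_nil,
      fun G => ⟨fun h => by simp at h, fun h => ?_⟩, ht⟩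
    exact h.1.nonempty.elim fun v => v.elim0
  · exact ⟨s, t, _, hrun, hout, hS.nodup_map_graph, fun G =>
      (hE.mem_map_graph_iff hk hS hne hn G).trans (KSets.isSolution_iff hc G), ht⟩
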